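/- **Setting.** Let $\mathcal M=(\mathcal S,\mathcal A,H,P,\mathcal R)$ be an episodic MDP with finite state space of size $S$, finite nonempty action space of size $A$, horizon $H\ge 1$, transition kernels $P_h(\cdot\mid s,a)$, and, for each step $h\in\{1,\dots,H\}$ and state $s$, a law $\mathcal R_h(s)$ on $[0,1]^{\mathcal A}$ of the reward vector of all actions (whose coordinates may be dependent). At step $h$ in state $s_h$ the agent first observes $\boldsymbol R_h\sim\mathcal R_h(s_h)$, then plays $a_h$, collects $\boldsymbol R_h(a_h)$, and moves to $s_{h+1}\sim P_h(\cdot\mid s_h,a_h)$; the rewards and next states are independent of the past given $s_h$, respectively $(s_h,a_h)$. A reward-lookahead policy $\pi$ is a measurable map from (step, state, observed reward vector) to distributions on $\mathcal A$. Its value is $V^{\pi}_h(s)=\mathbb E\big[\sum_{t=h}^H \boldsymbol R_t(a_t)\mid s_h=s,\pi\big]$, and $V^*_h(s)=\sup_\pi V^\pi_h(s)$. Episodes are numbered $k=1,2,\dots$; the initial states $s^k_1$ are arbitrary and may depend on the past. If the policy $\pi^k$ is played in episode $k$, the regret is $\mathrm{Reg}^R(K)=\sum_{k=1}^K\big(V^*_1(s_1^k)-V^{\pi^k}_1(s_1^k)\big)$.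 **Algorithm MVP-RL** with parameter $\delta\in(0,1)$. Let $n^{k}_h(s)$ and $n^k_h(s,a)$ be the numbers of episodes among $1,\dots,k$ in which $s$, respectively $(s,a)$, was visited at step $h$; let $\hat P^{k}_h(\cdot\mid s,a)$ be the empirical transition frequencies (zero if $n^k_h(s,a)=0$), and let $\hat{\mathcal R}^k_h(s)$ be the empirical distribution of the reward vectors observed at step $h$ in $s$ during those episodes. For weights $p$ on $\mathcal S$ put $\mathrm{Var}_p(V)=\sum_s p(s)V(s)^2-\big(\sum_s p(s)V(s)\big)^2$, and let $$L^k=\ln\frac{144S^2AH^2k^3(k+1)}{\delta},\qquad b^r_{k,h}(s)=3\sqrt{\frac{A L^k}{2\max\{n^{k-1}_h(s),1\}}},$$ $$b^p_{k,h}(s,a)=\min\Big\{\tfrac{20}{3}\sqrt{\tfrac{\mathrm{Var}_{\hat P^{k-1}_h(\cdot\mid s,a)}(\bar V^k_{h+1})\,L^k}{\max\{n^{k-1}_h(s,a),1\}}}+\tfrac{400}{9}\tfrac{H L^k}{\max\{n^{k-1}_h(s,a),1\}},\;H\Big\}.$$ Before episode $k$ the algorithm sets $\bar V^k_{H+1}=0$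 and, for $h=H,\dots,1$, with $$Q^k_h(s,\boldsymbol R,a)=\boldsymbol R(a)+b^p_{k,h}(s,a)+\sum_{s'}\hat P^{k-1}_h(s'\mid s,a)\bar V^k_{h+1}(s'),$$ it sets $\bar V^k_h(s)=H$ if $n^{k-1}_h(s)=0$, and otherwise $$\bar V^k_h(s)=\min\Big\{\mathbb E_{\boldsymbol R\sim\hat{\mathcal R}^{k-1}_h(s)}\big[\max_a Q^k_h(s,\boldsymbol R,a)\big]+b^r_{k,h}(s),\;H\Big\}.$$ In episode $k$ it plays the policy $\pi^k_h(s,\boldsymbol R)\in\arg\max_a Q^k_h(s,\boldsymbol R,a)$, with ties broken arbitrarily (measurably, as a function of the reward vector and the past data). **Theorem.** There is an absolute constant $C>0$ such that, for every such MDP, every $\delta\in(0,1)$ and every run of MVP-RL with parameter $\delta$, with probability at least $1-\delta$, simultaneously for all $K\ge 1$, $$\mathrm{Reg}^R(K)\le C\left(\sqrt{H^3SAK}\,\ln\frac{SAHK}{\delta}+H^3S^2A\Big(\ln\frac{SAHK}{\delta}\Big)^2\right).$$ -/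

import Mathlib

open MeasureTheory ProbabilityTheory
open scoped ENNReal

noncomputable section

namespace RewardLookahead

variable {S A Ω : Type*}

/-! ### Environments, reward-lookahead policies and their values

Steps of an episode are numbered `1, …, H`; the components of the objects below at other
indices play no role. -/

/-- An episodic tabular MDP `(S, A, H, P, R)`. `rewardLaw h s` is the joint law, at step `h` and
state `s`, of the reward vector of all the actions (which need not be independent). -/
structure MDP (S A : Type*) [MeasurableSpace S] [MeasurableSpace A] where
  H : ℕ
  one_le_H : 1 ≤ H
  P : ℕ → Kernel (S × A) S
  rewardLaw : ℕ → Kernel S (A → ℝ)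
  markov_P : ∀ h, IsMarkovKernel (P h)
  markov_rewardLaw : ∀ h, IsMarkovKernel (rewardLaw h)
  reward_mem : ∀ h s, ∀ᵐ r ∂(rewardLaw h s), ∀ a, r a ∈ Set.Icc (0 : ℝ) 1

/-- A (randomized, Markovian) reward-lookahead policy: at step `h`, state `s` and observed reward
vector `r`, the action is drawn from `act h (s, r)`. -/
structure Policy (S A : Type*) [MeasurableSpace S] [MeasurableSpace A] where
  act : ℕ → Kernel (S × (A → ℝ)) A
  markov : ∀ h, IsMarkovKernel (act h)

/-- A deterministic reward-lookahead policy. -/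
structure DetPolicy (S A : Type*) [MeasurableSpace A] where
  act : ℕ → S → (A → ℝ) → A
  measurable_act : ∀ h s, Measurable (act h s)

/-- A deterministic policy, seen as a policy. -/
def DetPolicy.toPolicy [MeasurableSpace S] [Countable S] [MeasurableSingletonClass S]
    [MeasurableSpace A] (π : DetPolicy S A) : Policy S A where
  act h := Kernel.deterministic (fun p : S × (A → ℝ) => π.act h p.1 p.2)
    (measurable_from_prod_countable_right (fun s => π.measurable_act h s))
  markov _ := inferInstance

namespace MDP

variable [MeasurableSpace S] [MeasurableSpace A] (M : MDP S A)

/-- `returnLaw π n h s` is the law of the sum of the rewards collected by `π` in the `n` steps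
`h, …, h + n - 1`, starting from `s` at step `h`. In each step the reward vector is drawn from
`rewardLaw h s`, then the action from `π`, then the next state from `P h (s, a)`, and the interaction
continues from there; a point `y` below is `(((reward vector, action), next state), later return)`. -/
def returnLaw (π : Policy S A) : ℕ → ℕ → Kernel S ℝ
  | 0, _ => Kernel.const S (Measure.dirac 0)
  | n + 1, h =>
    (((M.rewardLaw h ⊗ₖ π.act h)
        ⊗ₖ (M.P h).comap (fun x : S × ((A → ℝ) × A) => (x.1, x.2.2)) (by fun_prop))
        ⊗ₖ (returnLaw π n (h + 1)).comap
            (fun x : S × (((A → ℝ) × A) × S) => x.2.2) (by fun_prop)).map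
      (fun y : (((A → ℝ) × A) × S) × ℝ => y.1.1.1 y.1.1.2 + y.2)

/-- The value of `π` from step `h` and state `s`: its expected cumulative reward in the steps
`h, …, H`. -/
def value (π : Policy S A) (h : ℕ) (s : S) : ℝ :=
  ∫ x, x ∂(M.returnLaw π (M.H + 1 - h) h s)

/-- The optimal value over all reward-lookahead policies. -/
def optValue (h : ℕ) (s : S) : ℝ := ⨆ π : Policy S A, M.value π h s

end MDP

/-! ### The data collected by a learner -/

/-- The data of an infinite sequence of episodes `k = 1, 2, …`: `state k h` is the state at step `h`
of episode `k` (for `h ≤ H + 1`), `rew k h` the reward vector of all the actions observed there, and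
`act k h` the action played. -/
structure Trace (S A : Type*) where
  state : ℕ → ℕ → S
  rew : ℕ → ℕ → A → ℝ
  act : ℕ → ℕ → A

namespace Trace

variable (ξ : Trace S A)

open Classical in
/-- The episodes among `1, …, k` in which `s` is visited at step `h`. -/
def visitsS (k h : ℕ) (s : S) : Finset ℕ :=
  (Finset.Icc 1 k).filter (fun j => ξ.state j h = s)

open Classical in
/-- The episodes among `1, …, k` in which `(s, a)` is visited at step `h`. -/
def visitsSA (k h : ℕ) (s : S) (a : A) : Finset ℕ :=
  (Finset.Icc 1 k).filter (fun j => ξ.state j h = s ∧ ξ.act j h = a)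

/-- The visit count of the state `s` at step `h`. -/
def nS (k h : ℕ) (s : S) : ℕ := (ξ.visitsS k h s).card

/-- The visit count of the pair `(s, a)` at step `h`. -/
def nSA (k h : ℕ) (s : S) (a : A) : ℕ := (ξ.visitsSA k h s a).card

open Classical in
/-- The empirical transition kernel (zero where there is no data). -/
def empP (k h : ℕ) (s : S) (a : A) (s' : S) : ℝ :=
  (((ξ.visitsSA k h s a).filter (fun j => ξ.state j (h + 1) = s')).card : ℝ) / ξ.nSA k h s a

/-- The expectation of `f` under the empirical distribution of the reward vector of all actions. -/
def empR (k h : ℕ) (s : S) (f : (A → ℝ) → ℝ) : ℝ :=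
  (∑ j ∈ ξ.visitsS k h s, f (ξ.rew j h)) / ξ.nS k h s

end Trace

/-! ### The algorithm MVP-RL -/

/-- The expectation of `V` for the weights `p`. -/
def mean [Fintype S] (p V : S → ℝ) : ℝ := ∑ s, p s * V s

/-- The variance of `V` for the weights `p`. -/
def var [Fintype S] (p V : S → ℝ) : ℝ := ∑ s, p s * V s ^ 2 - (∑ s, p s * V s) ^ 2

section Algorithm

variable [Fintype S] [Fintype A] (H : ℕ) (δ : ℝ) (ξ : Trace S A)

/-- The logarithmic factor `L` of episode `k`. -/
def logFactor (S A : Type*) [Fintype S] [Fintype A] (H : ℕ) (δ : ℝ) (k : ℕ) : ℝ :=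
  Real.log (144 * (Fintype.card S : ℝ) ^ 2 * Fintype.card A * (H : ℝ) ^ 2 * (k : ℝ) ^ 3 * (k + 1) / δ)

/-- The reward bonus of episode `k`. -/
def bonusR (k h : ℕ) (s : S) : ℝ :=
  3 * √(Fintype.card A * logFactor S A H δ k / (2 * max (ξ.nS (k - 1) h s : ℝ) 1))

/-- The transition bonus of episode `k`, for the next-step values `V`. -/
def bonusP (k h : ℕ) (V : S → ℝ) (s : S) (a : A) : ℝ :=
  min
    (20 / 3 * √(var (ξ.empP (k - 1) h s a) V * logFactor S A H δ k
        / max (ξ.nSA (k - 1) h s a : ℝ) 1)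
      + 400 / 9 * (H * logFactor S A H δ k / max (ξ.nSA (k - 1) h s a : ℝ) 1))
    H

/-- The optimistic score of the action `a` at step `h` of episode `k`, in the state `s` with observed
rewards `r`, for the next-step values `V`. -/
def score (k h : ℕ) (V : S → ℝ) (s : S) (r : A → ℝ) (a : A) : ℝ :=
  r a + bonusP H δ ξ k h V s a + mean (ξ.empP (k - 1) h s a) V

/-- The optimistic values of episode `k` when `n` steps remain, that is at step `H + 1 - n`. -/
def optimisticToGo (k : ℕ) : ℕ → S → ℝ
  | 0, _ => 0
  | n + 1, s =>
    if ξ.nS (k - 1) (H - n) s = 0 then H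
    else
      min
        (ξ.empR (k - 1) (H - n) s
            (fun r => ⨆ a, score H δ ξ k (H - n) (optimisticToGo k n) s r a)
          + bonusR H δ ξ k (H - n) s)
        H

/-- The optimistic values of episode `k` at step `h`. -/
def optimisticValue (k h : ℕ) : S → ℝ := optimisticToGo H δ ξ k (H + 1 - h)

/-- `π` is a policy of MVP-RL for episode `k`, given the data `ξ` (of which only the episodes before
`k` are used): at each step and state, for every reward vector, it maximizes the optimistic score.
Ties are broken in any way. -/
def IsMVPRLPolicy [MeasurableSpace A] (k : ℕ) (π : DetPolicy S A) : Prop :=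
  ∀ h ∈ Set.Icc 1 H, ∀ (s : S) (r : A → ℝ) (a : A),
    score H δ ξ k h (optimisticValue H δ ξ k (h + 1)) s r a
      ≤ score H δ ξ k h (optimisticValue H δ ξ k (h + 1)) s r (π.act h s r)

end Algorithm

/-! ### Learning -/

section Learning

variable [MeasurableSpace S] [MeasurableSpace A]

/-- The information in the step `t` of episode `j`: state, observed rewards, action, next state. -/
abbrev stepInfo (ξ : Ω → Trace S A) (j t : ℕ) : MeasurableSpace Ω :=
  MeasurableSpace.comap
    (fun ω => ((ξ ω).state j t, (ξ ω).rew j t, (ξ ω).act j t, (ξ ω).state j (t + 1))) inferInstance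

/-- The information available at step `h` of episode `k` once the state of that step is known, and
before its rewards are observed. -/
abbrev pastOfRewards (H : ℕ) (ξ : Ω → Trace S A) (k h : ℕ) : MeasurableSpace Ω :=
  (⨆ j ∈ Set.Ico 1 k, ⨆ t ∈ Set.Icc 1 H, stepInfo ξ j t)
    ⊔ (⨆ t ∈ Set.Ico 1 h, stepInfo ξ k t)
    ⊔ MeasurableSpace.comap (fun ω => (ξ ω).state k h) inferInstance

/-- The information available at step `h` of episode `k` once its rewards are observed and its action
is played, and before the next state is drawn. -/
abbrev pastOfTransition (H : ℕ) (ξ : Ω → Trace S A) (k h : ℕ) : MeasurableSpace Ω :=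
  pastOfRewards H ξ k h
    ⊔ MeasurableSpace.comap (fun ω => ((ξ ω).rew k h, (ξ ω).act k h)) inferInstance

/-- `ξ` is the random data of a learner that interacts with `M`, playing the policy `π k ω` in episode
`k`. The policy is chosen from the past data; the rewards and the next states are drawn from `M`,
independently of the past given the current state, respectively the current state and action. The
initial states `(ξ ω).state k 1` are arbitrary; they may depend on the past. -/
structure IsInteraction [MeasurableSpace Ω] (M : MDP S A) (μ : Measure Ω) (ξ : Ω → Trace S A)
    (π : ℕ → Ω → DetPolicy S A) : Prop where
  measurable_state : ∀ k h, Measurable (fun ω => (ξ ω).state k h)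
  measurable_rew : ∀ k h, Measurable (fun ω => (ξ ω).rew k h)
  measurable_act : ∀ k h, Measurable (fun ω => (ξ ω).act k h)
  measurable_policy : ∀ k ≥ 1, ∀ h ∈ Set.Icc 1 M.H, ∀ s : S,
    @Measurable (Ω × (A → ℝ)) A ((pastOfRewards M.H ξ k 1).prod inferInstance) inferInstance
      (fun p => (π k p.1).act h s p.2)
  act_eq : ∀ k ≥ 1, ∀ h ∈ Set.Icc 1 M.H, ∀ ω,
    (ξ ω).act k h = (π k ω).act h ((ξ ω).state k h) ((ξ ω).rew k h)
  rew_law : ∀ k ≥ 1, ∀ h ∈ Set.Icc 1 M.H, ∀ B : Set (A → ℝ), MeasurableSet B →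
    μ⟦(fun ω => (ξ ω).rew k h) ⁻¹' B | pastOfRewards M.H ξ k h⟧
      =ᵐ[μ] fun ω => (M.rewardLaw h ((ξ ω).state k h)).real B
  state_law : ∀ k ≥ 1, ∀ h ∈ Set.Icc 1 M.H, ∀ s' : S,
    μ⟦(fun ω => (ξ ω).state k (h + 1)) ⁻¹' {s'} | pastOfTransition M.H ξ k h⟧
      =ᵐ[μ] fun ω => (M.P h ((ξ ω).state k h, (ξ ω).act k h)).real {s'}

/-- The regret of the policies `π 1, …, π K`, played from the initial states `s₁ 1, …, s₁ K`, against
the optimal reward-lookahead value. -/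
def regret [Countable S] [MeasurableSingletonClass S] (M : MDP S A) (s₁ : ℕ → S)
    (π : ℕ → DetPolicy S A) (K : ℕ) : ℝ :=
  ∑ k ∈ Finset.Icc 1 K, (M.optValue 1 (s₁ k) - M.value (π k).toPolicy 1 (s₁ k))

end Learning

end RewardLookahead

end

/-! The values computed by the algorithm dominate the optimal ones, so the regret of an episode is
at most the gap between the optimistic value and the value of the policy played. This gap is paid
for by the bonuses met along the trajectory, plus martingale noise.

Optimism. On the event `Concentrated`, the empirical mean of `max_a (r a + x a)` is within the
reward bonus of the true mean for all offsets `x` in `[0, 2H]^A` at once. Bernstein bounds hold for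
the empirical transition means of three kinds of fixed functions: the optimal next-step value V*,
its squared deviation, and the indicator of each next state. Bernstein for V* involves its true
variance. The bound on the squared deviation turns it into the empirical variance of the optimistic
value U, with an error proportional to the empirical mean of U - V*, and that error is covered by
the surplus of the optimistic score (`mean_optValue_le`). Backward induction gives
`optValue_le_optimisticValue`.

Recursion. The policy maximizes the score for every reward vector, so the value gap is at most twice
the reward bonus plus the mean score gap of the action played (`valueGap_le`). The score gap is at
most `1 + 9 / H` times the expected next value gap, plus a variance term for the value of the
policy, plus a term of order S H² L / n (`scoreGap_le`). Over H steps the factors compound to at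
most e⁹, and replacing conditional means by the realized actions and states leaves martingale
differences (`valueGap_telescope`).

Summation. The inverse visit counts sum to at most HSAL. By a law of total variance (`sum_var_le`)
the variances along K episodes sum to order H² K, up to noise, instead of H³ K. Cauchy-Schwarz then
gives √(H³SAK) L. The reward bonuses contribute only √(H²SAK) L, because they depend on the state
count and not on the pair count.

Probability. All deviations come from exponential supermartingales (`lintegral_mul_prod_le`) and
Markov's inequality, with a union bound over the possible visit counts. Uniformity in `x` comes from
a grid, whose cardinality is the source of the factor A in the reward bonus. Episode k may fail with
probability δ / (k (k + 1)), which sums to δ. -/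

set_option linter.unusedSectionVars false
set_option linter.style.haveILetI false

noncomputable section

namespace RewardLookahead

section

variable {S A Ω : Type*}

/-! ### Suprema over the actions -/

section Sup

variable [Fintype A] [Nonempty A]

lemma le_iSup_fintype (f : A → ℝ) (a : A) : f a ≤ ⨆ a, f a :=
  le_ciSup (Set.finite_range f).bddAbove a

lemma measurable_iSup_add (x : A → ℝ) : Measurable (fun r : A → ℝ => ⨆ a, (r a + x a)) :=
  Measurable.iSup (fun a => (measurable_pi_apply a).add_const _)

/-- The range has length 1 however large the offsets are. Hoeffding's inequality for the best score
therefore has no factor H. -/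
lemma iSup_add_mem_Icc (x r : A → ℝ) (hr : ∀ a, r a ∈ Set.Icc (0 : ℝ) 1) :
    (⨆ a, (r a + x a)) ∈ Set.Icc (⨆ a, x a) ((⨆ a, x a) + 1) := by
  constructor
  · exact ciSup_le fun a => (le_add_of_nonneg_left (hr a).1).trans
      (le_iSup_fintype (fun a => r a + x a) a)
  · exact ciSup_le fun a => by linarith [(hr a).2, le_iSup_fintype x a]

lemma iSup_add_le_add (x y r : A → ℝ) (ε : ℝ) (h : ∀ a, x a ≤ y a + ε) :
    (⨆ a, (r a + x a)) ≤ (⨆ a, (r a + y a)) + ε :=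
  ciSup_le fun a => by linarith [h a, le_iSup_fintype (fun a => r a + y a) a]

end Sup

/-! ### Bellman equations -/

instance MDP.isMarkovKernel_P [MeasurableSpace S] [MeasurableSpace A] (M : MDP S A) (h : ℕ) :
    IsMarkovKernel (M.P h) := M.markov_P h

instance MDP.isMarkovKernel_rewardLaw [MeasurableSpace S] [MeasurableSpace A] (M : MDP S A)
    (h : ℕ) : IsMarkovKernel (M.rewardLaw h) := M.markov_rewardLaw h

instance Policy.isMarkovKernel_act [MeasurableSpace S] [MeasurableSpace A] (π : Policy S A)
    (h : ℕ) : IsMarkovKernel (π.act h) := π.markov h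

namespace MDP

variable [MeasurableSpace S] [Fintype A] [MeasurableSpace A]
  [MeasurableSingletonClass A] (M : MDP S A)

/-- The transition probabilities as real numbers. -/
def tr (h : ℕ) (s : S) (a : A) (s' : S) : ℝ := (M.P h (s, a)).real {s'}

lemma measurable_eval : Measurable (fun p : (A → ℝ) × A => p.1 p.2) :=
  measurable_from_prod_countable_left (fun a => measurable_pi_apply a)

lemma measurable_collect :
    Measurable (fun y : (((A → ℝ) × A) × S) × ℝ => y.1.1.1 y.1.1.2 + y.2) := by
  have h : Measurable (fun y : (((A → ℝ) × A) × S) × ℝ => y.1.1) := by fun_prop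
  exact ((measurable_eval (A := A)).comp h).add measurable_snd

instance isMarkovKernel_returnLaw (π : Policy S A) :
    ∀ n h, IsMarkovKernel (M.returnLaw π n h)
  | 0, _ => by unfold returnLaw; infer_instance
  | n + 1, h => by
    haveI := isMarkovKernel_returnLaw π n (h + 1)
    rw [returnLaw]
    exact Kernel.IsMarkovKernel.map _ measurable_collect

/-- This boundedness supplies the integrability behind every use of Fubini for returns, and the
range of the values. -/
lemma returnLaw_mem (π : Policy S A) (n h : ℕ) (s : S) :
    ∀ᵐ x ∂(M.returnLaw π n h s), x ∈ Set.Icc (0 : ℝ) n := by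
  induction n generalizing h s with
  | zero => simp [returnLaw]
  | succ n ih =>
    rw [returnLaw, Kernel.map_apply _ measurable_collect,
      ae_map_iff (p := fun x => x ∈ Set.Icc (0 : ℝ) (n + 1 : ℕ)) measurable_collect.aemeasurable
        measurableSet_Icc]
    refine Kernel.ae_compProd_of_ae_ae (measurable_collect measurableSet_Icc) ?_
    have h1 : ∀ᵐ b ∂((M.rewardLaw h ⊗ₖ π.act h) s), b.1 b.2 ∈ Set.Icc (0 : ℝ) 1 := by
      refine Kernel.ae_compProd_of_ae_ae (measurable_eval measurableSet_Icc) ?_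
      filter_upwards [M.reward_mem h s] with r hr
      exact Filter.Eventually.of_forall hr
    have h2 : ∀ᵐ b ∂(((M.rewardLaw h ⊗ₖ π.act h) ⊗ₖ (M.P h).comap
        (fun x : S × ((A → ℝ) × A) => (x.1, x.2.2)) (by fun_prop)) s),
        b.1.1 b.1.2 ∈ Set.Icc (0 : ℝ) 1 := by
      refine Kernel.ae_compProd_of_ae_ae
        ((measurable_eval.comp measurable_fst) measurableSet_Icc) ?_
      filter_upwards [h1] with b hb
      exact Filter.Eventually.of_forall fun _ => hb
    filter_upwards [h2] with b hb
    rw [Kernel.comap_apply]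
    filter_upwards [ih (h + 1) b.2] with x hx
    rw [Set.mem_Icc] at *
    push_cast
    constructor <;> linarith [hb.1, hb.2, hx.1, hx.2]

variable [Fintype S] [MeasurableSingletonClass S]

lemma tr_nonneg (h : ℕ) (s : S) (a : A) (s' : S) : 0 ≤ M.tr h s a s' := measureReal_nonneg

lemma sum_tr (h : ℕ) (s : S) (a : A) : ∑ s', M.tr h s a s' = 1 := by
  simp [tr]

lemma integral_P (h : ℕ) (s : S) (a : A) (V : S → ℝ) :
    ∫ s', V s' ∂(M.P h (s, a)) = mean (M.tr h s a) V := by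
  rw [integral_fintype (Integrable.of_finite)]
  simp [mean, tr]

lemma integral_returnLaw_succ (π : Policy S A) (n h : ℕ) (s : S) :
    ∫ x, x ∂(M.returnLaw π (n + 1) h s) =
      ∫ r, ∫ a, (r a + mean (M.tr h s a) (fun s' => ∫ x, x ∂(M.returnLaw π n (h + 1) s')))
        ∂(π.act h (s, r)) ∂(M.rewardLaw h s) := by
  have hmem := M.returnLaw_mem π (n + 1) h s
  rw [returnLaw, Kernel.map_apply _ measurable_collect] at hmem ⊢
  rw [ae_map_iff (p := fun x => x ∈ Set.Icc (0 : ℝ) (n + 1 : ℕ)) measurable_collect.aemeasurable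
    measurableSet_Icc] at hmem
  rw [integral_map measurable_collect.aemeasurable (by fun_prop)]
  have hint := Integrable.of_mem_Icc _ _ measurable_collect.aemeasurable hmem
  rw [integral_compProd hint]
  have hint2 := hint.integral_compProd
  rw [integral_compProd hint2]
  have hint3 := hint2.integral_compProd
  rw [integral_compProd hint3]
  refine integral_congr_ae (Filter.Eventually.of_forall fun r => ?_)
  refine integral_congr_ae (Filter.Eventually.of_forall fun a => ?_)
  simp only [Kernel.comap_apply]
  have key : ∀ s' : S, ∫ y, (r a + y) ∂(M.returnLaw π n (h + 1) s')
      = r a + ∫ y, y ∂(M.returnLaw π n (h + 1) s') := by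
    intro s'
    rw [integral_add (integrable_const _)
      (Integrable.of_mem_Icc 0 n (by fun_prop) (M.returnLaw_mem π n (h + 1) s'))]
    simp
  simp only [key]
  rw [integral_P, mean, mean]
  simp only [mul_add, Finset.sum_add_distrib]
  rw [← Finset.sum_mul, sum_tr, one_mul]

lemma value_bellman (π : Policy S A) {h : ℕ} (hh : h ≤ M.H) (s : S) :
    M.value π h s = ∫ r, ∫ a, (r a + mean (M.tr h s a) (M.value π (h + 1)))
        ∂(π.act h (s, r)) ∂(M.rewardLaw h s) := by
  unfold value
  have : M.H + 1 - h = (M.H + 1 - (h + 1)) + 1 := by omega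
  rw [this, integral_returnLaw_succ]

lemma value_detPolicy_bellman (π : DetPolicy S A) {h : ℕ} (hh : h ≤ M.H) (s : S) :
    M.value π.toPolicy h s =
      ∫ r, (r (π.act h s r) + mean (M.tr h s (π.act h s r)) (M.value π.toPolicy (h + 1)))
        ∂(M.rewardLaw h s) := by
  rw [value_bellman _ _ hh]
  simp [DetPolicy.toPolicy, Kernel.deterministic_apply]

lemma value_terminal (π : Policy S A) (s : S) : M.value π (M.H + 1) s = 0 := by
  simp [value, returnLaw]

lemma value_mem (π : Policy S A) (h : ℕ) (hh : 1 ≤ h) (s : S) :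
    M.value π h s ∈ Set.Icc (0 : ℝ) M.H := by
  have hm := M.returnLaw_mem π (M.H + 1 - h) h s
  have hint := Integrable.of_mem_Icc _ _ (by fun_prop) hm
  have hle : ((M.H + 1 - h : ℕ) : ℝ) ≤ M.H := by exact_mod_cast (by omega)
  constructor
  · exact integral_nonneg_of_ae (hm.mono fun x hx => hx.1)
  · have := integral_mono_ae hint (integrable_const ((M.H + 1 - h : ℕ) : ℝ))
      (hm.mono fun x hx => hx.2)
    simp only [integral_const, probReal_univ, smul_eq_mul, one_mul] at this
    exact this.trans hle

lemma value_le_optValue (π : Policy S A) {h : ℕ} (hh : 1 ≤ h) (s : S) :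
    M.value π h s ≤ M.optValue h s :=
  le_ciSup (f := fun π : Policy S A => M.value π h s)
    ⟨M.H, by rintro _ ⟨π, rfl⟩; exact (M.value_mem π h hh s).2⟩ π

variable [Nonempty A]

instance nonempty_policy : Nonempty (Policy S A) :=
  ⟨⟨fun _ => Kernel.const _ (Measure.dirac (Classical.arbitrary A)), fun _ => inferInstance⟩⟩

lemma optValue_mem {h : ℕ} (hh : 1 ≤ h) (s : S) :
    M.optValue h s ∈ Set.Icc (0 : ℝ) M.H := by
  obtain ⟨π⟩ := nonempty_policy (S := S) (A := A)
  exact ⟨(M.value_mem π h hh s).1.trans (M.value_le_optValue π hh s),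
    ciSup_le fun π => (M.value_mem π h hh s).2⟩

lemma optValue_terminal (s : S) : M.optValue (M.H + 1) s = 0 := by
  simp [optValue, value_terminal]

lemma mean_tr_mono (h : ℕ) (s : S) (a : A) {V W : S → ℝ} (hVW : ∀ s, V s ≤ W s) :
    mean (M.tr h s a) V ≤ mean (M.tr h s a) W :=
  Finset.sum_le_sum fun s' _ => mul_le_mul_of_nonneg_left (hVW s') (M.tr_nonneg h s a s')

lemma mean_tr_mem (h : ℕ) (s : S) (a : A) {V : S → ℝ} {c d : ℝ}
    (hV : ∀ s, V s ∈ Set.Icc c d) : mean (M.tr h s a) V ∈ Set.Icc c d := by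
  have e : ∀ c : ℝ, mean (M.tr h s a) (fun _ => c) = c := fun c => by
    rw [mean, ← Finset.sum_mul, sum_tr, one_mul]
  exact ⟨(e c).symm.le.trans (M.mean_tr_mono h s a fun s => (hV s).1),
    (M.mean_tr_mono h s a fun s => (hV s).2).trans (e d).le⟩

lemma integrable_iSup (h : ℕ) (s : S) (x : A → ℝ) :
    Integrable (fun r : A → ℝ => ⨆ a, (r a + x a)) (M.rewardLaw h s) :=
  Integrable.of_mem_Icc _ _ (measurable_iSup_add x).aemeasurable
    ((M.reward_mem h s).mono fun r hr => iSup_add_mem_Icc x r hr)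

/-- Each policy satisfies this through its own Bellman equation, any drawn action being at most the
maximum. Only this half of the optimality equation is needed, so no optimal policy has to be
constructed. -/
lemma optValue_le {h : ℕ} (hh : h ≤ M.H) (hh1 : 1 ≤ h) (s : S) :
    M.optValue h s ≤ ∫ r, ⨆ a, (r a + mean (M.tr h s a) (M.optValue (h + 1)))
      ∂(M.rewardLaw h s) := by
  refine ciSup_le fun π => ?_
  rw [value_bellman _ _ hh]
  refine integral_mono_of_nonneg ?_ (M.integrable_iSup h s _) ?_
  · filter_upwards [M.reward_mem h s] with r hr
    exact integral_nonneg fun a => add_nonneg (hr a).1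
      (M.mean_tr_mem h s a fun s' => M.value_mem π (h + 1) (by omega) s').1
  · refine Filter.Eventually.of_forall fun r => ?_
    have : ∀ a, r a + mean (M.tr h s a) (M.value π (h + 1))
        ≤ ⨆ a, (r a + mean (M.tr h s a) (M.optValue (h + 1))) := fun a =>
      (add_le_add_right (M.mean_tr_mono h s a fun s' =>
        M.value_le_optValue π (by omega) s') _).trans
        (le_iSup_fintype (fun a => r a + mean (M.tr h s a) (M.optValue (h + 1))) a)
    have h2 := integral_mono (μ := π.act h (s, r)) Integrable.of_finite
      (integrable_const _) this
    simpa using h2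

/-- With one action there is one policy and no regret. This settles SAHK = 1, where the logarithm of
the final bound may be arbitrarily close to 0 while the logarithmic factor is at least 1. -/
lemma optValue_eq_value_of_subsingleton [Subsingleton A] (π : Policy S A) (h : ℕ) (s : S) :
    M.optValue h s = M.value π h s := by
  have : ∀ π' : Policy S A, π' = π := by
    rintro ⟨f, hf⟩
    obtain ⟨g, hg⟩ := π
    congr
    ext i p B hB
    have := hf i
    have := hg i
    rcases Set.eq_empty_or_nonempty B with rfl | hB
    · simp
    · rw [Subsingleton.eq_univ_of_nonempty hB]
      simp
  unfold optValue
  simp [fun π' => this π']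

end MDP

end

section

/-! ### Conditional laws -/

/-- Given `m`, the random variable `X` has the law `κ (Y ω)`. -/
def CondLaw {Ω T E : Type*} [MeasurableSpace Ω] [MeasurableSpace T] [MeasurableSpace E]
    (μ : Measure Ω) (m : MeasurableSpace Ω) (X : Ω → E) (Y : Ω → T) (κ : Kernel T E) : Prop :=
  ∀ D, MeasurableSet[m] D → ∀ B, MeasurableSet B →
    μ (D ∩ X ⁻¹' B) = ∫⁻ ω in D, κ (Y ω) B ∂μ

section CondLaw

variable {Ω T E : Type*} {m : MeasurableSpace Ω} [mΩ : MeasurableSpace Ω] [MeasurableSpace T]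
  [MeasurableSpace E] {μ : Measure Ω} [IsProbabilityMeasure μ] {X : Ω → E} {Y : Ω → T}
  {κ : Kernel T E} [IsMarkovKernel κ]

lemma setLIntegral_eq_of_condExp (hm : m ≤ mΩ) (hY : Measurable Y) (hX : Measurable X)
    {B : Set E} (hB : MeasurableSet B)
    (h : μ⟦X ⁻¹' B | m⟧ =ᵐ[μ] fun ω => (κ (Y ω)).real B) {D : Set Ω}
    (hD : MeasurableSet[m] D) :
    μ (D ∩ X ⁻¹' B) = ∫⁻ ω in D, κ (Y ω) B ∂μ := by
  have hXB : MeasurableSet (X ⁻¹' B) := hX hB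
  have h1 := setIntegral_condExp (μ := μ) (f := (X ⁻¹' B).indicator fun _ => (1 : ℝ)) hm
    ((integrable_const 1).indicator hXB) hD
  rw [integral_congr_ae (ae_restrict_of_ae h), setIntegral_indicator hXB] at h1
  have hmeas : Measurable fun ω => κ (Y ω) B := (κ.measurable_coe hB).comp hY
  have h2 : ∫ ω in D, (κ (Y ω)).real B ∂μ = (∫⁻ ω in D, κ (Y ω) B ∂μ).toReal := by
    rw [← integral_toReal hmeas.aemeasurable]
    · rfl
    · exact Filter.Eventually.of_forall fun ω => measure_lt_top _ _
  rw [h2] at h1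
  simp only [integral_const, smul_eq_mul, mul_one, measureReal_restrict_apply_univ] at h1
  have hfin : ∫⁻ ω in D, κ (Y ω) B ∂μ ≠ ∞ := by
    refine ((lintegral_mono (g := fun _ => 1) fun ω => prob_le_one).trans_lt ?_).ne
    simp
  exact ((ENNReal.toReal_eq_toReal_iff' hfin (measure_ne_top _ _)).1 h1).symm

lemma CondLaw.of_condExp (hm : m ≤ mΩ) (hY : Measurable Y) (hX : Measurable X)
    (h : ∀ B, MeasurableSet B → μ⟦X ⁻¹' B | m⟧ =ᵐ[μ] fun ω => (κ (Y ω)).real B) :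
    CondLaw μ m X Y κ := fun _ hD B hB => setLIntegral_eq_of_condExp hm hY hX hB (h B hB) hD

lemma CondLaw.of_condExp_singleton [Fintype E] [MeasurableSingletonClass E] (hm : m ≤ mΩ)
    (hY : Measurable Y) (hX : Measurable X)
    (h : ∀ x, μ⟦X ⁻¹' {x} | m⟧ =ᵐ[μ] fun ω => (κ (Y ω)).real {x}) :
    CondLaw μ m X Y κ := by
  classical
  intro D hD B hB
  have hD' := hm _ hD
  have e1 : D ∩ X ⁻¹' B = ⋃ x ∈ B.toFinset, D ∩ X ⁻¹' {x} := by
    ext ω; simp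
  have e2 : ∀ ω, κ (Y ω) B = ∑ x ∈ B.toFinset, κ (Y ω) {x} := fun ω => by
    rw [sum_measure_singleton]; simp
  simp only [e2]
  rw [e1, measure_biUnion_finset, lintegral_finsetSum]
  · exact Finset.sum_congr rfl fun x _ =>
      setLIntegral_eq_of_condExp hm hY hX (measurableSet_singleton x) (h x) hD
  · exact fun x _ => (κ.measurable_coe (measurableSet_singleton x)).comp hY
  · intro x _ y _ hxy
    refine Set.disjoint_left.2 fun ω h1 h2 => hxy ?_
    exact h1.2.symm.trans h2.2
  · exact fun x _ => hD'.inter (hX (measurableSet_singleton x))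

/-- Rectangles determine the joint law, so no regular conditional distribution on `Ω` is required.
The map `Q` to a second space lets a sub-σ-algebra enter later as the identity from `Ω` to `Ω` with
the smaller σ-algebra. -/
lemma map_prodMk_eq_compProd {Ω' : Type*} [MeasurableSpace Ω'] {Q : Ω → Ω'}
    (hQ : Measurable Q) {Y' : Ω' → T} (hY' : Measurable Y') (hX : Measurable X)
    (h : ∀ D, MeasurableSet D → ∀ B, MeasurableSet B →
      μ (Q ⁻¹' D ∩ X ⁻¹' B) = ∫⁻ ω in Q ⁻¹' D, κ (Y' (Q ω)) B ∂μ) :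
    μ.map (fun ω => (Q ω, X ω)) = (μ.map Q) ⊗ₘ (κ.comap Y' hY') := by
  have := Measure.isProbabilityMeasure_map (μ := μ) (hQ.prodMk hX).aemeasurable
  refine Measure.ext_prod fun {D B} hD hB => ?_
  rw [Measure.map_apply (hQ.prodMk hX) (hD.prod hB), Measure.compProd_apply_prod hD hB,
    setLIntegral_map hD (Kernel.measurable_coe _ hB) hQ]
  simp only [Kernel.comap_apply]
  rw [← h D hD B hB]
  rfl

lemma lintegral_condLaw_aux {Ω' : Type*} [MeasurableSpace Ω'] {Q : Ω → Ω'}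
    (hQ : Measurable Q) {Y' : Ω' → T} (hY' : Measurable Y') (hX : Measurable X)
    (h : ∀ D, MeasurableSet D → ∀ B, MeasurableSet B →
      μ (Q ⁻¹' D ∩ X ⁻¹' B) = ∫⁻ ω in Q ⁻¹' D, κ (Y' (Q ω)) B ∂μ)
    {g : Ω' × E → ℝ≥0∞} (hg : Measurable g) :
    ∫⁻ ω, g (Q ω, X ω) ∂μ = ∫⁻ ω, ∫⁻ x, g (Q ω, x) ∂(κ (Y' (Q ω))) ∂μ := by
  rw [← lintegral_map hg (hQ.prodMk hX), map_prodMk_eq_compProd hQ hY' hX h,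
    Measure.lintegral_compProd hg, lintegral_map (hg.lintegral_kernel_prod_right') hQ]
  rfl

lemma CondLaw.lintegral_eq (hl : CondLaw μ m X Y κ) (hm : m ≤ mΩ) (hY : Measurable[m] Y)
    (hX : Measurable X) {g : Ω × E → ℝ≥0∞}
    (hg : @Measurable (Ω × E) ℝ≥0∞ (m.prod inferInstance) _ g) :
    ∫⁻ ω, g (ω, X ω) ∂μ = ∫⁻ ω, ∫⁻ x, g (ω, x) ∂(κ (Y ω)) ∂μ :=
  @lintegral_condLaw_aux Ω T E mΩ _ _ μ _ X κ _ Ω m id (measurable_id'' hm) Y hY hX hl g hg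

/-- The supermartingale step: a factor of conditional mean at most `1` does not increase
integrals. -/
lemma CondLaw.lintegral_mul_le (hl : CondLaw μ m X Y κ) (hm : m ≤ mΩ) (hY : Measurable[m] Y)
    (hX : Measurable X) {g : Ω × E → ℝ≥0∞}
    (hg : @Measurable (Ω × E) ℝ≥0∞ (m.prod inferInstance) _ g)
    (hg1 : ∀ ω, ∫⁻ x, g (ω, x) ∂(κ (Y ω)) ≤ 1) {Z : Ω → ℝ≥0∞} (hZ : Measurable[m] Z) :
    ∫⁻ ω, Z ω * g (ω, X ω) ∂μ ≤ ∫⁻ ω, Z ω ∂μ := by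
  have hZ' : @Measurable (Ω × E) ℝ≥0∞ (m.prod inferInstance) _ (fun p => Z p.1) :=
    hZ.comp (@measurable_fst Ω E m _)
  have h1 : ∫⁻ ω, Z ω * g (ω, X ω) ∂μ = ∫⁻ ω, ∫⁻ x, Z ω * g (ω, x) ∂(κ (Y ω)) ∂μ :=
    hl.lintegral_eq hm hY hX (g := fun p => Z p.1 * g p)
      (hZ'.mul hg)
  rw [h1]
  refine lintegral_mono fun ω => ?_
  have hgω : Measurable fun x => g (ω, x) := hg.comp (@measurable_prodMk_left Ω E m _ ω)
  rw [lintegral_const_mul _ hgω]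
  exact mul_le_of_le_one_right' (hg1 ω)

end CondLaw

/-! ### Exponential inequalities -/

/-- Hoeffding's lemma with the compensator moved into the exponent: a factor of mean at most 1 is
what a supermartingale product needs. -/
lemma lintegral_exp_hoeffding {E : Type*} [MeasurableSpace E] (ν : Measure E)
    [IsProbabilityMeasure ν] {f : E → ℝ} (hf : Measurable f) {a b : ℝ}
    (h : ∀ᵐ x ∂ν, f x ∈ Set.Icc a b) (t : ℝ) :
    ∫⁻ x, ENNReal.ofReal (Real.exp (t * (f x - ∫ x, f x ∂ν) - t ^ 2 * (b - a) ^ 2 / 8)) ∂ν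
      ≤ 1 := by
  have hs := hasSubgaussianMGF_of_mem_Icc hf.aemeasurable h
  have hi := hs.integrable_exp_mul t
  have hle := hs.mgf_le t
  rw [mgf] at hle
  have e : ∀ x, Real.exp (t * (f x - ∫ x, f x ∂ν) - t ^ 2 * (b - a) ^ 2 / 8)
      = Real.exp (t * (f x - ∫ x, f x ∂ν)) * Real.exp (-(t ^ 2 * (b - a) ^ 2 / 8)) := fun x => by
    rw [← Real.exp_add, sub_eq_add_neg]
  simp only [e]
  rw [← ofReal_integral_eq_lintegral_ofReal (hi.mul_const _)
    (Filter.Eventually.of_forall fun x => by positivity), integral_mul_const]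
  refine ENNReal.ofReal_le_one.2 ?_
  calc _ ≤ Real.exp _ * Real.exp (-(t ^ 2 * (b - a) ^ 2 / 8)) := by gcongr
    _ = 1 := by
      rw [← Real.exp_add]
      have : (((‖b - a‖₊ / 2) ^ 2 : NNReal) : ℝ) = (b - a) ^ 2 / 4 := by
        push_cast
        rw [div_pow, Real.norm_eq_abs, sq_abs]; norm_num
      rw [this]
      ring_nf
      simp

lemma exp_le_one_add_add_sq {x : ℝ} (hx : |x| ≤ 1) : Real.exp x ≤ 1 + x + x ^ 2 := by
  have := Real.abs_exp_sub_one_sub_id_le hx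
  linarith [(abs_le.1 this).2]

/-- Bernstein's exponential inequality for weights on a finite type. -/
lemma sum_exp_bernstein {S : Type*} [Fintype S] {p W : S → ℝ} (hp : ∀ s, 0 ≤ p s)
    (hp1 : ∑ s, p s = 1) {B t : ℝ} (hW : ∀ s, W s ∈ Set.Icc 0 B) (ht : |t| * B ≤ 1) :
    ∑ s, p s * Real.exp (t * (W s - mean p W) - t ^ 2 * var p W) ≤ 1 := by
  have hm0 : 0 ≤ mean p W := Finset.sum_nonneg fun s _ => mul_nonneg (hp s) (hW s).1
  have hmB : mean p W ≤ B := by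
    calc mean p W ≤ ∑ s, p s * B :=
          Finset.sum_le_sum fun s _ => mul_le_mul_of_nonneg_left (hW s).2 (hp s)
      _ = B := by rw [← Finset.sum_mul, hp1, one_mul]
  have h1 : ∀ s, Real.exp (t * (W s - mean p W)) ≤
      1 + t * (W s - mean p W) + (t * (W s - mean p W)) ^ 2 := fun s => by
    refine exp_le_one_add_add_sq ?_
    rw [abs_mul]
    refine le_trans (mul_le_mul_of_nonneg_left ?_ (abs_nonneg t)) ht
    rw [abs_le]; constructor <;> linarith [(hW s).1, (hW s).2]
  -- In `1 + y + y²` the linear term has mean zero and the quadratic one has mean `t² var`.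
  have h2 : ∑ s, p s * Real.exp (t * (W s - mean p W)) ≤ 1 + t ^ 2 * var p W := by
    calc _ ≤ ∑ s, p s * (1 + t * (W s - mean p W) + (t * (W s - mean p W)) ^ 2) :=
          Finset.sum_le_sum fun s _ => mul_le_mul_of_nonneg_left (h1 s) (hp s)
      _ = ∑ s, ((1 - t * mean p W + t ^ 2 * mean p W ^ 2) * p s
            + (t - 2 * t ^ 2 * mean p W) * (p s * W s) + t ^ 2 * (p s * W s ^ 2)) :=
          Finset.sum_congr rfl fun s _ => by ring
      _ = 1 + t ^ 2 * var p W := by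
          simp only [Finset.sum_add_distrib, ← Finset.mul_sum, hp1]
          simp only [var, mean]
          ring
  have h3 : ∀ s, p s * Real.exp (t * (W s - mean p W) - t ^ 2 * var p W)
      = p s * Real.exp (t * (W s - mean p W)) * Real.exp (-(t ^ 2 * var p W)) := fun s => by
    rw [mul_assoc, ← Real.exp_add]; ring_nf
  simp only [h3]
  rw [← Finset.sum_mul]
  calc _ ≤ Real.exp (t ^ 2 * var p W) * Real.exp (-(t ^ 2 * var p W)) := by
        gcongr
        refine h2.trans ?_
        linarith [Real.add_one_le_exp (t ^ 2 * var p W)]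
    _ = 1 := by rw [← Real.exp_add]; simp

lemma var_eq_of_sum_one {S : Type*} [Fintype S] {p : S → ℝ} (hp1 : ∑ s, p s = 1) (W : S → ℝ) (c : ℝ) :
    var p W = ∑ s, p s * (W s - c) ^ 2 - (mean p W - c) ^ 2 := by
  have : ∀ s, p s * (W s - c) ^ 2 = p s * W s ^ 2 - 2 * c * (p s * W s) + c ^ 2 * p s :=
    fun s => by ring
  simp only [this, Finset.sum_add_distrib, Finset.sum_sub_distrib, ← Finset.mul_sum, hp1]
  simp only [var, mean]
  ring

lemma var_nonneg {S : Type*} [Fintype S] {p : S → ℝ} (hp : ∀ s, 0 ≤ p s) (hp1 : ∑ s, p s = 1) (W : S → ℝ) :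
    0 ≤ var p W := by
  rw [var_eq_of_sum_one hp1 W (mean p W), sub_self]
  simpa using Finset.sum_nonneg fun s _ => mul_nonneg (hp s) (sq_nonneg (W s - mean p W))

/-! ### Supermartingale products and the exponential Markov inequality -/

section Super

variable {Ω : Type*} [mΩ : MeasurableSpace Ω] {μ : Measure Ω}

/-- Products of factors that do not increase integrals. -/
lemma lintegral_mul_prod_le (F : ℕ → Ω → ℝ≥0∞) (𝓕 : ℕ → MeasurableSpace Ω) (n₀ n : ℕ)
    (hF : ∀ i j, i < j → 1 ≤ i → j ≤ n₀ → Measurable[𝓕 j] (F i))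
    (hstep : ∀ j, 1 ≤ j → j ≤ n₀ → ∀ Z : Ω → ℝ≥0∞, Measurable[𝓕 j] Z →
      ∫⁻ ω, Z ω * F j ω ∂μ ≤ ∫⁻ ω, Z ω ∂μ)
    (hn : n ≤ n₀) (Z : Ω → ℝ≥0∞) (hZ : ∀ j, 1 ≤ j → j ≤ n₀ → Measurable[𝓕 j] Z) :
    ∫⁻ ω, Z ω * ∏ i ∈ Finset.Icc 1 n, F i ω ∂μ ≤ ∫⁻ ω, Z ω ∂μ := by
  induction n with
  | zero => simp
  | succ n ih =>
    refine le_trans ?_ (ih (by omega))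
    simp only [Finset.prod_Icc_succ_top (Nat.le_add_left 1 n), ← mul_assoc]
    refine hstep (n + 1) (by omega) hn (fun ω => Z ω * ∏ i ∈ Finset.Icc 1 n, F i ω) ?_
    refine (hZ _ (by omega) hn).mul (Finset.measurable_fun_prod _ fun i hi => ?_)
    rw [Finset.mem_Icc] at hi
    exact hF i _ (by omega) hi.1 hn

/-- Markov's inequality for `exp G`. -/
lemma measure_le_of_lintegral_exp_le {G : Ω → ℝ} (hG : ∫⁻ ω, ENNReal.ofReal (Real.exp (G ω)) ∂μ ≤ 1)
    (hGm : Measurable G) (θ : ℝ) :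
    μ {ω | θ ≤ G ω} ≤ ENNReal.ofReal (Real.exp (-θ)) := by
  have h1 := mul_meas_ge_le_lintegral (μ := μ)
    (f := fun ω => ENNReal.ofReal (Real.exp (G ω))) (by fun_prop) (ENNReal.ofReal (Real.exp θ))
  have h2 : {ω | ENNReal.ofReal (Real.exp θ) ≤ ENNReal.ofReal (Real.exp (G ω))}
      = {ω | θ ≤ G ω} := by
    ext ω
    simp [ENNReal.ofReal_le_ofReal_iff (Real.exp_nonneg _)]
  rw [h2] at h1
  calc μ {ω | θ ≤ G ω} = ENNReal.ofReal (Real.exp (-θ)) *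
        (ENNReal.ofReal (Real.exp θ) * μ {ω | θ ≤ G ω}) := by
        rw [← mul_assoc, ← ENNReal.ofReal_mul (Real.exp_nonneg _), ← Real.exp_add]; simp
    _ ≤ ENNReal.ofReal (Real.exp (-θ)) * 1 := by gcongr; exact h1.trans hG
    _ = _ := mul_one _

end Super

end

section

lemma CondLaw.lintegral_mul_le_of_discrete {Ω T E : Type*} {m : MeasurableSpace Ω}
    [mΩ : MeasurableSpace Ω] [MeasurableSpace T] [Countable T] [MeasurableSingletonClass T]
    [MeasurableSpace E] {μ : Measure Ω} [IsProbabilityMeasure μ] {X : Ω → E} {Y : Ω → T}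
    {κ : Kernel T E} [IsMarkovKernel κ] (hl : CondLaw μ m X Y κ) (hm : m ≤ mΩ)
    (hY : Measurable[m] Y) (hX : Measurable X) {G : T → E → ℝ≥0∞} (hG : ∀ y, Measurable (G y))
    (hG1 : ∀ y, ∫⁻ x, G y x ∂(κ y) ≤ 1) {Z : Ω → ℝ≥0∞} (hZ : Measurable[m] Z) :
    ∫⁻ ω, Z ω * G (Y ω) (X ω) ∂μ ≤ ∫⁻ ω, Z ω ∂μ := by
  have hG' : Measurable (fun p : T × E => G p.1 p.2) := measurable_from_prod_countable_right hG
  refine hl.lintegral_mul_le hm hY hX (g := fun p => G (Y p.1) p.2) ?_ (fun ω => hG1 _) hZ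
  have h2 : @Measurable (Ω × E) (T × E) (m.prod inferInstance) _ (fun p => (Y p.1, p.2)) :=
    (hY.comp (@measurable_fst Ω E m _)).prodMk (@measurable_snd Ω E m _)
  exact hG'.comp h2

section Interaction

variable {S A Ω : Type*} [Fintype S] [MeasurableSpace S] [MeasurableSingletonClass S]
  [Fintype A] [MeasurableSpace A] [MeasurableSingletonClass A] [mΩ : MeasurableSpace Ω]
  {μ : Measure Ω} {M : MDP S A} {ξ : Ω → Trace S A}
  {π : ℕ → Ω → DetPolicy S A}

/-! ### Measurability with respect to the past -/

section Past

variable {m : MeasurableSpace Ω} {H j k t h : ℕ}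

lemma measurable_state_of_stepInfo_le (hm : stepInfo ξ j t ≤ m) :
    Measurable[m] (fun ω => (ξ ω).state j t) :=
  (measurable_fst.comp (comap_measurable _)).mono hm le_rfl

lemma measurable_rew_of_stepInfo_le (hm : stepInfo ξ j t ≤ m) :
    Measurable[m] (fun ω => (ξ ω).rew j t) :=
  (measurable_fst.comp (measurable_snd.comp (comap_measurable _))).mono hm le_rfl

lemma measurable_act_of_stepInfo_le (hm : stepInfo ξ j t ≤ m) :
    Measurable[m] (fun ω => (ξ ω).act j t) :=
  (measurable_fst.comp (measurable_snd.comp (measurable_snd.comp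
    (comap_measurable _)))).mono hm le_rfl

lemma measurable_next_of_stepInfo_le (hm : stepInfo ξ j t ≤ m) :
    Measurable[m] (fun ω => (ξ ω).state j (t + 1)) :=
  (measurable_snd.comp (measurable_snd.comp (measurable_snd.comp
    (comap_measurable _)))).mono hm le_rfl

lemma stepInfo_le_pastOfRewards (hj : j ∈ Set.Ico 1 k) (ht : t ∈ Set.Icc 1 H) :
    stepInfo ξ j t ≤ pastOfRewards H ξ k h :=
  le_trans (le_iSup₂_of_le (f := fun j _ => ⨆ t ∈ Set.Icc 1 H, stepInfo ξ j t) j hj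
    (le_iSup₂_of_le (f := fun t _ => stepInfo ξ j t) t ht le_rfl))
    (le_sup_left.trans le_sup_left)

lemma stepInfo_le_pastOfRewards_same (ht : t ∈ Set.Ico 1 h) :
    stepInfo ξ k t ≤ pastOfRewards H ξ k h :=
  le_trans (le_iSup₂_of_le (f := fun t _ => stepInfo ξ k t) t ht le_rfl)
    (le_sup_right.trans le_sup_left)

lemma measurable_state_pastOfRewards :
    Measurable[pastOfRewards H ξ k h] (fun ω => (ξ ω).state k h) :=
  (comap_measurable _).mono le_sup_right le_rfl

lemma pastOfRewards_le_pastOfTransition : pastOfRewards H ξ k h ≤ pastOfTransition H ξ k h :=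
  le_sup_left

lemma measurable_rew_pastOfTransition :
    Measurable[pastOfTransition H ξ k h] (fun ω => (ξ ω).rew k h) :=
  (measurable_fst.comp (comap_measurable fun ω => ((ξ ω).rew k h, (ξ ω).act k h))).mono
    le_sup_right le_rfl

lemma measurable_act_pastOfTransition :
    Measurable[pastOfTransition H ξ k h] (fun ω => (ξ ω).act k h) :=
  (measurable_snd.comp (comap_measurable fun ω => ((ξ ω).rew k h, (ξ ω).act k h))).mono
    le_sup_right le_rfl

lemma measurable_stateAct_pastOfTransition :
    Measurable[pastOfTransition H ξ k h] (fun ω => ((ξ ω).state k h, (ξ ω).act k h)) :=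
  (measurable_state_pastOfRewards.mono pastOfRewards_le_pastOfTransition le_rfl).prodMk
    measurable_act_pastOfTransition

lemma pastOfTransition_le_pastOfRewards_succ (hh : 1 ≤ h) :
    pastOfTransition H ξ k h ≤ pastOfRewards H ξ k (h + 1) := by
  have hs : stepInfo ξ k h ≤ pastOfRewards H ξ k (h + 1) :=
    stepInfo_le_pastOfRewards_same ⟨hh, Nat.lt_succ_self h⟩
  refine sup_le (sup_le (sup_le (le_sup_left.trans le_sup_left) ?_) ?_) ?_
  · exact iSup₂_le fun t ht => stepInfo_le_pastOfRewards_same ⟨ht.1, ht.2.trans (Nat.lt_succ_self h)⟩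
  · exact (measurable_state_of_stepInfo_le hs).comap_le
  · exact ((measurable_rew_of_stepInfo_le hs).prodMk (measurable_act_of_stepInfo_le hs)).comap_le

lemma pastOfRewards_mono (ht : 1 ≤ t) (hth : t ≤ h) :
    pastOfRewards H ξ k t ≤ pastOfRewards H ξ k h := by
  induction h, hth using Nat.le_induction with
  | base => exact le_rfl
  | succ h hth ih =>
    exact ih.trans (pastOfRewards_le_pastOfTransition.trans
      (pastOfTransition_le_pastOfRewards_succ (ht.trans hth)))

end Past

variable [IsProbabilityMeasure μ]

lemma IsInteraction.stepInfo_le (hI : IsInteraction M μ ξ π) (j t : ℕ) : stepInfo ξ j t ≤ mΩ :=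
  ((hI.measurable_state j t).prodMk ((hI.measurable_rew j t).prodMk
    ((hI.measurable_act j t).prodMk (hI.measurable_state j (t + 1))))).comap_le

lemma IsInteraction.pastOfRewards_le (hI : IsInteraction M μ ξ π) (H k h : ℕ) :
    pastOfRewards H ξ k h ≤ mΩ :=
  sup_le (sup_le (iSup₂_le fun _ _ => iSup₂_le fun _ _ => hI.stepInfo_le _ _)
    (iSup₂_le fun _ _ => hI.stepInfo_le _ _)) (hI.measurable_state k h).comap_le

lemma IsInteraction.pastOfTransition_le (hI : IsInteraction M μ ξ π) (H k h : ℕ) :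
    pastOfTransition H ξ k h ≤ mΩ :=
  sup_le (hI.pastOfRewards_le H k h)
    ((hI.measurable_rew k h).prodMk (hI.measurable_act k h)).comap_le

lemma IsInteraction.condLaw_rew (hI : IsInteraction M μ ξ π) {k h : ℕ} (hk : 1 ≤ k)
    (hh : h ∈ Set.Icc 1 M.H) :
    CondLaw μ (pastOfRewards M.H ξ k h) (fun ω => (ξ ω).rew k h) (fun ω => (ξ ω).state k h)
      (M.rewardLaw h) :=
  CondLaw.of_condExp (hI.pastOfRewards_le _ _ _) (hI.measurable_state k h)
    (hI.measurable_rew k h) (hI.rew_law k hk h hh)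

lemma IsInteraction.condLaw_state (hI : IsInteraction M μ ξ π) {k h : ℕ} (hk : 1 ≤ k)
    (hh : h ∈ Set.Icc 1 M.H) :
    CondLaw μ (pastOfTransition M.H ξ k h) (fun ω => (ξ ω).state k (h + 1))
      (fun ω => ((ξ ω).state k h, (ξ ω).act k h)) (M.P h) :=
  CondLaw.of_condExp_singleton (hI.pastOfTransition_le _ _ _)
    ((hI.measurable_state k h).prodMk (hI.measurable_act k h))
    (hI.measurable_state k (h + 1)) (hI.state_law k hk h hh)

/-! ### Concentration of the empirical rewards and transitions -/

/-- Episodes without a visit count as factors 1. A sum over the random set of visits thus becomes a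
product over a fixed range of episodes. -/
lemma ofReal_exp_sum {ι : Type*} (s : Finset ι) (p : ι → Prop) [DecidablePred p] (f : ι → ℝ) :
    ∏ i ∈ s, (if p i then ENNReal.ofReal (Real.exp (f i)) else 1)
      = ENNReal.ofReal (Real.exp (∑ i ∈ s.filter p, f i)) := by
  rw [Real.exp_sum, ENNReal.ofReal_prod_of_nonneg fun i _ => Real.exp_nonneg _,
    Finset.prod_filter]

/-- The test function `f` is fixed in advance. Whether `s` is visited is known before the rewards
are drawn, so each factor has conditional mean at most 1. -/
lemma IsInteraction.lintegral_exp_rew (hI : IsInteraction M μ ξ π) (k : ℕ) {h : ℕ}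
    (hh : h ∈ Set.Icc 1 M.H) (s : S) {f : (A → ℝ) → ℝ} (hf : Measurable f) {a : ℝ}
    (hfa : ∀ᵐ r ∂(M.rewardLaw h s), f r ∈ Set.Icc a (a + 1)) (t : ℝ) :
    ∫⁻ ω, ENNReal.ofReal (Real.exp (∑ j ∈ (ξ ω).visitsS k h s,
      (t * (f ((ξ ω).rew j h) - ∫ r, f r ∂(M.rewardLaw h s)) - t ^ 2 / 8))) ∂μ ≤ 1 := by
  classical
  let G : S → (A → ℝ) → ℝ≥0∞ := fun s' r => if s' = s then
    ENNReal.ofReal (Real.exp (t * (f r - ∫ r, f r ∂(M.rewardLaw h s)) - t ^ 2 / 8)) else 1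
  have hG : ∀ s', Measurable (G s') := fun s' => by
    by_cases hs : s' = s
    · simp only [G, hs, if_true]; fun_prop
    · simp only [G, hs, if_false]; fun_prop
  have hG' : Measurable (fun p : S × (A → ℝ) => G p.1 p.2) :=
    measurable_from_prod_countable_right hG
  have hG1 : ∀ s', ∫⁻ r, G s' r ∂(M.rewardLaw h s') ≤ 1 := fun s' => by
    by_cases hs : s' = s
    · subst hs
      simp only [G, if_true]
      have := lintegral_exp_hoeffding (M.rewardLaw h s') hf hfa t
      simpa using this
    · simp [G, hs]
  have key := lintegral_mul_prod_le (μ := μ)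
    (fun j ω => G ((ξ ω).state j h) ((ξ ω).rew j h)) (fun j => pastOfRewards M.H ξ j h) k k
    (fun i j hij hi _ => hG'.comp
      ((measurable_state_of_stepInfo_le (stepInfo_le_pastOfRewards ⟨hi, hij⟩ hh)).prodMk
      (measurable_rew_of_stepInfo_le (stepInfo_le_pastOfRewards ⟨hi, hij⟩ hh))))
    (fun j hj _ Z hZ => (hI.condLaw_rew hj hh).lintegral_mul_le_of_discrete
      (hI.pastOfRewards_le _ _ _) measurable_state_pastOfRewards (hI.measurable_rew j h)
      hG hG1 hZ) le_rfl (fun _ => 1) (fun _ _ _ => measurable_const)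
  simp only [one_mul, lintegral_one, measure_univ, G, ofReal_exp_sum] at key
  exact key

lemma IsInteraction.lintegral_exp_state (hI : IsInteraction M μ ξ π) (k : ℕ) {h : ℕ}
    (hh : h ∈ Set.Icc 1 M.H) (s : S) (a : A) {W : S → ℝ} {B t : ℝ}
    (hW : ∀ s, W s ∈ Set.Icc 0 B) (ht : |t| * B ≤ 1) :
    ∫⁻ ω, ENNReal.ofReal (Real.exp (∑ j ∈ (ξ ω).visitsSA k h s a,
      (t * (W ((ξ ω).state j (h + 1)) - mean (M.tr h s a) W)
        - t ^ 2 * var (M.tr h s a) W))) ∂μ ≤ 1 := by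
  classical
  let G : S × A → S → ℝ≥0∞ := fun y s' => if y.1 = s ∧ y.2 = a then
    ENNReal.ofReal (Real.exp (t * (W s' - mean (M.tr h s a) W) - t ^ 2 * var (M.tr h s a) W))
    else 1
  have hG : ∀ y, Measurable (G y) := fun y => measurable_of_finite _
  have hG' : Measurable (fun p : (S × A) × S => G p.1 p.2) := measurable_of_finite _
  have hG1 : ∀ y, ∫⁻ r, G y r ∂(M.P h y) ≤ 1 := fun y => by
    by_cases hs : y.1 = s ∧ y.2 = a
    · obtain ⟨rfl, rfl⟩ := hs
      simp only [G, and_self, if_true]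
      rw [← ofReal_integral_eq_lintegral_ofReal Integrable.of_finite
        (Filter.Eventually.of_forall fun _ => Real.exp_nonneg _)]
      refine ENNReal.ofReal_le_one.2 ?_
      have := M.integral_P h y.1 y.2 (fun s' => Real.exp (t * (W s' - mean (M.tr h y.1 y.2) W)
        - t ^ 2 * var (M.tr h y.1 y.2) W))
      rw [Prod.mk.eta] at this
      rw [this]
      exact sum_exp_bernstein (M.tr_nonneg h y.1 y.2) (M.sum_tr h y.1 y.2) hW ht
    · simp [G, hs]
  have key := lintegral_mul_prod_le (μ := μ)
    (fun j ω => G ((ξ ω).state j h, (ξ ω).act j h) ((ξ ω).state j (h + 1)))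
    (fun j => pastOfTransition M.H ξ j h) k k
    (fun i j hij hi _ => by
      have hle := (stepInfo_le_pastOfRewards (ξ := ξ) (k := j) (h := h) ⟨hi, hij⟩ hh).trans
        pastOfRewards_le_pastOfTransition
      exact hG'.comp (((measurable_state_of_stepInfo_le hle).prodMk
        (measurable_act_of_stepInfo_le hle)).prodMk (measurable_next_of_stepInfo_le hle)))
    (fun j hj _ Z hZ => (hI.condLaw_state hj hh).lintegral_mul_le_of_discrete
      (hI.pastOfTransition_le _ _ _) measurable_stateAct_pastOfTransition
      (hI.measurable_state j (h + 1)) hG hG1 hZ) le_rfl (fun _ => 1) (fun _ _ _ => measurable_const)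
  simp only [one_mul, lintegral_one, measure_univ, G, ofReal_exp_sum] at key
  exact key

lemma IsInteraction.measurable_sum_visitsS (hI : IsInteraction M μ ξ π) (k h : ℕ) (s : S)
    {f : (A → ℝ) → ℝ} (hf : Measurable f) :
    Measurable fun ω => ∑ j ∈ (ξ ω).visitsS k h s, f ((ξ ω).rew j h) := by
  classical
  simp only [Trace.visitsS, Finset.sum_filter]
  exact Finset.measurable_fun_sum _ fun j _ =>
    Measurable.ite (hI.measurable_state j h (measurableSet_singleton s))
      (hf.comp (hI.measurable_rew j h)) measurable_const

lemma IsInteraction.measurable_sum_visitsSA (hI : IsInteraction M μ ξ π) (k h : ℕ) (s : S)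
    (a : A) (W : S → ℝ) :
    Measurable fun ω => ∑ j ∈ (ξ ω).visitsSA k h s a, W ((ξ ω).state j (h + 1)) := by
  classical
  simp only [Trace.visitsSA, Finset.sum_filter]
  exact Finset.measurable_fun_sum _ fun j _ =>
    Measurable.ite ((hI.measurable_state j h (measurableSet_singleton s)).inter
      (hI.measurable_act j h (measurableSet_singleton a)))
      ((measurable_of_finite W).comp (hI.measurable_state j (h + 1))) measurable_const

/-- Deviations at a fixed visit count, from exponential bounds. -/
lemma hoeffding_exponent {n θ D : ℝ} (hn : 0 < n) (hθ : 0 ≤ θ)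
    (hD : √(θ / (2 * n)) < |D / n|) :
    θ ≤ √(8 * θ / n) * D - n * (√(8 * θ / n) ^ 2 / 8) ∨
      θ ≤ -√(8 * θ / n) * D - n * ((-√(8 * θ / n)) ^ 2 / 8) := by
  -- The tilt `√(8θ/n)` makes the compensator equal to `θ` and the linear term at the threshold
  -- equal to `2θ`, which leaves `θ`.
  have e1 : n * (√(8 * θ / n) ^ 2 / 8) = θ := by
    rw [Real.sq_sqrt (by positivity)]; field_simp
  have e2 : √(8 * θ / n) * (n * √(θ / (2 * n))) = 2 * θ := by
    have : √(8 * θ / n) * √(θ / (2 * n)) = 2 * θ / n := by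
      rw [← Real.sqrt_mul (by positivity), show 8 * θ / n * (θ / (2 * n)) = (2 * θ / n) ^ 2 by
        field_simp; ring, Real.sqrt_sq (by positivity)]
    calc _ = n * (√(8 * θ / n) * √(θ / (2 * n))) := by ring
      _ = 2 * θ := by rw [this]; field_simp
  rw [neg_sq, e1]
  have h0 : 0 ≤ √(8 * θ / n) := Real.sqrt_nonneg _
  rcases lt_abs.1 hD with h | h
  · left
    rw [lt_div_iff₀ hn] at h
    nlinarith [mul_le_mul_of_nonneg_left h.le h0]
  · right
    rw [← neg_div, lt_div_iff₀ hn] at h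
    nlinarith [mul_le_mul_of_nonneg_left h.le h0]

/-- The unconstrained tilt is `√(θ/(nv))`; when it exceeds the admissible `1/B`, the tilt `1/B` is
used instead. In both cases the compensator is at most `θ`, and one of the two terms of the
threshold brings the linear part to `2θ`. -/
lemma bernstein_exponent {n θ v B : ℝ} (hn : 0 < n) (hθ : 0 < θ) (hv : 0 ≤ v) (hB : 0 < B) :
    ∃ t, 0 ≤ t ∧ t * B ≤ 1 ∧ ∀ D, 2 * √(v * θ / n) + 2 * B * θ / n < |D / n| →
      θ ≤ t * D - n * (t ^ 2 * v) ∨ θ ≤ -t * D - n * ((-t) ^ 2 * v) := by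
  suffices h : ∃ t, 0 ≤ t ∧ t * B ≤ 1 ∧ n * (t ^ 2 * v) ≤ θ ∧
      2 * θ ≤ t * (n * (2 * √(v * θ / n) + 2 * B * θ / n)) by
    obtain ⟨t, h0, h1, h2, h3⟩ := h
    refine ⟨t, h0, h1, fun D hD => ?_⟩
    rw [neg_sq]
    rcases lt_abs.1 hD with h | h
    · left
      rw [lt_div_iff₀ hn] at h
      nlinarith [mul_le_mul_of_nonneg_left h.le h0]
    · right
      rw [← neg_div, lt_div_iff₀ hn] at h
      nlinarith [mul_le_mul_of_nonneg_left h.le h0]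
  by_cases hc : θ * B ^ 2 ≤ n * v
  · have hv' : 0 < v := by
      by_contra hv'
      have : v = 0 := le_antisymm (not_lt.1 hv') hv
      rw [this, mul_zero] at hc
      have : 0 < θ * B ^ 2 := by positivity
      linarith
    refine ⟨√(θ / (n * v)), Real.sqrt_nonneg _, ?_, ?_, ?_⟩
    · rw [← Real.sqrt_sq hB.le, ← Real.sqrt_mul (by positivity), Real.sqrt_le_one,
        div_mul_eq_mul_div, div_le_one (by positivity)]
      exact hc
    · rw [Real.sq_sqrt (by positivity)]
      apply le_of_eq; field_simp
    · have e : √(θ / (n * v)) * √(v * θ / n) = θ / n := by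
        rw [← Real.sqrt_mul (by positivity), show θ / (n * v) * (v * θ / n) = (θ / n) ^ 2 by
          field_simp, Real.sqrt_sq (by positivity)]
      calc 2 * θ = n * (2 * (√(θ / (n * v)) * √(v * θ / n))) := by rw [e]; field_simp
        _ = √(θ / (n * v)) * (n * (2 * √(v * θ / n))) := by ring
        _ ≤ _ := by
          gcongr
          exact le_add_of_nonneg_right (by positivity)
  · push Not at hc
    refine ⟨1 / B, by positivity, by field_simp; exact le_rfl, ?_, ?_⟩
    · rw [div_pow, one_pow, div_mul_eq_mul_div, one_mul, ← mul_div_assoc,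
        div_le_iff₀ (by positivity)]
      exact hc.le
    · calc 2 * θ = 1 / B * (n * (2 * B * θ / n)) := by field_simp
        _ ≤ _ := by
          gcongr
          exact le_add_of_nonneg_left (by positivity)

/-- The optimal tilt depends on the random visit count. A union bound over its nonzero values makes
it deterministic, at the price of a factor `k`. -/
lemma measure_count_le (N : Ω → ℕ) (k : ℕ) (hN : ∀ ω, N ω ≤ k) (p : Ω → Prop) (c : ℝ≥0∞)
    (h : ∀ n, 1 ≤ n → μ {ω | N ω = n ∧ p ω} ≤ c) : μ {ω | N ω ≠ 0 ∧ p ω} ≤ k * c := by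
  have : {ω | N ω ≠ 0 ∧ p ω} ⊆ ⋃ n ∈ Finset.Icc 1 k, {ω | N ω = n ∧ p ω} := by
    intro ω hω
    simp only [Set.mem_iUnion]
    exact ⟨N ω, Finset.mem_Icc.2 ⟨Nat.one_le_iff_ne_zero.2 hω.1, hN ω⟩, rfl, hω.2⟩
  refine (measure_mono this).trans ((measure_biUnion_finset_le _ _).trans ?_)
  refine (Finset.sum_le_sum fun n hn => h n (Finset.mem_Icc.1 hn).1).trans ?_
  simp

lemma Trace.nS_le (ξ : Trace S A) (k h : ℕ) (s : S) : ξ.nS k h s ≤ k := by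
  classical
  refine (Finset.card_filter_le _ _).trans ?_
  simp

lemma Trace.nSA_le (ξ : Trace S A) (k h : ℕ) (s : S) (a : A) : ξ.nSA k h s a ≤ k := by
  classical
  refine (Finset.card_filter_le _ _).trans ?_
  simp

/-- The empirical transition means are averages over the visits. -/
lemma Trace.mean_empP (ξ : Trace S A) (k h : ℕ) (s : S) (a : A) (W : S → ℝ) :
    mean (ξ.empP k h s a) W
      = (∑ j ∈ ξ.visitsSA k h s a, W (ξ.state j (h + 1))) / ξ.nSA k h s a := by
  classical
  simp only [mean, Trace.empP, div_mul_eq_mul_div, ← Finset.sum_div]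
  congr 1
  rw [← Finset.sum_fiberwise (s := ξ.visitsSA k h s a) (g := fun j => ξ.state j (h + 1))]
  refine Finset.sum_congr rfl fun s' _ => ?_
  rw [Finset.sum_congr rfl (g := fun _ => W s')
    (fun j hj => by rw [(Finset.mem_filter.1 hj).2]), Finset.sum_const, nsmul_eq_mul]

lemma IsInteraction.measure_empR_deviation (hI : IsInteraction M μ ξ π) (k : ℕ) {h : ℕ}
    (hh : h ∈ Set.Icc 1 M.H) (s : S) {f : (A → ℝ) → ℝ} (hf : Measurable f) {a : ℝ}
    (hfa : ∀ᵐ r ∂(M.rewardLaw h s), f r ∈ Set.Icc a (a + 1)) {θ : ℝ} (hθ : 0 ≤ θ) :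
    μ {ω | (ξ ω).nS k h s ≠ 0 ∧ √(θ / (2 * (ξ ω).nS k h s))
        < |(ξ ω).empR k h s f - ∫ r, f r ∂(M.rewardLaw h s)|}
      ≤ k * (2 * ENNReal.ofReal (Real.exp (-θ))) := by
  refine measure_count_le _ k (fun ω => (ξ ω).nS_le k h s) _ _ fun n hn => ?_
  have hn0 : (0 : ℝ) < n := by exact_mod_cast hn
  set c := ∫ r, f r ∂(M.rewardLaw h s) with hc
  let G : ℝ → Ω → ℝ := fun t ω => ∑ j ∈ (ξ ω).visitsS k h s, (t * (f ((ξ ω).rew j h) - c) - t ^ 2 / 8)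
  have hGm : ∀ t, Measurable (G t) := fun t =>
    hI.measurable_sum_visitsS k h s (f := fun r => t * (f r - c) - t ^ 2 / 8) (by fun_prop)
  have hG := fun t => measure_le_of_lintegral_exp_le
    (hI.lintegral_exp_rew k hh s hf hfa t) (hGm t) θ
  have hsub : {ω | (ξ ω).nS k h s = n ∧ √(θ / (2 * (ξ ω).nS k h s))
        < |(ξ ω).empR k h s f - c|}
      ⊆ {ω | θ ≤ G (√(8 * θ / n)) ω} ∪ {ω | θ ≤ G (-√(8 * θ / n)) ω} := by
    rintro ω ⟨h1, h2⟩
    have hcard : ((ξ ω).visitsS k h s).card = n := h1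
    have e : ∀ t, G t ω = t * (∑ j ∈ (ξ ω).visitsS k h s, (f ((ξ ω).rew j h) - c))
        - n * (t ^ 2 / 8) := fun t => by
      simp only [G, Finset.sum_sub_distrib, ← Finset.mul_sum, Finset.sum_const, nsmul_eq_mul, hcard]
    have e2 : (ξ ω).empR k h s f - c
        = (∑ j ∈ (ξ ω).visitsS k h s, (f ((ξ ω).rew j h) - c)) / n := by
      rw [Trace.empR, h1, Finset.sum_sub_distrib, Finset.sum_const, nsmul_eq_mul,
        hcard]
      field_simp
    rw [e2, h1] at h2
    simp only [Set.mem_union, Set.mem_ofPred_eq, e]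
    exact hoeffding_exponent hn0 hθ h2
  refine (measure_mono hsub).trans ((measure_union_le _ _).trans ?_)
  rw [two_mul]
  exact add_le_add (hG _) (hG _)

lemma IsInteraction.measure_empP_deviation (hI : IsInteraction M μ ξ π) (k : ℕ) {h : ℕ}
    (hh : h ∈ Set.Icc 1 M.H) (s : S) (a : A) {W : S → ℝ} {B : ℝ} (hB : 0 < B)
    (hW : ∀ s, W s ∈ Set.Icc 0 B) {θ : ℝ} (hθ : 0 < θ) :
    μ {ω | (ξ ω).nSA k h s a ≠ 0 ∧
        2 * √(var (M.tr h s a) W * θ / (ξ ω).nSA k h s a) + 2 * B * θ / (ξ ω).nSA k h s a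
        < |mean ((ξ ω).empP k h s a) W - mean (M.tr h s a) W|}
      ≤ k * (2 * ENNReal.ofReal (Real.exp (-θ))) := by
  refine measure_count_le _ k (fun ω => (ξ ω).nSA_le k h s a) _ _ fun n hn => ?_
  have hn0 : (0 : ℝ) < n := by exact_mod_cast hn
  set c := mean (M.tr h s a) W with hc
  set v := var (M.tr h s a) W with hv
  have hv0 : 0 ≤ v := var_nonneg (M.tr_nonneg h s a) (M.sum_tr h s a) W
  obtain ⟨t, ht0, ht1, ht⟩ := bernstein_exponent hn0 hθ hv0 hB
  let G : ℝ → Ω → ℝ := fun t ω => ∑ j ∈ (ξ ω).visitsSA k h s a,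
    (t * (W ((ξ ω).state j (h + 1)) - c) - t ^ 2 * v)
  have hGm : ∀ t, Measurable (G t) := fun t =>
    hI.measurable_sum_visitsSA k h s a (fun r => t * (W r - c) - t ^ 2 * v)
  have hG : ∀ t : ℝ, |t| * B ≤ 1 → _ := fun t ht => measure_le_of_lintegral_exp_le
    (hI.lintegral_exp_state k hh s a hW ht) (hGm t) θ
  have hsub : {ω | (ξ ω).nSA k h s a = n ∧
        2 * √(v * θ / (ξ ω).nSA k h s a) + 2 * B * θ / (ξ ω).nSA k h s a
        < |mean ((ξ ω).empP k h s a) W - c|}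
      ⊆ {ω | θ ≤ G t ω} ∪ {ω | θ ≤ G (-t) ω} := by
    rintro ω ⟨h1, h2⟩
    have hcard : ((ξ ω).visitsSA k h s a).card = n := h1
    have e : ∀ t, G t ω = t * (∑ j ∈ (ξ ω).visitsSA k h s a, (W ((ξ ω).state j (h + 1)) - c))
        - n * (t ^ 2 * v) := fun t => by
      simp only [G, Finset.sum_sub_distrib, ← Finset.mul_sum, Finset.sum_const, nsmul_eq_mul, hcard]
      ring
    have e2 : mean ((ξ ω).empP k h s a) W - c
        = (∑ j ∈ (ξ ω).visitsSA k h s a, (W ((ξ ω).state j (h + 1)) - c)) / n := by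
      rw [Trace.mean_empP, h1, Finset.sum_sub_distrib, Finset.sum_const, nsmul_eq_mul,
        hcard]
      field_simp
    rw [e2, h1] at h2
    simp only [Set.mem_union, Set.mem_ofPred_eq, e]
    exact ht _ h2
  refine (measure_mono hsub).trans ((measure_union_le _ _).trans ?_)
  rw [two_mul]
  refine add_le_add (hG t ?_) (hG (-t) ?_)
  · rwa [abs_of_nonneg ht0]
  · rwa [abs_neg, abs_of_nonneg ht0]

end Interaction

end

section

variable {S A Ω : Type*} [Fintype S] [MeasurableSpace S] [MeasurableSingletonClass S]
  [Fintype A] [MeasurableSpace A] [MeasurableSingletonClass A]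

/-! ### Martingale concentration along the episodes -/

section Composition

variable {T : Type*} [MeasurableSpace T]

lemma measurable_comp_finite {F E : Type*} [MeasurableSpace E] [Finite F] [MeasurableSpace F]
    [MeasurableSingletonClass F] {f : T → F → E} (hf : ∀ y, Measurable (fun ω => f ω y))
    {y : T → F} (hy : Measurable y) : Measurable (fun ω => f ω (y ω)) := by
  have : Measurable (fun p : T × F => f p.1 p.2) := measurable_from_prod_countable_left hf
  exact this.comp (measurable_id.prodMk hy)

lemma measurable_played {u : T → A → ℝ} (hu : ∀ a, Measurable (fun ω => u ω a))
    {b : T → (A → ℝ) → A} (hb : Measurable (fun p : T × (A → ℝ) => b p.1 p.2)) :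
    Measurable (fun p : T × (A → ℝ) => u p.1 (b p.1 p.2)) :=
  measurable_comp_finite (f := fun (p : T × (A → ℝ)) a => u p.1 a)
    (fun a => (hu a).comp measurable_fst) hb

lemma measurable_integral_played {u : T → A → ℝ} (hu : ∀ a, Measurable (fun ω => u ω a))
    {b : T → (A → ℝ) → A} (hb : Measurable (fun p : T × (A → ℝ) => b p.1 p.2))
    (ν : Measure (A → ℝ)) [SFinite ν] : Measurable (fun ω => ∫ r, u ω (b ω r) ∂ν) :=
  ((measurable_played hu hb).stronglyMeasurable.integral_prod_right').measurable

lemma measurable_played_state {u : T → S → A → ℝ} (hu : ∀ s a, Measurable (fun ω => u ω s a))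
    {b : T → S → (A → ℝ) → A} (hb : ∀ s, Measurable (fun p : T × (A → ℝ) => b p.1 s p.2))
    {y : T → S} (hy : Measurable y) (ρ : Kernel S (A → ℝ)) [IsMarkovKernel ρ] :
    Measurable (fun p : T × (A → ℝ) => u p.1 (y p.1) (b p.1 (y p.1) p.2)
      - ∫ r, u p.1 (y p.1) (b p.1 (y p.1) r) ∂(ρ (y p.1))) := by
  refine Measurable.sub ?_ ?_
  · exact measurable_comp_finite (f := fun (p : T × (A → ℝ)) s => u p.1 s (b p.1 s p.2))
      (fun s => measurable_played (u := fun ω => u ω s) (b := fun ω => b ω s) (hu s) (hb s))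
      (hy.comp measurable_fst)
  · refine Measurable.comp (g := fun ω => ∫ r, u ω (y ω) (b ω (y ω) r) ∂(ρ (y ω))) ?_
      measurable_fst
    exact measurable_comp_finite (f := fun ω s => ∫ r, u ω s (b ω s r) ∂(ρ s))
      (fun s => measurable_integral_played (u := fun ω => u ω s) (b := fun ω => b ω s) (hu s)
        (hb s) _) hy

lemma measurable_mean {w : T → S → ℝ} (hw : ∀ s, Measurable (fun ω => w ω s)) (M : MDP S A)
    (h : ℕ) {y : T → S × A} (hy : Measurable y) :
    Measurable (fun ω => mean (M.tr h (y ω).1 (y ω).2) (w ω)) := by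
  refine measurable_comp_finite (f := fun ω (y : S × A) => mean (M.tr h y.1 y.2) (w ω))
    (fun y => ?_) hy
  simp only [mean]
  exact Finset.measurable_fun_sum _ fun s _ => (hw s).const_mul _

lemma measurable_sub_mean {w : T → S → ℝ} (hw : ∀ s, Measurable (fun ω => w ω s)) (M : MDP S A)
    (h : ℕ) {y : T → S × A} (hy : Measurable y) :
    Measurable (fun p : T × S => w p.1 p.2 - mean (M.tr h (y p.1).1 (y p.1).2) (w p.1)) :=
  (measurable_comp_finite (f := fun (p : T × S) s => w p.1 s)
    (fun s => (hw s).comp measurable_fst) measurable_snd).sub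
    ((measurable_mean hw M h hy).comp measurable_fst)

end Composition

lemma lintegral_exp_mean {W : S → ℝ} (M : MDP S A) (h : ℕ) (y : S × A) {a c : ℝ}
    (hW : ∀ s, W s ∈ Set.Icc a (a + c)) (t : ℝ) :
    ∫⁻ s', ENNReal.ofReal (Real.exp (t * (W s' - mean (M.tr h y.1 y.2) W) - t ^ 2 * c ^ 2 / 8))
      ∂(M.P h y) ≤ 1 := by
  have := lintegral_exp_hoeffding (M.P h y) (measurable_of_finite W)
    (Filter.Eventually.of_forall hW) t
  rw [add_sub_cancel_left, M.integral_P h y.1 y.2 W] at this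
  exact this

variable {m : MeasurableSpace Ω} [mΩ : MeasurableSpace Ω] {μ : Measure Ω} [IsProbabilityMeasure μ] {M : MDP S A}
  {ξ : Ω → Trace S A} {π : ℕ → Ω → DetPolicy S A}

/-- The difference between `u` at the action played at step `h` of an episode and its conditional
mean given the state. -/
def actionNoise (M : MDP S A) (ξ : Trace S A) (π : DetPolicy S A) (k h : ℕ) (u : S → A → ℝ) : ℝ :=
  u (ξ.state k h) (ξ.act k h)
    - ∫ r, u (ξ.state k h) (π.act h (ξ.state k h) r) ∂(M.rewardLaw h (ξ.state k h))

/-- The difference between `w` at the state after step `h` of an episode and its conditional mean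
given the state and the action of that step. -/
def stateNoise (M : MDP S A) (ξ : Trace S A) (k h : ℕ) (w : S → ℝ) : ℝ :=
  w (ξ.state k (h + 1)) - mean (M.tr h (ξ.state k h) (ξ.act k h)) w

lemma pastOfRewards_one_le (hH : 1 ≤ M.H) {i j : ℕ} (hi : 1 ≤ i) (hij : i < j) :
    pastOfRewards M.H ξ i 1 ≤ pastOfRewards M.H ξ j 1 := by
  refine sup_le (sup_le ?_ ?_) ?_
  · exact iSup₂_le fun l hl => iSup₂_le fun t ht =>
      stepInfo_le_pastOfRewards ⟨hl.1, hl.2.trans hij⟩ ht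
  · exact iSup₂_le fun t ht => absurd ht.2 (not_lt.2 ht.1)
  · exact (measurable_state_of_stepInfo_le
      (stepInfo_le_pastOfRewards ⟨hi, hij⟩ ⟨le_rfl, hH⟩)).comap_le

section Noise

variable (hI : IsInteraction M μ ξ π) {k h : ℕ} (hk : 1 ≤ k) (hh : h ∈ Set.Icc 1 M.H)
  {u : Ω → S → A → ℝ}
  (hu : ∀ s a, Measurable[pastOfRewards M.H ξ k 1] (fun ω => u ω s a))
  {w : Ω → S → ℝ} (hw : ∀ s, Measurable[pastOfRewards M.H ξ k 1] (fun ω => w ω s))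

include hI hk hh hu in
lemma measurable_actionNoise_aux (hm : pastOfRewards M.H ξ k 1 ≤ m)
    (hs : Measurable[m] (fun ω => (ξ ω).state k h)) :
    @Measurable (Ω × (A → ℝ)) ℝ (m.prod inferInstance) _ (fun p =>
      u p.1 ((ξ p.1).state k h) ((π k p.1).act h ((ξ p.1).state k h) p.2)
      - ∫ r, u p.1 ((ξ p.1).state k h) ((π k p.1).act h ((ξ p.1).state k h) r)
        ∂(M.rewardLaw h ((ξ p.1).state k h))) := by
  refine @measurable_played_state S A _ _ _ _ _ _ Ω m u (fun s a => (hu s a).mono hm le_rfl)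
    (fun ω s r => (π k ω).act h s r) (fun s => ?_) _ hs (M.rewardLaw h) _
  refine (hI.measurable_policy k hk h hh s).mono ?_ le_rfl
  exact sup_le_sup (MeasurableSpace.comap_mono hm) le_rfl

include hI hk hh hu in
lemma measurable_actionNoise (hm : pastOfRewards M.H ξ k 1 ≤ m)
    (hs : Measurable[m] (fun ω => (ξ ω).state k h)) (hr : Measurable[m] (fun ω => (ξ ω).rew k h)) :
    Measurable[m] (fun ω => actionNoise M (ξ ω) (π k ω) k h (u ω)) := by
  have h1 : @Measurable Ω (Ω × (A → ℝ)) m (m.prod inferInstance) (fun ω => (ω, (ξ ω).rew k h)) :=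
    (@measurable_id Ω m).prodMk hr
  have h2 := (measurable_actionNoise_aux hI hk hh hu hm hs).comp h1
  have h3 : (fun ω => actionNoise M (ξ ω) (π k ω) k h (u ω)) = (fun p : Ω × (A → ℝ) =>
      u p.1 ((ξ p.1).state k h) ((π k p.1).act h ((ξ p.1).state k h) p.2)
      - ∫ r, u p.1 ((ξ p.1).state k h) ((π k p.1).act h ((ξ p.1).state k h) r)
        ∂(M.rewardLaw h ((ξ p.1).state k h))) ∘ fun ω => (ω, (ξ ω).rew k h) := by
    funext ω
    simp only [actionNoise, Function.comp, hI.act_eq k hk h hh ω]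
  rw [h3]
  exact h2

include hw in
lemma measurable_stateNoise (hm : pastOfRewards M.H ξ k 1 ≤ m)
    (hs : Measurable[m] (fun ω => (ξ ω).state k h)) (ha : Measurable[m] (fun ω => (ξ ω).act k h))
    (hs' : Measurable[m] (fun ω => (ξ ω).state k (h + 1))) :
    Measurable[m] (fun ω => stateNoise M (ξ ω) k h (w ω)) := by
  have hw' : ∀ s, Measurable[m] (fun ω => w ω s) := fun s => (hw s).mono hm le_rfl
  have h1 := @measurable_sub_mean S A _ _ _ _ _ _ Ω m w hw' M h
    (fun ω => ((ξ ω).state k h, (ξ ω).act k h)) (hs.prodMk ha)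
  have h2 : @Measurable Ω (Ω × S) m (m.prod inferInstance)
      (fun ω => (ω, (ξ ω).state k (h + 1))) := (@measurable_id Ω m).prodMk hs'
  exact h1.comp h2

variable {a a' c : ℝ}

include hI hk hh hu in
lemma lintegral_mul_exp_actionNoise (hua : ∀ ω s x, u ω s x ∈ Set.Icc a (a + c)) (t : ℝ)
    {Z : Ω → ℝ≥0∞} (hZ : Measurable[pastOfRewards M.H ξ k h] Z) :
    ∫⁻ ω, Z ω * ENNReal.ofReal (Real.exp (t * actionNoise M (ξ ω) (π k ω) k h (u ω)
      - t ^ 2 * c ^ 2 / 8)) ∂μ ≤ ∫⁻ ω, Z ω ∂μ := by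
  have hm := pastOfRewards_mono (H := M.H) (ξ := ξ) (k := k) le_rfl hh.1
  have key := (hI.condLaw_rew hk hh).lintegral_mul_le (hI.pastOfRewards_le _ _ _)
    measurable_state_pastOfRewards (hI.measurable_rew k h)
    (g := fun p => ENNReal.ofReal (Real.exp (t * (
      u p.1 ((ξ p.1).state k h) ((π k p.1).act h ((ξ p.1).state k h) p.2)
      - ∫ r, u p.1 ((ξ p.1).state k h) ((π k p.1).act h ((ξ p.1).state k h) r)
        ∂(M.rewardLaw h ((ξ p.1).state k h))) - t ^ 2 * c ^ 2 / 8)))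
    (ENNReal.measurable_ofReal.comp (Real.measurable_exp.comp
      (((measurable_actionNoise_aux hI hk hh hu hm measurable_state_pastOfRewards).const_mul
        t).sub_const _)))
    (fun ω => by
      have := lintegral_exp_hoeffding (M.rewardLaw h ((ξ ω).state k h))
        (f := fun r => u ω ((ξ ω).state k h) ((π k ω).act h ((ξ ω).state k h) r))
        ((measurable_of_finite _).comp ((π k ω).measurable_act h _))
        (Filter.Eventually.of_forall fun r => hua ω _ _) t
      rwa [add_sub_cancel_left] at this) hZ
  refine le_of_eq_of_le (lintegral_congr fun ω => ?_) key
  simp only [actionNoise, hI.act_eq k hk h hh ω]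

include hI hk hh hw in
lemma lintegral_mul_exp_stateNoise (hwa : ∀ ω s, w ω s ∈ Set.Icc a' (a' + c)) (t : ℝ)
    {Z : Ω → ℝ≥0∞} (hZ : Measurable[pastOfTransition M.H ξ k h] Z) :
    ∫⁻ ω, Z ω * ENNReal.ofReal (Real.exp (t * stateNoise M (ξ ω) k h (w ω)
      - t ^ 2 * c ^ 2 / 8)) ∂μ ≤ ∫⁻ ω, Z ω ∂μ := by
  have hm := (pastOfRewards_mono (H := M.H) (ξ := ξ) (k := k) le_rfl hh.1).trans
    pastOfRewards_le_pastOfTransition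
  have hw' : ∀ s, Measurable[pastOfTransition M.H ξ k h] (fun ω => w ω s) :=
    fun s => (hw s).mono hm le_rfl
  have h1 := @measurable_sub_mean S A _ _ _ _ _ _ Ω (pastOfTransition M.H ξ k h) w hw' M h
    (fun ω => ((ξ ω).state k h, (ξ ω).act k h)) measurable_stateAct_pastOfTransition
  exact (hI.condLaw_state hk hh).lintegral_mul_le (hI.pastOfTransition_le _ _ _)
    measurable_stateAct_pastOfTransition (hI.measurable_state k (h + 1))
    (g := fun p => ENNReal.ofReal (Real.exp (t * (w p.1 p.2
      - mean (M.tr h ((ξ p.1).state k h) ((ξ p.1).act k h)) (w p.1)) - t ^ 2 * c ^ 2 / 8)))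
    (ENNReal.measurable_ofReal.comp (Real.measurable_exp.comp
      ((h1.const_mul t).sub_const _)))
    (fun ω => lintegral_exp_mean M h ((ξ ω).state k h, (ξ ω).act k h) (hwa ω) t) hZ

end Noise

/-- Azuma's inequality along the steps of `K` episodes. -/
lemma IsInteraction.measure_noise_le (hI : IsInteraction M μ ξ π) (K : ℕ) (hK : 1 ≤ K)
    (u : ℕ → ℕ → Ω → S → A → ℝ) (w : ℕ → ℕ → Ω → S → ℝ)
    (hu : ∀ k ≥ 1, ∀ h ∈ Set.Icc 1 M.H, ∀ s a,
      Measurable[pastOfRewards M.H ξ k 1] (fun ω => u k h ω s a))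
    (hw : ∀ k ≥ 1, ∀ h ∈ Set.Icc 1 M.H, ∀ s,
      Measurable[pastOfRewards M.H ξ k 1] (fun ω => w k h ω s))
    {a a' c : ℝ} (hc : 0 < c)
    (hua : ∀ k ≥ 1, ∀ h ∈ Set.Icc 1 M.H, ∀ ω s x, u k h ω s x ∈ Set.Icc a (a + c))
    (hwa : ∀ k ≥ 1, ∀ h ∈ Set.Icc 1 M.H, ∀ ω s, w k h ω s ∈ Set.Icc a' (a' + c))
    {θ : ℝ} (hθ : 0 ≤ θ) :
    μ {ω | c * √(K * M.H * θ) ≤ ∑ k ∈ Finset.Icc 1 K, ∑ h ∈ Finset.Icc 1 M.H,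
        (actionNoise M (ξ ω) (π k ω) k h (u k h ω) + stateNoise M (ξ ω) k h (w k h ω))}
      ≤ ENNReal.ofReal (Real.exp (-θ)) := by
  have hH := M.one_le_H
  -- Each step carries two noises, each with compensator `t²c²/8`. At this tilt the total
  -- compensator is `θ` and the linear term at the threshold is `2θ`.
  set t : ℝ := 2 * √(θ / (K * M.H)) / c with ht
  let FR : ℕ → ℕ → Ω → ℝ≥0∞ := fun k h ω => ENNReal.ofReal (Real.exp
    (t * actionNoise M (ξ ω) (π k ω) k h (u k h ω) - t ^ 2 * c ^ 2 / 8))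
  let FP : ℕ → ℕ → Ω → ℝ≥0∞ := fun k h ω => ENNReal.ofReal (Real.exp
    (t * stateNoise M (ξ ω) k h (w k h ω) - t ^ 2 * c ^ 2 / 8))
  have hexp : Measurable fun x : ℝ => ENNReal.ofReal (Real.exp (t * x - t ^ 2 * c ^ 2 / 8)) := by
    fun_prop
  have hF : ∀ k ≥ 1, ∀ h ∈ Set.Icc 1 M.H, ∀ m : MeasurableSpace Ω,
      pastOfRewards M.H ξ k 1 ≤ m → stepInfo ξ k h ≤ m →
      Measurable[m] (fun ω => FR k h ω * FP k h ω) := by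
    intro k hk h hh m hm hs
    exact (hexp.comp (measurable_actionNoise (mΩ := mΩ) hI hk hh (hu k hk h hh) hm
      (measurable_state_of_stepInfo_le hs) (measurable_rew_of_stepInfo_le hs))).mul
      (hexp.comp (measurable_stateNoise (hw k hk h hh) hm (measurable_state_of_stepInfo_le hs)
        (measurable_act_of_stepInfo_le hs) (measurable_next_of_stepInfo_le hs)))
  have hstep : ∀ k ≥ 1, ∀ h ∈ Set.Icc 1 M.H, ∀ Z : Ω → ℝ≥0∞,
      Measurable[pastOfRewards M.H ξ k h] Z →
      ∫⁻ ω, Z ω * (FR k h ω * FP k h ω) ∂μ ≤ ∫⁻ ω, Z ω ∂μ := by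
    intro k hk h hh Z hZ
    have hm := (pastOfRewards_mono (H := M.H) (ξ := ξ) (k := k) le_rfl hh.1).trans
      pastOfRewards_le_pastOfTransition
    have hR : Measurable[pastOfTransition M.H ξ k h] (FR k h) :=
      hexp.comp (measurable_actionNoise hI hk hh (hu k hk h hh) hm
        (measurable_state_pastOfRewards.mono pastOfRewards_le_pastOfTransition le_rfl)
        measurable_rew_pastOfTransition)
    simp only [← mul_assoc]
    -- The next state is integrated out first, given the rewards and the action, and then the
    -- rewards given the state.
    exact (lintegral_mul_exp_stateNoise hI hk hh (hw k hk h hh) (hwa k hk h hh) t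
      ((hZ.mono pastOfRewards_le_pastOfTransition le_rfl).mul hR)).trans
      (lintegral_mul_exp_actionNoise hI hk hh (hu k hk h hh) (hua k hk h hh) t hZ)
  -- A whole episode is one factor of the outer product; `Z` stands for the product over the earlier
  -- episodes.
  have hepisode : ∀ k, 1 ≤ k → ∀ Z : Ω → ℝ≥0∞, Measurable[pastOfRewards M.H ξ k 1] Z →
      ∫⁻ ω, Z ω * ∏ h ∈ Finset.Icc 1 M.H, (FR k h ω * FP k h ω) ∂μ ≤ ∫⁻ ω, Z ω ∂μ := by
    intro k hk Z hZ
    refine lintegral_mul_prod_le (fun h ω => FR k h ω * FP k h ω)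
      (fun h => pastOfRewards M.H ξ k h) M.H M.H ?_ ?_ le_rfl Z ?_
    · exact fun i j hij hi hj => hF k hk i ⟨hi, by omega⟩ _
        (pastOfRewards_mono le_rfl (by omega)) (stepInfo_le_pastOfRewards_same ⟨hi, hij⟩)
    · exact fun j hj hjH Z hZ => hstep k hk j ⟨hj, hjH⟩ Z hZ
    · exact fun j hj _ => hZ.mono (pastOfRewards_mono le_rfl hj) le_rfl
  have key := lintegral_mul_prod_le (μ := μ)
    (fun k ω => ∏ h ∈ Finset.Icc 1 M.H, (FR k h ω * FP k h ω))
    (fun k => pastOfRewards M.H ξ k 1) K K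
    (fun i j hij hi _ => Finset.measurable_fun_prod _ fun h hh =>
      hF i hi h (by simpa using hh) _ (pastOfRewards_one_le hH hi hij)
        (stepInfo_le_pastOfRewards ⟨hi, hij⟩ (by simpa using hh)))
    (fun k hk _ Z hZ => hepisode k hk Z hZ) le_rfl (fun _ => 1) (fun _ _ _ => measurable_const)
  have e : ∀ ω, ∏ k ∈ Finset.Icc 1 K, ∏ h ∈ Finset.Icc 1 M.H, (FR k h ω * FP k h ω)
      = ENNReal.ofReal (Real.exp (t * (∑ k ∈ Finset.Icc 1 K, ∑ h ∈ Finset.Icc 1 M.H,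
        (actionNoise M (ξ ω) (π k ω) k h (u k h ω) + stateNoise M (ξ ω) k h (w k h ω)))
        - K * M.H * (t ^ 2 * c ^ 2 / 4))) := by
    intro ω
    have e1 : ∀ k h, FR k h ω * FP k h ω = ENNReal.ofReal (Real.exp
        (t * (actionNoise M (ξ ω) (π k ω) k h (u k h ω) + stateNoise M (ξ ω) k h (w k h ω))
          - t ^ 2 * c ^ 2 / 4)) := fun k h => by
      simp only [FR, FP]
      rw [← ENNReal.ofReal_mul (Real.exp_nonneg _), ← Real.exp_add]
      ring_nf
    simp only [e1]
    simp only [← ENNReal.ofReal_prod_of_nonneg (fun _ _ => Real.exp_nonneg _), ← Real.exp_sum,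
      Finset.sum_sub_distrib, Finset.mul_sum, Finset.sum_const, nsmul_eq_mul, Nat.card_Icc,
      Nat.add_sub_cancel]
    ring_nf
  simp only [one_mul, lintegral_one, measure_univ, e] at key
  have hm : Measurable fun ω => t * (∑ k ∈ Finset.Icc 1 K, ∑ h ∈ Finset.Icc 1 M.H,
        (actionNoise M (ξ ω) (π k ω) k h (u k h ω) + stateNoise M (ξ ω) k h (w k h ω)))
        - K * M.H * (t ^ 2 * c ^ 2 / 4) := by
    refine Measurable.sub_const (Measurable.const_mul ?_ t) _
    refine Finset.measurable_fun_sum _ fun k hk => Finset.measurable_fun_sum _ fun h hh => ?_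
    have hk' : 1 ≤ k := (Finset.mem_Icc.1 hk).1
    have hh' : h ∈ Set.Icc 1 M.H := by simpa using hh
    exact (measurable_actionNoise hI hk' hh' (hu k hk' h hh') (hI.pastOfRewards_le _ _ _)
      (hI.measurable_state k h) (hI.measurable_rew k h)).add
      (measurable_stateNoise (hw k hk' h hh') (hI.pastOfRewards_le _ _ _)
      (hI.measurable_state k h) (hI.measurable_act k h) (hI.measurable_state k (h + 1)))
  refine (measure_mono fun ω hω => ?_).trans (measure_le_of_lintegral_exp_le key hm θ)
  simp only [Set.mem_ofPred_eq] at hω ⊢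
  have hn : (0 : ℝ) < K * M.H := by
    have : (1 : ℝ) ≤ K := by exact_mod_cast hK
    have : (1 : ℝ) ≤ M.H := by exact_mod_cast hH
    positivity
  have ht0 : 0 ≤ t := by positivity
  have h1 := mul_le_mul_of_nonneg_left hω ht0
  have e2 : t * (c * √(K * M.H * θ)) = 2 * θ := by
    rw [ht]
    have : √(θ / (K * M.H)) * √(K * M.H * θ) = θ := by
      rw [← Real.sqrt_mul (by positivity), show θ / (K * M.H) * (K * M.H * θ) = θ ^ 2 by
        field_simp, Real.sqrt_sq hθ]
    calc _ = 2 * (√(θ / (K * M.H)) * √(K * M.H * θ)) := by field_simp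
      _ = 2 * θ := by rw [this]
  have e3 : K * M.H * (t ^ 2 * c ^ 2 / 4) = θ := by
    rw [ht, div_pow, mul_pow, Real.sq_sqrt (by positivity)]
    field_simp
    ring
  rw [e2] at h1
  rw [e3]
  linarith

end

section

variable {S A Ω : Type*} [Fintype S] [MeasurableSpace S] [MeasurableSingletonClass S]
  [Fintype A] [MeasurableSpace A] [MeasurableSingletonClass A]

/-! ### Measurability of the optimistic values and of the values of the policies played -/

section Data

variable {T : Type*} [MeasurableSpace T] {H k h : ℕ} {δ : ℝ} {ξ : T → Trace S A}

/-- The data of the episodes before `k` are measurable. -/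
structure MeasurableData (H k : ℕ) (ξ : T → Trace S A) : Prop where
  state : ∀ j ∈ Set.Ico 1 k, ∀ h ∈ Set.Icc 1 H, Measurable fun ω => (ξ ω).state j h
  next : ∀ j ∈ Set.Ico 1 k, ∀ h ∈ Set.Icc 1 H, Measurable fun ω => (ξ ω).state j (h + 1)
  rew : ∀ j ∈ Set.Ico 1 k, ∀ h ∈ Set.Icc 1 H, Measurable fun ω => (ξ ω).rew j h
  act : ∀ j ∈ Set.Ico 1 k, ∀ h ∈ Set.Icc 1 H, Measurable fun ω => (ξ ω).act j h

lemma mem_Ico_of_mem_Icc_pred {j k : ℕ} (hj : j ∈ Finset.Icc 1 (k - 1)) : j ∈ Set.Ico 1 k := by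
  rw [Finset.mem_Icc] at hj
  exact ⟨hj.1, by omega⟩

namespace MeasurableData

variable (hd : MeasurableData H k ξ) (hh : h ∈ Set.Icc 1 H)

include hd hh

lemma measurable_nS (s : S) : Measurable fun ω => (ξ ω).nS (k - 1) h s := by
  classical
  simp only [Trace.nS, Trace.visitsS, Finset.card_filter]
  exact Finset.measurable_fun_sum _ fun j hj => Measurable.ite
    (hd.state j (mem_Ico_of_mem_Icc_pred hj) h hh (measurableSet_singleton s))
    measurable_const measurable_const

lemma measurableSet_visit {j : ℕ} (hj : j ∈ Finset.Icc 1 (k - 1)) (s : S) (a : A) :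
    MeasurableSet {ω | (ξ ω).state j h = s ∧ (ξ ω).act j h = a} :=
  (hd.state j (mem_Ico_of_mem_Icc_pred hj) h hh (measurableSet_singleton s)).inter
    (hd.act j (mem_Ico_of_mem_Icc_pred hj) h hh (measurableSet_singleton a))

lemma measurable_nSA (s : S) (a : A) : Measurable fun ω => (ξ ω).nSA (k - 1) h s a := by
  classical
  simp only [Trace.nSA, Trace.visitsSA, Finset.card_filter]
  exact Finset.measurable_fun_sum _ fun j hj => Measurable.ite
    (hd.measurableSet_visit hh hj s a) measurable_const measurable_const

lemma measurable_nSA_real (s : S) (a : A) :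
    Measurable fun ω => ((ξ ω).nSA (k - 1) h s a : ℝ) :=
  (measurable_of_countable (fun n : ℕ => (n : ℝ))).comp (hd.measurable_nSA hh s a)

lemma measurable_nS_real (s : S) : Measurable fun ω => ((ξ ω).nS (k - 1) h s : ℝ) :=
  (measurable_of_countable (fun n : ℕ => (n : ℝ))).comp (hd.measurable_nS hh s)

lemma measurable_empP (s : S) (a : A) (s' : S) :
    Measurable fun ω => (ξ ω).empP (k - 1) h s a s' := by
  classical
  simp only [Trace.empP]
  refine Measurable.div ?_ (hd.measurable_nSA_real hh s a)
  refine (measurable_of_countable (fun n : ℕ => (n : ℝ))).comp ?_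
  simp only [Trace.visitsSA, Finset.filter_filter, Finset.card_filter]
  exact Finset.measurable_fun_sum _ fun j hj => Measurable.ite
    ((hd.measurableSet_visit hh hj s a).inter
      (hd.next j (mem_Ico_of_mem_Icc_pred hj) h hh (measurableSet_singleton s')))
    measurable_const measurable_const

lemma measurable_mean_empP {V : T → S → ℝ} (hV : ∀ s, Measurable fun ω => V ω s) (s : S) (a : A) :
    Measurable fun ω => mean ((ξ ω).empP (k - 1) h s a) (V ω) :=
  Finset.measurable_fun_sum _ fun s' _ => (hd.measurable_empP hh s a s').mul (hV s')

lemma measurable_bonusP {V : T → S → ℝ} (hV : ∀ s, Measurable fun ω => V ω s) (s : S) (a : A) :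
    Measurable fun ω => bonusP H δ (ξ ω) k h (V ω) s a := by
  have h1 : Measurable fun ω => var ((ξ ω).empP (k - 1) h s a) (V ω) :=
    (Finset.measurable_fun_sum _ fun s' _ =>
      (hd.measurable_empP hh s a s').mul ((hV s').pow_const 2)).sub
      ((hd.measurable_mean_empP hh hV s a).pow_const 2)
  have h2 := hd.measurable_nSA_real hh s a
  unfold bonusP
  fun_prop

end MeasurableData

lemma MeasurableData.measurable_optimisticToGo [Nonempty A] (hd : MeasurableData H k ξ) {n : ℕ}
    (hn : n ≤ H) (s : S) : Measurable fun ω => optimisticToGo H δ (ξ ω) k n s := by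
  classical
  induction n generalizing s with
  | zero => simp [optimisticToGo]
  | succ n ih =>
    have hh : H - n ∈ Set.Icc 1 H := ⟨by omega, by omega⟩
    have ih' := ih (by omega)
    simp only [optimisticToGo]
    refine Measurable.ite (hd.measurable_nS hh s (measurableSet_singleton 0)) measurable_const ?_
    refine Measurable.min (Measurable.add ?_ ?_) measurable_const
    · simp only [Trace.empR]
      refine Measurable.div ?_ (hd.measurable_nS_real hh s)
      simp only [Trace.visitsS, Finset.sum_filter]
      refine Finset.measurable_fun_sum _ fun j hj => Measurable.ite
        (hd.state j (mem_Ico_of_mem_Icc_pred hj) _ hh (measurableSet_singleton s)) ?_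
        measurable_const
      refine Measurable.iSup fun a => ?_
      exact (((measurable_pi_apply a).comp (hd.rew j (mem_Ico_of_mem_Icc_pred hj) _ hh)).add
        (hd.measurable_bonusP hh ih' s a)).add (hd.measurable_mean_empP hh ih' s a)
    · have h2 := hd.measurable_nS_real hh s
      unfold bonusR
      fun_prop

lemma MeasurableData.measurable_optimisticValue [Nonempty A] (hd : MeasurableData H k ξ)
    (hh : 1 ≤ h) (s : S) : Measurable fun ω => optimisticValue H δ (ξ ω) k h s :=
  hd.measurable_optimisticToGo (by omega) s

/-- The policy is random here, so measurability goes through the Bellman equation by backward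
induction, each step being an integral depending measurably on a parameter. -/
lemma measurable_value (M : MDP S A) {b : T → DetPolicy S A}
    (hb : ∀ h ∈ Set.Icc 1 M.H, ∀ s : S, Measurable fun p : T × (A → ℝ) => (b p.1).act h s p.2)
    {n : ℕ} (hn : n ≤ M.H) (s : S) :
    Measurable fun ω => M.value (b ω).toPolicy (M.H + 1 - n) s := by
  induction n generalizing s with
  | zero => simp [MDP.value_terminal]
  | succ n ih =>
    have e : M.H + 1 - (n + 1) = M.H - n := by omega
    have e' : M.H - n + 1 = M.H + 1 - n := by omega
    have hh : M.H - n ∈ Set.Icc 1 M.H := ⟨by omega, by omega⟩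
    rw [e]
    simp only [M.value_detPolicy_bellman _ hh.2, e']
    have hu : ∀ a, Measurable fun ω => mean (M.tr (M.H - n) s a)
        (M.value (b ω).toPolicy (M.H + 1 - n)) := fun a => by
      simp only [mean]
      exact Finset.measurable_fun_sum _ fun s' _ => (ih (by omega) s').const_mul _
    have hp := measurable_played (b := fun ω r => (b ω).act (M.H - n) s r) hu (hb _ hh s)
    have hm := (MDP.measurable_eval.comp (measurable_snd.prodMk (hb _ hh s))).add hp
    exact (hm.stronglyMeasurable.integral_prod_right').measurable

end Data

section Past

variable [mΩ : MeasurableSpace Ω] {μ : Measure Ω} {M : MDP S A} {ξ : Ω → Trace S A}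
  {π : ℕ → Ω → DetPolicy S A} {k h : ℕ} {δ : ℝ}

lemma measurableData_pastOfRewards (H k : ℕ) (ξ : Ω → Trace S A) :
    @MeasurableData S A _ _ Ω (pastOfRewards H ξ k 1) H k ξ :=
  @MeasurableData.mk S A _ _ Ω (pastOfRewards H ξ k 1) H k ξ
    (fun _ hj _ hh => measurable_state_of_stepInfo_le (stepInfo_le_pastOfRewards hj hh))
    (fun _ hj _ hh => measurable_next_of_stepInfo_le (stepInfo_le_pastOfRewards hj hh))
    (fun _ hj _ hh => measurable_rew_of_stepInfo_le (stepInfo_le_pastOfRewards hj hh))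
    (fun _ hj _ hh => measurable_act_of_stepInfo_le (stepInfo_le_pastOfRewards hj hh))

lemma measurable_optimisticValue_pastOfRewards [Nonempty A] {H : ℕ} (hh : 1 ≤ h) (s : S) :
    Measurable[pastOfRewards H ξ k 1] fun ω => optimisticValue H δ (ξ ω) k h s :=
  @MeasurableData.measurable_optimisticValue S A _ _ _ _ _ _ Ω (pastOfRewards H ξ k 1) H k h δ ξ _
    (measurableData_pastOfRewards H k ξ) hh s

lemma IsInteraction.measurable_value_pastOfRewards (hI : IsInteraction M μ ξ π) (hk : 1 ≤ k)
    (hh : h ∈ Set.Icc 1 (M.H + 1)) (s : S) :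
    Measurable[pastOfRewards M.H ξ k 1] fun ω => M.value (π k ω).toPolicy h s := by
  have := @measurable_value S A _ _ _ _ _ _ Ω (pastOfRewards M.H ξ k 1) M (π k)
    (hI.measurable_policy k hk) (M.H + 1 - h) (by have := hh.1; omega) s
  rwa [Nat.sub_sub_self hh.2] at this

lemma measurable_bonusP_pastOfRewards [Nonempty A] {H : ℕ} (hh : h ∈ Set.Icc 1 H) (s : S) (a : A) :
    Measurable[pastOfRewards H ξ k 1]
      fun ω => bonusP H δ (ξ ω) k h (optimisticValue H δ (ξ ω) k (h + 1)) s a :=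
  @MeasurableData.measurable_bonusP S A _ _ _ _ _ _ Ω (pastOfRewards H ξ k 1) H k h δ ξ
    (measurableData_pastOfRewards H k ξ) hh _
    (fun s => measurable_optimisticValue_pastOfRewards (by omega) s) s a

end Past

end

section

/-! ### Elementary inequalities -/

lemma sqrt_add_le_add (x y : ℝ) (hx : 0 ≤ x) (hy : 0 ≤ y) : √(x + y) ≤ √x + √y := by
  rw [Real.sqrt_le_left (by positivity)]
  nlinarith [Real.sq_sqrt hx, Real.sq_sqrt hy, Real.sqrt_nonneg x, Real.sqrt_nonneg y,
    mul_nonneg (Real.sqrt_nonneg x) (Real.sqrt_nonneg y)]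

lemma two_mul_sqrt_mul_le {x y : ℝ} (hx : 0 ≤ x) (hy : 0 ≤ y) : 2 * √(x * y) ≤ x + y := by
  rw [Real.sqrt_mul hx]
  nlinarith [Real.sq_sqrt hx, Real.sq_sqrt hy, sq_nonneg (√x - √y)]

lemma sqrt_sq_mul {c : ℝ} (hc : 0 ≤ c) (x : ℝ) : √(c ^ 2 * x) = c * √x := by
  rw [Real.sqrt_mul (sq_nonneg c), Real.sqrt_sq hc]

/-- From a Bernstein bound with the true variance `v` to one with the variance `b` of an upper
bound, for the empirical weights. -/
lemma deviation_le_of_empirical_variance {H ℓ v e b m d y z : ℝ} (hH : 1 ≤ H) (hℓ : 0 ≤ ℓ)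
    (hℓ1 : 400 / 9 * ℓ ≤ 1) (hv : 0 ≤ v) (hb : 0 ≤ b) (hm : 0 ≤ m)
    (hd : |d| ≤ 2 * √(v * ℓ) + 2 * H * ℓ) (hz : z ≤ H ^ 2 * v)
    (hy : v - y ≤ 2 * √(z * ℓ) + 2 * H ^ 2 * ℓ) (hye : y = e + d ^ 2)
    (heb : e ≤ 2 * b + 2 * (H * m)) :
    d ≤ 20 / 3 * √(b * ℓ) + 400 / 9 * (H * ℓ) + m := by
  -- The roles are: `v` and `e` are the true and the empirical variance of V*, `b` the empirical
  -- variance of the upper bound, `m` the empirical mean of their difference, `y` and `z` the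
  -- empirical mean and the true variance of the squared deviation.
  have h1 : 2 * √(z * ℓ) ≤ v / 4 + 4 * H ^ 2 * ℓ := by
    refine le_trans ?_ (two_mul_sqrt_mul_le (by positivity : 0 ≤ v / 4)
      (by positivity : 0 ≤ 4 * H ^ 2 * ℓ))
    exact mul_le_mul_of_nonneg_left
      (Real.sqrt_le_sqrt (by nlinarith [mul_le_mul_of_nonneg_right hz hℓ])) two_pos.le
  have hsq : √(v * ℓ) ^ 2 = v * ℓ := Real.sq_sqrt (by positivity)
  have h2 : d ^ 2 ≤ 8 * (v * ℓ) + 8 * H ^ 2 * ℓ ^ 2 := by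
    rw [← sq_abs]
    have := pow_le_pow_left₀ (abs_nonneg d) hd 2
    nlinarith [sq_nonneg (2 * √(v * ℓ) - 2 * H * ℓ)]
  have h3 : v * ℓ ≤ v * (9 / 400) := by gcongr; linarith
  have h4 : H ^ 2 * ℓ ^ 2 ≤ H ^ 2 * ℓ * (9 / 400) := by
    rw [sq ℓ, ← mul_assoc]; gcongr; linarith
  -- The terms in `v` on the right add up to `(1/4 + 8 · 9/400) v`, less than `v/2`, and are
  -- absorbed.
  have h5 : v ≤ 4 * b + 4 * (H * m) + 16 * (H ^ 2 * ℓ) := by nlinarith [mul_nonneg (sq_nonneg H) hℓ]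
  have h6 : √(v * ℓ) ≤ √(2 ^ 2 * (b * ℓ)) + (√(2 ^ 2 * (m * (H * ℓ))) + √((4 * (H * ℓ)) ^ 2)) := by
    refine le_trans (Real.sqrt_le_sqrt ?_) ((sqrt_add_le_add (2 ^ 2 * (b * ℓ))
      (2 ^ 2 * (m * (H * ℓ)) + (4 * (H * ℓ)) ^ 2) (by positivity) (by positivity)).trans
      (add_le_add_right (sqrt_add_le_add _ _ (by positivity) (by positivity)) _))
    nlinarith [mul_le_mul_of_nonneg_right h5 hℓ]
  rw [sqrt_sq_mul two_pos.le, sqrt_sq_mul two_pos.le, Real.sqrt_sq (by positivity)] at h6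
  -- The split is weighted so that `m` appears with coefficient exactly one, the amount available in
  -- the conclusion. In total `d ≤ 4 √(bℓ) + 14 Hℓ + m`, within the constants of the bonus.
  have h7 : 4 * √(m * (H * ℓ)) ≤ m + 4 * (H * ℓ) := by
    have := two_mul_sqrt_mul_le hm (by positivity : 0 ≤ 4 * (H * ℓ))
    rw [show m * (4 * (H * ℓ)) = 2 ^ 2 * (m * (H * ℓ)) by ring, sqrt_sq_mul two_pos.le] at this
    linarith
  have h8 : 0 ≤ H * ℓ := by positivity
  linarith [le_abs_self d, Real.sqrt_nonneg (b * ℓ)]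

/-! ### Means and variances for weights on a finite set -/

section Weights

variable {S : Type*} [Fintype S] {p q : S → ℝ}

lemma mean_sub (p V W : S → ℝ) : mean p (fun s => V s - W s) = mean p V - mean p W := by
  simp only [mean, mul_sub, Finset.sum_sub_distrib]

lemma mean_mono (hp : ∀ s, 0 ≤ p s) {V W : S → ℝ} (h : ∀ s, V s ≤ W s) : mean p V ≤ mean p W :=
  Finset.sum_le_sum fun s _ => mul_le_mul_of_nonneg_left (h s) (hp s)

lemma mean_nonneg (hp : ∀ s, 0 ≤ p s) {V : S → ℝ} (h : ∀ s, 0 ≤ V s) : 0 ≤ mean p V :=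
  Finset.sum_nonneg fun s _ => mul_nonneg (hp s) (h s)

lemma mean_const_mul (p V : S → ℝ) (c : ℝ) : mean p (fun s => c * V s) = c * mean p V := by
  simp only [mean, Finset.mul_sum]
  exact Finset.sum_congr rfl fun s _ => by ring

lemma mean_add (p V W : S → ℝ) : mean p (fun s => V s + W s) = mean p V + mean p W := by
  simp only [mean, mul_add, Finset.sum_add_distrib]

lemma mean_sq_le (hp : ∀ s, 0 ≤ p s) {V : S → ℝ} {B : ℝ} (h : ∀ s, V s ∈ Set.Icc 0 B) :
    mean p (fun s => V s ^ 2) ≤ B * mean p V := by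
  rw [← mean_const_mul]
  exact mean_mono hp fun s => by nlinarith [(h s).1, (h s).2]

/-- This transfers means of data-dependent functions from empirical to true weights. The additive
errors over all states cost the factor `|S|` that becomes the second S of the lower-order term. -/
lemma mean_le_of_le_add {r : ℝ} (hp : ∀ s, p s ≤ 2 * q s + 3 * r) {V : S → ℝ} {B : ℝ} (hr : 0 ≤ r)
    (h : ∀ s, V s ∈ Set.Icc 0 B) : mean p V ≤ 2 * mean q V + 3 * (Fintype.card S * (B * r)) := by
  calc mean p V ≤ ∑ s, (2 * (q s * V s) + 3 * (B * r)) := by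
        refine Finset.sum_le_sum fun s _ => ?_
        have h1 := mul_le_mul_of_nonneg_right (hp s) (h s).1
        have h2 := mul_le_mul_of_nonneg_left (h s).2 hr
        linarith
    _ = _ := by
        rw [Finset.sum_add_distrib, ← Finset.mul_sum]
        simp [mean]
        ring

lemma var_le (hp1 : ∑ s, p s = 1) (W : S → ℝ) (c : ℝ) :
    var p W ≤ mean p (fun s => (W s - c) ^ 2) := by
  rw [var_eq_of_sum_one hp1 W c]
  exact sub_le_self _ (sq_nonneg _)

lemma var_le_sq_mul (hp : ∀ s, 0 ≤ p s) (hp1 : ∑ s, p s = 1) {V : S → ℝ} {B : ℝ}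
    (h : ∀ s, V s ∈ Set.Icc 0 B) : var p V ≤ B * mean p V := by
  have := var_le hp1 V 0
  simp only [sub_zero] at this
  exact this.trans (mean_sq_le hp h)

/-- Centring `V` at the mean of `W` only increases the second moment; then `(x + y)² ≤ 2x² + 2y²`,
and `|V - W| ≤ H` makes one square linear. -/
lemma var_le_two_mul_add (hp : ∀ s, 0 ≤ p s) (hp1 : ∑ s, p s = 1) {V W : S → ℝ} {H : ℝ}
    (h : ∀ s, |V s - W s| ≤ H) :
    var p V ≤ 2 * var p W + 2 * (H * mean p fun s => |V s - W s|) := by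
  refine (var_le hp1 V (mean p W)).trans ?_
  have e : var p W = mean p fun s => (W s - mean p W) ^ 2 := by
    rw [var_eq_of_sum_one hp1 W (mean p W), sub_self]; simp [mean]
  rw [e, ← mean_const_mul, ← mean_const_mul, ← mean_const_mul, ← mean_add]
  refine mean_mono hp fun s => ?_
  nlinarith [sq_nonneg (V s - W s - (W s - mean p W)), sq_abs (V s - W s),
    mul_le_mul_of_nonneg_right (h s) (abs_nonneg (V s - W s))]

end Weights

end

/-! ### Arithmetic of the one-step recursion and size of the logarithmic factor -/

section

/-- Here `x` is the expected next value gap, `v` the variance of the value of the policy and `σ` the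
number of states. Writing `Hxℓ = (x/H)(H²ℓ)` before the arithmetic-geometric inequality leaves only
multiples of `x/H`, which can be compounded over H steps. The constants come from `20/3 + 1 + 1 ≤
9`, `40/3 + 4 ≤ 18` and `100/3 + 400/9 + 2 + 2 + 3 ≤ 85`. -/
lemma bonus_add_deviation_le {H ℓ x v σ vb vs β d₁ d₂ : ℝ} (hH : 1 ≤ H) (hℓ : 0 ≤ ℓ) (hx : 0 ≤ x)
    (hv : 0 ≤ v) (hσ : 1 ≤ σ) (hβ : β ≤ 20 / 3 * √(vb * ℓ) + 400 / 9 * (H * ℓ))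
    (hvb : vb ≤ 4 * (H * x) + 4 * v + 12 * (σ * (H ^ 2 * ℓ)))
    (hd₁ : d₁ ≤ 2 * √(vs * ℓ) + 2 * H * ℓ) (hvs : vs ≤ 2 * v + 2 * (H * x))
    (hd₂ : d₂ ≤ x / H + 3 * (σ * (H ^ 2 * ℓ))) :
    β + d₁ + d₂ ≤ 9 * (x / H) + 18 * √(v * ℓ) + 85 * (σ * (H ^ 2 * ℓ)) := by
  have hH0 : 0 < H := by linarith
  have hxH : 0 ≤ x / H := by positivity
  have h1 : 2 * √(x / H * (H ^ 2 * ℓ)) ≤ x / H + H ^ 2 * ℓ :=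
    two_mul_sqrt_mul_le hxH (by positivity)
  have h2 : √(vb * ℓ) ≤ 2 * √(x / H * (H ^ 2 * ℓ)) + (2 * √(v * ℓ) + 4 * (σ * (H * ℓ))) := by
    rw [← sqrt_sq_mul two_pos.le, ← sqrt_sq_mul two_pos.le,
      ← Real.sqrt_sq (by positivity : 0 ≤ 4 * (σ * (H * ℓ)))]
    refine le_trans (Real.sqrt_le_sqrt ?_) ((sqrt_add_le_add (2 ^ 2 * (x / H * (H ^ 2 * ℓ)))
      (2 ^ 2 * (v * ℓ) + (4 * (σ * (H * ℓ))) ^ 2) (by positivity) (by positivity)).trans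
      (add_le_add_right (sqrt_add_le_add _ _ (by positivity) (by positivity)) _))
    have e : x / H * (H ^ 2 * ℓ) = H * x * ℓ := by field_simp
    rw [e]
    have h3 := mul_le_mul_of_nonneg_right hvb hℓ
    have h4 : σ * (H * ℓ) ^ 2 ≤ σ ^ 2 * (H * ℓ) ^ 2 := by
      gcongr; nlinarith
    nlinarith [mul_nonneg (by linarith : 0 ≤ σ) (sq_nonneg (H * ℓ))]
  have h3 : 2 * √(vs * ℓ) ≤ (x / H + 2 * (H ^ 2 * ℓ)) + 4 * √(v * ℓ) := by
    have h4 : √(vs * ℓ) ≤ √(x / H * (2 * (H ^ 2 * ℓ))) + 2 * √(v * ℓ) := by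
      rw [← sqrt_sq_mul two_pos.le]
      refine le_trans (Real.sqrt_le_sqrt ?_) (sqrt_add_le_add _ _ (by positivity) (by positivity))
      have e : x / H * (2 * (H ^ 2 * ℓ)) = 2 * (H * x * ℓ) := by field_simp
      rw [e]
      nlinarith [mul_le_mul_of_nonneg_right hvs hℓ, mul_nonneg hv hℓ]
    have h5 := two_mul_sqrt_mul_le hxH (by positivity : 0 ≤ 2 * (H ^ 2 * ℓ))
    linarith
  have h6 : H * ℓ ≤ σ * (H ^ 2 * ℓ) := by
    rw [← mul_assoc]
    exact mul_le_mul_of_nonneg_right (by nlinarith) hℓ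
  have h7 : σ * (H * ℓ) ≤ σ * (H ^ 2 * ℓ) := by
    gcongr; nlinarith
  have h8 : H ^ 2 * ℓ ≤ σ * (H ^ 2 * ℓ) := le_mul_of_one_le_left (by positivity) hσ
  have h9 : 0 ≤ σ * (H ^ 2 * ℓ) := le_trans (by positivity) h8
  linarith [Real.sqrt_nonneg (v * ℓ)]

variable {S A : Type*} [Fintype S] [MeasurableSpace S] [MeasurableSingletonClass S]
  [Fintype A] [MeasurableSpace A] [MeasurableSingletonClass A]

lemma one_le_logFactor [Nonempty S] [Nonempty A] {H : ℕ} (hH : 1 ≤ H) {δ : ℝ}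
    (hδ : δ ∈ Set.Ioo (0 : ℝ) 1) {k : ℕ} (hk : 1 ≤ k) : 1 ≤ logFactor S A H δ k := by
  have hS : (1 : ℝ) ≤ Fintype.card S := by exact_mod_cast Fintype.card_pos
  have hA : (1 : ℝ) ≤ Fintype.card A := by exact_mod_cast Fintype.card_pos
  have hH' : (1 : ℝ) ≤ H := by exact_mod_cast hH
  have hk' : (1 : ℝ) ≤ k := by exact_mod_cast hk
  rw [logFactor, Real.le_log_iff_exp_le (by have := hδ.1; positivity)]
  have h3 : Real.exp 1 ≤ 144 := Real.exp_one_lt_d9.le.trans (by norm_num)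
  refine h3.trans ?_
  rw [le_div_iff₀ hδ.1]
  have h4 : (1 : ℝ) ≤ (Fintype.card S : ℝ) ^ 2 * Fintype.card A * (H : ℝ) ^ 2 * (k : ℝ) ^ 3 * (k + 1) :=
    one_le_mul_of_one_le_of_one_le (one_le_mul_of_one_le_of_one_le (one_le_mul_of_one_le_of_one_le
      (one_le_mul_of_one_le_of_one_le (one_le_pow₀ hS) hA) (one_le_pow₀ hH')) (one_le_pow₀ hk'))
      (by linarith)
  nlinarith [hδ.2]

lemma logFactor_mono [Nonempty S] [Nonempty A] {H : ℕ} (hH : 1 ≤ H) {δ : ℝ}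
    (hδ : δ ∈ Set.Ioo (0 : ℝ) 1) {k K : ℕ} (hk : 1 ≤ k) (hkK : k ≤ K) :
    logFactor S A H δ k ≤ logFactor S A H δ K := by
  have hS : (1 : ℝ) ≤ Fintype.card S := by exact_mod_cast Fintype.card_pos
  have hA : (1 : ℝ) ≤ Fintype.card A := by exact_mod_cast Fintype.card_pos
  have hH' : (1 : ℝ) ≤ H := by exact_mod_cast hH
  have hk' : (1 : ℝ) ≤ k := by exact_mod_cast hk
  have hK' : (k : ℝ) ≤ K := by exact_mod_cast hkK
  have := hδ.1
  unfold logFactor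
  gcongr

/-! ### Empirical weights and bonuses -/

namespace Trace

variable (ξ : Trace S A) (k h : ℕ) (s : S) (a : A)

lemma empP_nonneg (s' : S) : 0 ≤ ξ.empP k h s a s' := by
  unfold empP; positivity

lemma sum_empP (hn : ξ.nSA k h s a ≠ 0) : ∑ s', ξ.empP k h s a s' = 1 := by
  have := ξ.mean_empP k h s a (fun _ => 1)
  simp only [mean, mul_one, Finset.sum_const, nsmul_eq_mul] at this
  rw [this]
  exact div_self (by exact_mod_cast hn)

lemma mean_empP_of_nSA_eq_zero (hn : ξ.nSA k h s a = 0) (V : S → ℝ) :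
    mean (ξ.empP k h s a) V = 0 := by
  rw [mean_empP, hn]; simp

lemma mean_empP_mem {V : S → ℝ} {B : ℝ} (hB : 0 ≤ B) (hV : ∀ s, V s ∈ Set.Icc 0 B) :
    mean (ξ.empP k h s a) V ∈ Set.Icc 0 B := by
  refine ⟨mean_nonneg (ξ.empP_nonneg k h s a) fun s => (hV s).1, ?_⟩
  by_cases hn : ξ.nSA k h s a = 0
  · rwa [mean_empP_of_nSA_eq_zero _ _ _ _ _ hn]
  · calc _ ≤ ∑ s', ξ.empP k h s a s' * B :=
          mean_mono (ξ.empP_nonneg k h s a) (W := fun _ => B) fun s => (hV s).2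
      _ = B := by rw [← Finset.sum_mul, ξ.sum_empP k h s a hn, one_mul]

lemma nSA_eq_zero_of_nS_eq_zero (hn : ξ.nS k h s = 0) : ξ.nSA k h s a = 0 := by
  classical
  rw [nS, visitsS, Finset.card_eq_zero, Finset.filter_eq_empty_iff] at hn
  rw [nSA, visitsSA, Finset.card_eq_zero, Finset.filter_eq_empty_iff]
  exact fun j hj hc => hn hj hc.1

end Trace

section Bonus

variable {H : ℕ} {δ : ℝ} {ξ : Trace S A} {k h : ℕ}

lemma bonusP_mem (hL : 0 ≤ logFactor S A H δ k) (V : S → ℝ) (s : S) (a : A) :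
    bonusP H δ ξ k h V s a ∈ Set.Icc (0 : ℝ) H := by
  unfold bonusP
  exact ⟨le_min (by positivity) (by positivity), min_le_right _ _⟩

/-- With few visits the truncation at `H` is active and optimism is automatic. In the opposite case
`L / n` is small, as the variance comparison requires. -/
lemma bonusP_eq (hL : 1 ≤ 400 / 9 * (logFactor S A H δ k / max (ξ.nSA (k - 1) h s a : ℝ) 1))
    (V : S → ℝ) : bonusP H δ ξ k h V s a = H := by
  refine min_eq_right ?_
  have h1 : (H : ℝ) * 1 ≤ H * (400 / 9 * (logFactor S A H δ k / max (ξ.nSA (k - 1) h s a : ℝ) 1)) := by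
    gcongr
  rw [mul_div_assoc (H : ℝ)]
  have := Real.sqrt_nonneg (var (ξ.empP (k - 1) h s a) V * logFactor S A H δ k
        / max (ξ.nSA (k - 1) h s a : ℝ) 1)
  linarith

lemma bonusP_eq_of_nSA_eq_zero (hL : 1 ≤ logFactor S A H δ k) {s : S} {a : A}
    (hn : ξ.nSA (k - 1) h s a = 0) (V : S → ℝ) : bonusP H δ ξ k h V s a = H := by
  refine bonusP_eq ?_ V
  rw [hn]
  simp
  linarith

lemma bonusR_nonneg (s : S) : 0 ≤ bonusR H δ ξ k h s := by unfold bonusR; positivity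

lemma optimisticValue_le (s : S) :
    optimisticValue H δ ξ k h s ≤ H := by
  unfold optimisticValue
  cases H + 1 - h with
  | zero => simp [optimisticToGo]
  | succ n =>
    rw [optimisticToGo]
    split_ifs
    · exact le_rfl
    · exact min_le_right _ _

lemma optimisticValue_terminal (s : S) : optimisticValue H δ ξ k (H + 1) s = 0 := by
  simp [optimisticValue, optimisticToGo]

lemma optimisticValue_eq (hh : h ∈ Set.Icc 1 H) (s : S) :
    optimisticValue H δ ξ k h s = if ξ.nS (k - 1) h s = 0 then (H : ℝ) else
      min (ξ.empR (k - 1) h s (fun r => ⨆ a, (r a + (bonusP H δ ξ k h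
          (optimisticValue H δ ξ k (h + 1)) s a
          + mean (ξ.empP (k - 1) h s a) (optimisticValue H δ ξ k (h + 1)))))
          + bonusR H δ ξ k h s) H := by
  have e1 : H + 1 - h = (H - h) + 1 := by have := hh.2; omega
  have e2 : H - (H - h) = h := Nat.sub_sub_self hh.2
  have e3 : H + 1 - (h + 1) = H - h := by omega
  simp only [optimisticValue, e1, e3, optimisticToGo, e2, score, add_assoc]

end Bonus

end

/-! ### The good event, optimism and the recursion for the value gap -/

section

variable {S A : Type*} [Fintype S] [MeasurableSpace S] [MeasurableSingletonClass S]
  [Fintype A] [MeasurableSpace A] [MeasurableSingletonClass A]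

/-- A Bernstein bound for the empirical transition mean of `W`, whose values lie in `[0, B]`. -/
def TransitionBound (M : MDP S A) (δ : ℝ) (ξ : Trace S A) (k h : ℕ) (s : S) (a : A)
    (W : S → ℝ) (B : ℝ) : Prop :=
  ξ.nSA (k - 1) h s a ≠ 0 →
    |mean (ξ.empP (k - 1) h s a) W - mean (M.tr h s a) W|
      ≤ 2 * √(var (M.tr h s a) W * logFactor S A M.H δ k / ξ.nSA (k - 1) h s a)
        + 2 * B * logFactor S A M.H δ k / ξ.nSA (k - 1) h s a

/-- The squared distance of the optimal next-step value to its mean. -/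
def optSqDev (M : MDP S A) (h : ℕ) (s : S) (a : A) (s' : S) : ℝ :=
  (M.optValue (h + 1) s' - mean (M.tr h s a) (M.optValue (h + 1))) ^ 2

/-- The data available in episode `k` are close to what they estimate. -/
structure Concentrated (M : MDP S A) (δ : ℝ) (ξ : Trace S A) (k : ℕ) : Prop where
  reward : ∀ h ∈ Set.Icc 1 M.H, ∀ s, ξ.nS (k - 1) h s ≠ 0 → ∀ x : A → ℝ,
    (∀ a, x a ∈ Set.Icc (0 : ℝ) (2 * M.H)) →
    |ξ.empR (k - 1) h s (fun r => ⨆ a, (r a + x a))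
      - ∫ r, ⨆ a, (r a + x a) ∂(M.rewardLaw h s)| ≤ bonusR M.H δ ξ k h s
  opt : ∀ h ∈ Set.Icc 1 M.H, ∀ s a,
    TransitionBound M δ ξ k h s a (M.optValue (h + 1)) M.H
  optSq : ∀ h ∈ Set.Icc 1 M.H, ∀ s a,
    TransitionBound M δ ξ k h s a (optSqDev M h s a) ((M.H : ℝ) ^ 2)
  next : ∀ h ∈ Set.Icc 1 M.H, ∀ s a s',
    TransitionBound M δ ξ k h s a (Set.indicator {s'} 1) 1

variable [Nonempty S] [Nonempty A] {M : MDP S A} {δ : ℝ} {ξ : Trace S A} {k h : ℕ}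

section Optimism

variable (hc : Concentrated M δ ξ k) (hδ : δ ∈ Set.Ioo (0 : ℝ) 1) (hk : 1 ≤ k)
  (hh : h ∈ Set.Icc 1 M.H)

lemma max_natCast_one {n : ℕ} (hn : n ≠ 0) : max (n : ℝ) 1 = n :=
  max_eq_left (by exact_mod_cast Nat.one_le_iff_ne_zero.2 hn)

lemma optSqDev_mem (hh : 1 ≤ h) (s : S) (a : A) (s' : S) :
    optSqDev M h s a s' ∈ Set.Icc 0 ((M.H : ℝ) ^ 2) := by
  have h1 := M.optValue_mem (show 1 ≤ h + 1 by omega) s'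
  have h2 := M.mean_tr_mem h s a fun s' => M.optValue_mem (show 1 ≤ h + 1 by omega) s'
  refine ⟨sq_nonneg _, sq_le_sq' ?_ ?_⟩ <;> linarith [h1.1, h1.2, h2.1, h2.2]

include hc hδ hk hh

/-- Bernstein's inequality is applied to the fixed function V*, never to `V`, which will depend on
the data. Any `V` between V* and `H` is allowed: its excess over V* pays for the change of variance.
-/
lemma mean_optValue_le (s : S) (a : A) {V : S → ℝ} (hV : ∀ s, M.optValue (h + 1) s ≤ V s)
    (hVH : ∀ s, V s ≤ M.H) :
    mean (M.tr h s a) (M.optValue (h + 1))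
      ≤ bonusP M.H δ ξ k h V s a + mean (ξ.empP (k - 1) h s a) V := by
  have hO := fun s' => M.optValue_mem (show 1 ≤ h + 1 by omega) s'
  have hH1 : (1 : ℝ) ≤ M.H := by exact_mod_cast M.one_le_H
  have hL := one_le_logFactor (S := S) (A := A) M.one_le_H hδ hk
  have hV0 : ∀ s, V s ∈ Set.Icc (0 : ℝ) M.H := fun s => ⟨(hO s).1.trans (hV s), hVH s⟩
  have hmV := ξ.mean_empP_mem (k - 1) h s a (by linarith) hV0
  have hmO := M.mean_tr_mem h s a hO
  set L := logFactor S A M.H δ k with hLdef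
  by_cases hbig : 1 ≤ 400 / 9 * (L / max (ξ.nSA (k - 1) h s a : ℝ) 1)
  · rw [bonusP_eq hbig]
    linarith [hmO.2, hmV.1]
  have hn : ξ.nSA (k - 1) h s a ≠ 0 := by
    intro hn
    rw [hn] at hbig
    apply hbig
    simp
    linarith
  have hmax := max_natCast_one hn
  push Not at hbig
  have hb1 := hc.opt h hh s a hn
  have hb2 := hc.optSq h hh s a hn
  rw [← hLdef] at hb1 hb2
  simp only [mul_div_assoc] at hb1 hb2
  rw [hmax] at hbig
  have hp := ξ.empP_nonneg (k - 1) h s a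
  have hp1 := ξ.sum_empP (k - 1) h s a hn
  unfold bonusP
  rw [hmax, ← hLdef]
  simp only [mul_div_assoc]
  set p := ξ.empP (k - 1) h s a with hpdef
  set q := M.tr h s a with hqdef
  set ℓ := L / (ξ.nSA (k - 1) h s a : ℝ) with hℓ
  have hℓ0 : 0 ≤ ℓ := by positivity
  have hsq : mean q (optSqDev M h s a) = var q (M.optValue (h + 1)) := by
    rw [var_eq_of_sum_one (M.sum_tr h s a) _ (mean q (M.optValue (h + 1))), sub_self]
    simp [mean, optSqDev, hqdef]
  -- The deviations are centred at the true mean, so the empirical second moment exceeds the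
  -- empirical variance by the squared error of the mean.
  have hsqe : mean p (optSqDev M h s a) = var p (M.optValue (h + 1))
      + (mean q (M.optValue (h + 1)) - mean p (M.optValue (h + 1))) ^ 2 := by
    rw [var_eq_of_sum_one hp1 _ (mean q (M.optValue (h + 1)))]
    simp only [mean, optSqDev, hqdef]
    ring
  have hv0 : 0 ≤ var q (M.optValue (h + 1)) := var_nonneg (M.tr_nonneg h s a) (M.sum_tr h s a) _
  have hm0 : 0 ≤ mean p (fun s => V s - M.optValue (h + 1) s) :=
    mean_nonneg hp fun s => sub_nonneg.2 (hV s)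
  have hz := var_le_sq_mul (M.tr_nonneg h s a) (M.sum_tr h s a)
    (optSqDev_mem (M := M) hh.1 s a)
  rw [← hqdef, hsq] at hz
  have heb : var p (M.optValue (h + 1)) ≤ 2 * var p V
      + 2 * (M.H * mean p (fun s => V s - M.optValue (h + 1) s)) := by
    have habs : ∀ s, |M.optValue (h + 1) s - V s| = V s - M.optValue (h + 1) s := fun s => by
      rw [abs_sub_comm, abs_of_nonneg (sub_nonneg.2 (hV s))]
    have := var_le_two_mul_add hp hp1 (V := M.optValue (h + 1)) (W := V) (H := M.H) fun s => by
      rw [habs]; linarith [(hO s).1, hVH s]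
    simpa only [habs] using this
  have key := deviation_le_of_empirical_variance hH1 hℓ0 hbig.le hv0 (var_nonneg hp hp1 V) hm0
    (d := mean q (M.optValue (h + 1)) - mean p (M.optValue (h + 1)))
    (by rw [abs_sub_comm]; linarith [hb1]) hz
    (by rw [← hsq]; linarith [(abs_le.1 hb2).1]) hsqe heb
  rw [mean_sub] at key
  rcases min_cases (20 / 3 * √(var p V * ℓ) + 400 / 9 * (M.H * ℓ)) (M.H : ℝ) with ⟨h1, _⟩ | ⟨h1, _⟩
  · rw [h1]; linarith
  · rw [h1]; linarith [hmO.2, hmV.1]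

/-- One step of the optimism induction. -/
lemma optValue_le_optimisticValue_step
    (ih : ∀ s, M.optValue (h + 1) s ≤ optimisticValue M.H δ ξ k (h + 1) s) (s : S) :
    M.optValue h s ≤ optimisticValue M.H δ ξ k h s := by
  have hO := fun s' => M.optValue_mem (show 1 ≤ h + 1 by omega) s'
  have hH1 : (1 : ℝ) ≤ M.H := by exact_mod_cast M.one_le_H
  rw [optimisticValue_eq hh]
  split_ifs with hn
  · exact (M.optValue_mem hh.1 s).2
  refine le_min ?_ (M.optValue_mem hh.1 s).2
  have hL := one_le_logFactor (S := S) (A := A) M.one_le_H hδ hk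
  set x : A → ℝ := fun a => bonusP M.H δ ξ k h (optimisticValue M.H δ ξ k (h + 1)) s a
    + mean (ξ.empP (k - 1) h s a) (optimisticValue M.H δ ξ k (h + 1)) with hx
  have hx2 : ∀ a, x a ∈ Set.Icc (0 : ℝ) (2 * M.H) := fun a => by
    have h1 := bonusP_mem (ξ := ξ) (h := h) (H := M.H) (by linarith)
      (optimisticValue M.H δ ξ k (h + 1)) s a
    have h2 := ξ.mean_empP_mem (k - 1) h s a (B := M.H) (by linarith)
      (V := optimisticValue M.H δ ξ k (h + 1))
      fun s => ⟨(hO s).1.trans (ih s), optimisticValue_le s⟩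
    constructor <;> simp only [hx] <;> linarith [h1.1, h1.2, h2.1, h2.2]
  have h3 := hc.reward h hh s hn x hx2
  have h4 := M.optValue_le hh.2 hh.1 s
  have h5 : ∫ r, ⨆ a, (r a + mean (M.tr h s a) (M.optValue (h + 1))) ∂(M.rewardLaw h s)
      ≤ ∫ r, ⨆ a, (r a + x a) ∂(M.rewardLaw h s) := by
    refine integral_mono (M.integrable_iSup h s _) (M.integrable_iSup h s _) fun r => ?_
    have := iSup_add_le_add (fun a => mean (M.tr h s a) (M.optValue (h + 1))) x r 0 fun a => by
      rw [add_zero]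
      exact mean_optValue_le hc hδ hk hh s a ih fun s => optimisticValue_le s
    simpa using this
  linarith [(abs_le.1 h3).1]

omit hh in
/-- The values computed by the algorithm are optimistic. -/
lemma optValue_le_optimisticValue (hh : h ∈ Set.Icc 1 (M.H + 1)) (s : S) :
    M.optValue h s ≤ optimisticValue M.H δ ξ k h s := by
  obtain ⟨n, rfl⟩ : ∃ n, h = M.H + 1 - n := ⟨M.H + 1 - h, (Nat.sub_sub_self hh.2).symm⟩
  induction n generalizing s with
  | zero =>
    rw [Nat.sub_zero, MDP.optValue_terminal, optimisticValue_terminal]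
  | succ n ih =>
    have e : M.H + 1 - n = (M.H + 1 - (n + 1)) + 1 := by have := hh.1; omega
    refine optValue_le_optimisticValue_step hc hδ hk ⟨hh.1, by omega⟩ (fun s' => ?_) s
    rw [← e]
    exact ih s' ⟨by omega, by omega⟩

end Optimism

lemma MDP.integrable_played (M : MDP S A) (π : DetPolicy S A) (h : ℕ) (s : S) (f : A → ℝ) :
    Integrable (fun r => f (π.act h s r)) (M.rewardLaw h s) := by
  have hf : Measurable (fun r => f (π.act h s r)) :=
    (measurable_of_finite f).comp (π.measurable_act h s)
  obtain ⟨C, hC⟩ := (Set.finite_range fun a => |f a|).bddAbove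
  exact Integrable.of_bound hf.aestronglyMeasurable C
    (Filter.Eventually.of_forall fun r => hC ⟨π.act h s r, rfl⟩)

lemma MDP.integrable_reward_played (M : MDP S A) (π : DetPolicy S A) (h : ℕ) (s : S) :
    Integrable (fun r : A → ℝ => r (π.act h s r)) (M.rewardLaw h s) :=
  Integrable.of_mem_Icc 0 1 (MDP.measurable_eval.comp
    (measurable_id.prodMk (π.measurable_act h s))).aemeasurable
    ((M.reward_mem h s).mono fun _ hr => hr _)

/-- The excess of the optimistic score of an action over its value under `π`, rewards aside. -/
def scoreGap (M : MDP S A) (δ : ℝ) (ξ : Trace S A) (π : DetPolicy S A) (k h : ℕ) (s : S) (a : A) :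
    ℝ :=
  bonusP M.H δ ξ k h (optimisticValue M.H δ ξ k (h + 1)) s a
    + mean (ξ.empP (k - 1) h s a) (optimisticValue M.H δ ξ k (h + 1))
    - mean (M.tr h s a) (M.value π.toPolicy (h + 1))

/-- The excess of the optimistic value over the value of `π`. -/
def valueGap (M : MDP S A) (δ : ℝ) (ξ : Trace S A) (π : DetPolicy S A) (k h : ℕ) (s : S) : ℝ :=
  optimisticValue M.H δ ξ k h s - M.value π.toPolicy h s

section Gap

variable (hc : Concentrated M δ ξ k) (hδ : δ ∈ Set.Ioo (0 : ℝ) 1) (hk : 1 ≤ k)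
  (hh : h ∈ Set.Icc 1 M.H) (π : DetPolicy S A)

lemma mean_indicator_singleton (p : S → ℝ) (s' : S) :
    mean p (Set.indicator {s'} 1) = p s' := by
  classical
  simp [mean, Set.indicator_apply]

lemma var_indicator_singleton_le (p : S → ℝ) (s' : S) :
    var p (Set.indicator {s'} 1) ≤ p s' := by
  classical
  have : ∀ s, p s * (Set.indicator {s'} (1 : S → ℝ) s) ^ 2 = p s * Set.indicator {s'} 1 s := by
    intro s
    by_cases hs : s = s' <;> simp [hs]
  unfold var
  simp only [this]
  have h1 := mean_indicator_singleton p s'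
  unfold mean at h1
  rw [h1]
  exact sub_le_self _ (sq_nonneg _)

include hc hδ hk hh

omit [Nonempty A] hδ hk in
lemma abs_empP_sub_le (s : S) (a : A) (s' : S) (hn : ξ.nSA (k - 1) h s a ≠ 0)
    (hL : 0 ≤ logFactor S A M.H δ k) :
    |ξ.empP (k - 1) h s a s' - M.tr h s a s'|
      ≤ 2 * √(M.tr h s a s' * (logFactor S A M.H δ k / ξ.nSA (k - 1) h s a))
        + 2 * (logFactor S A M.H δ k / ξ.nSA (k - 1) h s a) := by
  have h1 := hc.next h hh s a s' hn
  rw [mean_indicator_singleton, mean_indicator_singleton] at h1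
  simp only [mul_div_assoc, mul_one] at h1
  refine h1.trans ?_
  gcongr
  exact var_indicator_singleton_le _ _

/-- With p̂ and p the empirical and true weights, U the optimistic value and V the value of the
policy, the gap is the bonus plus (p̂ - p)V* + (p̂ - p)(U - V*) + p(U - V). Bernstein applies to the
fixed V*. Since U depends on the data, the other deviation is bounded state by state. -/
lemma scoreGap_le (s : S) (a : A) :
    scoreGap M δ ξ π k h s a ≤ (1 + 9 / M.H) * mean (M.tr h s a) (valueGap M δ ξ π k (h + 1))
      + 18 * √(var (M.tr h s a) (M.value π.toPolicy (h + 1))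
          * (logFactor S A M.H δ k / max (ξ.nSA (k - 1) h s a : ℝ) 1))
      + 85 * (Fintype.card S * ((M.H : ℝ) ^ 2
          * (logFactor S A M.H δ k / max (ξ.nSA (k - 1) h s a : ℝ) 1))) := by
  have hO := fun s' => M.optValue_mem (show 1 ≤ h + 1 by omega) s'
  have hV := fun s' => M.value_mem π.toPolicy (h + 1) (by omega) s'
  have hVO := fun s' => M.value_le_optValue π.toPolicy (show 1 ≤ h + 1 by omega) s'
  have hOB := optValue_le_optimisticValue (h := h + 1) hc hδ hk ⟨by omega, by have := hh.2; omega⟩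
  have hBH := fun s' => optimisticValue_le (H := M.H) (δ := δ) (ξ := ξ) (k := k) (h := h + 1) s'
  have hH1 : (1 : ℝ) ≤ M.H := by exact_mod_cast M.one_le_H
  have hσ : (1 : ℝ) ≤ Fintype.card S := by exact_mod_cast Fintype.card_pos
  have hL := one_le_logFactor (S := S) (A := A) M.one_le_H hδ hk
  have hq := M.tr_nonneg h s a
  have hq1 := M.sum_tr h s a
  have hΔ : ∀ s', valueGap M δ ξ π k (h + 1) s' ∈ Set.Icc (0 : ℝ) M.H := fun s' => by
    unfold valueGap
    constructor <;> linarith [hVO s', hOB s', hBH s', (hV s').1]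
  have hx0 : 0 ≤ mean (M.tr h s a) (valueGap M δ ξ π k (h + 1)) :=
    mean_nonneg hq fun s' => (hΔ s').1
  -- Without data the gap is at most `H`, and the last term alone covers it because the logarithmic
  -- factor is at least 1.
  by_cases hn : ξ.nSA (k - 1) h s a = 0
  · have h1 : scoreGap M δ ξ π k h s a ≤ M.H := by
      unfold scoreGap
      rw [bonusP_eq_of_nSA_eq_zero hL hn, Trace.mean_empP_of_nSA_eq_zero _ _ _ _ _ hn]
      linarith [(M.mean_tr_mem h s a hV).1]
    have h2 : (M.H : ℝ) ≤ 85 * (Fintype.card S * ((M.H : ℝ) ^ 2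
          * (logFactor S A M.H δ k / max (ξ.nSA (k - 1) h s a : ℝ) 1))) := by
      rw [hn]
      simp only [Nat.cast_zero, zero_le_one, sup_of_le_right, div_one]
      have h3 : (M.H : ℝ) ≤ (M.H : ℝ) ^ 2 := by nlinarith
      have h4 : (M.H : ℝ) ^ 2 ≤ (M.H : ℝ) ^ 2 * logFactor S A M.H δ k :=
        le_mul_of_one_le_right (by positivity) hL
      have h5 := le_mul_of_one_le_left (h4.trans' (by positivity)) hσ
      linarith
    have h3 : 0 ≤ (1 + 9 / (M.H : ℝ)) * mean (M.tr h s a) (valueGap M δ ξ π k (h + 1)) := by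
      positivity
    have h4 := Real.sqrt_nonneg (var (M.tr h s a) (M.value π.toPolicy (h + 1))
          * (logFactor S A M.H δ k / max (ξ.nSA (k - 1) h s a : ℝ) 1))
    linarith
  have hmax := max_natCast_one hn
  have hb1 := hc.opt h hh s a hn
  have hb2 := fun s' => abs_empP_sub_le hc hh s a s' hn (by linarith)
  have hp := ξ.empP_nonneg (k - 1) h s a
  have hp1 := ξ.sum_empP (k - 1) h s a hn
  simp only [mul_div_assoc] at hb1
  set U := optimisticValue M.H δ ξ k (h + 1) with hU
  set V := M.value π.toPolicy (h + 1) with hVdef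
  set O := M.optValue (h + 1) with hOdef
  set Δ := valueGap M δ ξ π k (h + 1) with hΔdef
  set p := ξ.empP (k - 1) h s a with hpdef
  set q := M.tr h s a with hqdef
  rw [hmax]
  set ℓ := logFactor S A M.H δ k / (ξ.nSA (k - 1) h s a : ℝ) with hℓ
  have hℓ0 : 0 ≤ ℓ := by positivity
  have hΔe : ∀ s', Δ s' = U s' - V s' := fun s' => rfl
  have hbonus : bonusP M.H δ ξ k h U s a ≤ 20 / 3 * √(var p U * ℓ) + 400 / 9 * (M.H * ℓ) := by
    refine (min_le_left _ _).trans (le_of_eq ?_)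
    rw [hmax]
    simp only [mul_div_assoc]
    rfl
  have hdom : ∀ s', p s' ≤ 2 * q s' + 3 * ℓ := fun s' => by
    have h1 := two_mul_sqrt_mul_le (hq s') hℓ0
    linarith [(abs_le.1 (hb2 s')).2]
  have hvb : var p U ≤ 4 * (M.H * mean q Δ) + 4 * var q V
      + 12 * (Fintype.card S * ((M.H : ℝ) ^ 2 * ℓ)) := by
    have hmV := M.mean_tr_mem h s a hV
    rw [← hqdef] at hmV
    have h1 : var p U ≤ mean p (fun s' => 2 * Δ s' ^ 2 + 2 * (V s' - mean q V) ^ 2) :=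
      (var_le hp1 U (mean q V)).trans (mean_mono hp fun s' => by
        have : U s' = Δ s' + V s' := by rw [hΔe]; ring
        rw [this]
        nlinarith [sq_nonneg (Δ s' - (V s' - mean q V))])
    rw [mean_add, mean_const_mul, mean_const_mul] at h1
    have h2 := mean_le_of_le_add hdom hℓ0 (V := fun s' => Δ s' ^ 2) (B := (M.H : ℝ) ^ 2) fun s' =>
      ⟨sq_nonneg _, pow_le_pow_left₀ (hΔ s').1 (hΔ s').2 2⟩
    have h3 := mean_sq_le hq hΔ
    have h4 := mean_le_of_le_add hdom hℓ0 (V := fun s' => (V s' - mean q V) ^ 2)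
      (B := (M.H : ℝ) ^ 2) fun s' => ⟨sq_nonneg _, by
        refine sq_le_sq' ?_ ?_ <;> linarith [(hV s').1, (hV s').2, hmV.1, hmV.2]⟩
    have h5 : mean q (fun s' => (V s' - mean q V) ^ 2) = var q V := by
      rw [var_eq_of_sum_one hq1 V (mean q V), sub_self]; simp [mean]
    rw [h5] at h4
    linarith
  have hvs : var q O ≤ 2 * var q V + 2 * (M.H * mean q Δ) := by
    have habs : ∀ s', |O s' - V s'| = O s' - V s' := fun s' =>
      abs_of_nonneg (sub_nonneg.2 (hVO s'))
    have h1 := var_le_two_mul_add hq hq1 (V := O) (W := V) (H := M.H) fun s' => by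
      rw [habs]; linarith [(hV s').1, (hO s').2]
    have h2 : mean q (fun s' => |O s' - V s'|) ≤ mean q Δ := mean_mono hq fun s' => by
      rw [habs, hΔe]; linarith [hOB s']
    have h3 : (M.H : ℝ) * mean q (fun s' => |O s' - V s'|) ≤ M.H * mean q Δ := by gcongr
    linarith
  -- Splitting `q ℓ = (q/H)(Hℓ)` in each state costs only a fraction `1/H` of the value gap.
  have hd₂ : mean p (fun s' => U s' - O s') - mean q (fun s' => U s' - O s')
      ≤ mean q Δ / M.H + 3 * (Fintype.card S * ((M.H : ℝ) ^ 2 * ℓ)) := by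
    have h0 : (0 : ℝ) < M.H := by linarith
    calc _ = ∑ s', (p s' - q s') * (U s' - O s') := by
          simp only [mean, ← Finset.sum_sub_distrib, sub_mul]
      _ ≤ ∑ s', (q s' * Δ s' / M.H + 3 * ((M.H : ℝ) ^ 2 * ℓ)) := by
          refine Finset.sum_le_sum fun s' _ => ?_
          have h1 := two_mul_sqrt_mul_le (div_nonneg (hq s') h0.le)
            (mul_nonneg h0.le hℓ0)
          rw [show q s' / M.H * (M.H * ℓ) = q s' * ℓ by field_simp] at h1
          have h2 : p s' - q s' ≤ q s' / M.H + M.H * ℓ + 2 * ℓ := by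
            linarith [(abs_le.1 (hb2 s')).2]
          have h3 : 0 ≤ U s' - O s' := sub_nonneg.2 (hOB s')
          have h4 : U s' - O s' ≤ M.H := by linarith [hBH s', (hO s').1]
          have h5 : U s' - O s' ≤ Δ s' := by rw [hΔe]; linarith [hVO s']
          have h6 : q s' / M.H * (U s' - O s') ≤ q s' / M.H * Δ s' :=
            mul_le_mul_of_nonneg_left h5 (div_nonneg (hq s') h0.le)
          have h7 : (M.H * ℓ + 2 * ℓ) * (U s' - O s') ≤ (M.H * ℓ + 2 * (M.H * ℓ)) * M.H := by
            have : ℓ ≤ M.H * ℓ := le_mul_of_one_le_left hℓ0 hH1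
            gcongr
          have h8 := mul_le_mul_of_nonneg_right h2 h3
          have h9 : q s' * Δ s' / M.H = q s' / M.H * Δ s' := by ring
          rw [h9]
          nlinarith
      _ = _ := by
          rw [Finset.sum_add_distrib, ← Finset.sum_div]
          simp [mean]
          ring
  have key := bonus_add_deviation_le hH1 hℓ0 hx0 (var_nonneg hq hq1 V) hσ hbonus hvb
    (d₁ := mean p O - mean q O) (by linarith [(abs_le.1 hb1).2]) hvs hd₂
  have e : mean q Δ = mean q U - mean q V := mean_sub q U V
  rw [mean_sub, mean_sub] at key
  have e2 : scoreGap M δ ξ π k h s a = bonusP M.H δ ξ k h U s a + mean p U - mean q V := rfl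
  rw [e2]
  have e3 : (1 + 9 / (M.H : ℝ)) * mean q Δ = mean q Δ + 9 * (mean q Δ / M.H) := by ring
  rw [e3]
  linarith

omit hh in
-- The policy attains the maximal score for every reward vector, so the mean of the maximum under
-- the true reward law is the mean score of its actions. Passing from the empirical law to the true
-- one costs one reward bonus, and the value contains another.
lemma valueGap_le (hh : h ∈ Set.Icc 1 M.H) (hπ : IsMVPRLPolicy M.H δ ξ k π) (s : S) :
    valueGap M δ ξ π k h s ≤ 2 * bonusR M.H δ ξ k h s
      + ∫ r, scoreGap M δ ξ π k h s (π.act h s r) ∂(M.rewardLaw h s) := by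
  have hO := fun s' => M.optValue_mem (show 1 ≤ h + 1 by omega) s'
  have hOB := optValue_le_optimisticValue (h := h + 1) hc hδ hk ⟨by omega, by have := hh.2; omega⟩
  have hV := fun s' => M.value_mem π.toPolicy (h + 1) (by omega) s'
  have hH1 : (1 : ℝ) ≤ M.H := by exact_mod_cast M.one_le_H
  have hL := one_le_logFactor (S := S) (A := A) M.one_le_H hδ hk
  have hfin := M.integrable_played π h s
  have hr := M.integrable_reward_played π h s
  have hfV := hfin fun a => mean (M.tr h s a) (M.value π.toPolicy (h + 1))
  unfold valueGap
  rw [M.value_detPolicy_bellman π hh.2, integral_add hr hfV]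
  have hR0 : 0 ≤ ∫ r, r (π.act h s r) ∂(M.rewardLaw h s) :=
    integral_nonneg_of_ae ((M.reward_mem h s).mono fun r hr => (hr _).1)
  rw [optimisticValue_eq hh]
  -- In an unvisited state the value is `H` by convention, and the bonus of every action is `H` as
  -- well.
  by_cases hn : ξ.nS (k - 1) h s = 0
  · rw [if_pos hn]
    have e : ∀ a, scoreGap M δ ξ π k h s a
        = M.H - mean (M.tr h s a) (M.value π.toPolicy (h + 1)) := fun a => by
      have hna := ξ.nSA_eq_zero_of_nS_eq_zero (k - 1) h s a hn
      unfold scoreGap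
      rw [bonusP_eq_of_nSA_eq_zero hL hna, Trace.mean_empP_of_nSA_eq_zero _ _ _ _ _ hna, add_zero]
    simp only [e]
    rw [integral_sub (integrable_const _) hfV]
    simp only [integral_const, probReal_univ, smul_eq_mul, one_mul]
    linarith [bonusR_nonneg (H := M.H) (δ := δ) (ξ := ξ) (k := k) (h := h) s]
  · rw [if_neg hn]
    set x : A → ℝ := fun a => bonusP M.H δ ξ k h (optimisticValue M.H δ ξ k (h + 1)) s a
      + mean (ξ.empP (k - 1) h s a) (optimisticValue M.H δ ξ k (h + 1)) with hx
    have hx2 : ∀ a, x a ∈ Set.Icc (0 : ℝ) (2 * M.H) := fun a => by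
      have h1 := bonusP_mem (ξ := ξ) (h := h) (H := M.H) (by linarith)
        (optimisticValue M.H δ ξ k (h + 1)) s a
      have h2 := ξ.mean_empP_mem (k - 1) h s a (B := M.H) (by linarith)
        (V := optimisticValue M.H δ ξ k (h + 1))
        fun s => ⟨(hO s).1.trans (hOB s), optimisticValue_le s⟩
      constructor <;> simp only [hx] <;> linarith [h1.1, h1.2, h2.1, h2.2]
    have h3 := hc.reward h hh s hn x hx2
    have h4 : ∫ r, ⨆ a, (r a + x a) ∂(M.rewardLaw h s)
        ≤ ∫ r, (r (π.act h s r) + x (π.act h s r)) ∂(M.rewardLaw h s) := by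
      refine integral_mono (M.integrable_iSup h s _) (hr.add (hfin x)) fun r => ciSup_le fun a => ?_
      have := hπ h hh s r a
      simp only [score, add_assoc] at this
      exact this
    rw [integral_add hr (hfin x)] at h4
    have h5 : ∫ r, scoreGap M δ ξ π k h s (π.act h s r) ∂(M.rewardLaw h s)
        = ∫ r, x (π.act h s r) ∂(M.rewardLaw h s)
          - ∫ r, mean (M.tr h s (π.act h s r)) (M.value π.toPolicy (h + 1)) ∂(M.rewardLaw h s) := by
      rw [← integral_sub (hfin x) hfV]
      rfl
    rw [h5]
    have h6 := min_le_left (ξ.empR (k - 1) h s (fun r => ⨆ a, (r a + x a))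
      + bonusR M.H δ ξ k h s) (M.H : ℝ)
    linarith [(abs_le.1 h3).2]

end Gap

end

section

/-! ### Visit counts -/

lemma sum_inv_max_le_log {n : ℕ} (hn : 1 ≤ n) :
    ∑ i ∈ Finset.range n, 1 / max (i : ℝ) 1 ≤ 2 + 2 * Real.log n := by
  induction n, hn using Nat.le_induction with
  | base => simp
  | succ n hn ih =>
    have hn' : (1 : ℝ) ≤ n := by exact_mod_cast hn
    rw [Finset.sum_range_succ, max_eq_left hn']
    have h1 := Real.one_sub_inv_le_log_of_pos (show 0 < ((n : ℝ) + 1) / n by positivity)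
    rw [Real.log_div (by positivity) (by positivity), inv_div] at h1
    have h2 : 1 / (n : ℝ) ≤ 2 * (1 - n / (n + 1)) := by
      rw [show 1 - (n : ℝ) / (n + 1) = 1 / (n + 1) by field_simp; ring, ← mul_div_assoc,
        div_le_div_iff₀ (by positivity) (by positivity)]
      linarith
    push_cast
    linarith

/-- Each visit contributes the inverse of the number of earlier visits. -/
lemma sum_inv_count_eq {F : Type*} [Fintype F] [DecidableEq F] (y : ℕ → F) (K : ℕ) :
    ∑ k ∈ Finset.Icc 1 K, 1 / max ((((Finset.Icc 1 (k - 1)).filter (fun j => y j = y k)).card : ℝ)) 1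
      = ∑ z, ∑ i ∈ Finset.range ((Finset.Icc 1 K).filter (fun j => y j = z)).card,
          1 / max (i : ℝ) 1 := by
  induction K with
  | zero => simp
  | succ K ih =>
    rw [Finset.sum_Icc_succ_top (Nat.le_add_left 1 K), ih, Nat.add_sub_cancel]
    have h1 : ∀ z, ((Finset.Icc 1 (K + 1)).filter (fun j => y j = z)).card
        = ((Finset.Icc 1 K).filter (fun j => y j = z)).card + if y (K + 1) = z then 1 else 0 := by
      intro z
      simp only [Finset.card_filter]
      exact Finset.sum_Icc_succ_top (Nat.le_add_left 1 K) _
    have h2 : ∀ z, ∑ i ∈ Finset.range ((Finset.Icc 1 (K + 1)).filter (fun j => y j = z)).card,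
          1 / max (i : ℝ) 1
        = ∑ i ∈ Finset.range ((Finset.Icc 1 K).filter (fun j => y j = z)).card, 1 / max (i : ℝ) 1
          + if y (K + 1) = z then
            1 / max ((((Finset.Icc 1 K).filter (fun j => y j = z)).card : ℝ)) 1 else 0 := by
      intro z
      rw [h1]
      split_ifs
      · rw [Finset.sum_range_succ]
      · simp
    simp only [h2, Finset.sum_add_distrib]
    simp

lemma sum_inv_count_le {F : Type*} [Fintype F] [DecidableEq F] (y : ℕ → F) {K : ℕ} (hK : 1 ≤ K) :
    ∑ k ∈ Finset.Icc 1 K, 1 / max ((((Finset.Icc 1 (k - 1)).filter (fun j => y j = y k)).card : ℝ)) 1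
      ≤ Fintype.card F * (2 + 2 * Real.log K) := by
  rw [sum_inv_count_eq]
  calc _ ≤ ∑ _z : F, (2 + 2 * Real.log K) := by
        refine Finset.sum_le_sum fun z _ => ?_
        refine le_trans ?_ (sum_inv_max_le_log hK)
        refine Finset.sum_le_sum_of_subset_of_nonneg ?_ fun i _ _ => by positivity
        refine Finset.range_subset_range.2 ((Finset.card_filter_le _ _).trans ?_)
        simp
    _ = _ := by simp only [Finset.sum_const, Finset.card_univ, nsmul_eq_mul]

variable {S A : Type*} [Fintype S] [MeasurableSpace S] [MeasurableSingletonClass S]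
  [Fintype A] [MeasurableSpace A] [MeasurableSingletonClass A] [Nonempty S] [Nonempty A]
  {M : MDP S A} {δ : ℝ} {ξ : Trace S A} {k h K : ℕ}

lemma two_add_log_le_logFactor {H : ℕ} (hH : 1 ≤ H) (hδ : δ ∈ Set.Ioo (0 : ℝ) 1) (hK : 1 ≤ K) :
    2 + 2 * Real.log K ≤ logFactor S A H δ K := by
  have hS : (1 : ℝ) ≤ Fintype.card S := by exact_mod_cast Fintype.card_pos
  have hA : (1 : ℝ) ≤ Fintype.card A := by exact_mod_cast Fintype.card_pos
  have hH' : (1 : ℝ) ≤ H := by exact_mod_cast hH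
  have hk' : (1 : ℝ) ≤ K := by exact_mod_cast hK
  have hδ0 := hδ.1
  rw [logFactor, Real.le_log_iff_exp_le (by positivity), Real.exp_add, two_mul (Real.log K),
    Real.exp_add, Real.exp_log (by linarith)]
  have h2 : Real.exp 2 ≤ 144 := by
    rw [show (2 : ℝ) = 1 + 1 by norm_num, Real.exp_add]
    nlinarith [Real.exp_one_lt_d9, Real.exp_pos 1]
  rw [le_div_iff₀ hδ0]
  have h3 : (1 : ℝ) ≤ (Fintype.card S : ℝ) ^ 2 * Fintype.card A * (H : ℝ) ^ 2 :=
    one_le_mul_of_one_le_of_one_le (one_le_mul_of_one_le_of_one_le (one_le_pow₀ hS) hA)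
      (one_le_pow₀ hH')
  calc Real.exp 2 * (K * K) * δ ≤ 144 * (K * K) * 1 := by
        gcongr; exact hδ.2.le
    _ ≤ 144 * (1 * (K : ℝ) ^ 3 * (K + 1)) := by
        have h4 : (1 : ℝ) ≤ K * (K + 1) := by nlinarith
        nlinarith [mul_pos (by linarith : (0 : ℝ) < K) (by linarith : (0 : ℝ) < K)]
    _ ≤ 144 * ((Fintype.card S : ℝ) ^ 2 * Fintype.card A * (H : ℝ) ^ 2 * (K : ℝ) ^ 3 * (K + 1)) := by
        gcongr
    _ = _ := by ring

lemma sum_inv_nSA_le (ξ : Trace S A) (h : ℕ) (hK : 1 ≤ K) :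
    ∑ k ∈ Finset.Icc 1 K, 1 / max (ξ.nSA (k - 1) h (ξ.state k h) (ξ.act k h) : ℝ) 1
      ≤ Fintype.card S * Fintype.card A * (2 + 2 * Real.log K) := by
  classical
  have := sum_inv_count_le (fun k => (ξ.state k h, ξ.act k h)) hK
  simp only [Prod.mk.injEq, Fintype.card_prod, Nat.cast_mul] at this
  refine le_of_eq_of_le (Finset.sum_congr rfl fun k _ => ?_) this
  simp only [Trace.nSA, Trace.visitsSA]

lemma sum_inv_nS_le (ξ : Trace S A) (h : ℕ) (hK : 1 ≤ K) :
    ∑ k ∈ Finset.Icc 1 K, 1 / max (ξ.nS (k - 1) h (ξ.state k h) : ℝ) 1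
      ≤ Fintype.card S * (2 + 2 * Real.log K) := by
  classical
  have := sum_inv_count_le (fun k => ξ.state k h) hK
  refine le_of_eq_of_le (Finset.sum_congr rfl fun k _ => ?_) this
  simp only [Trace.nS, Trace.visitsS]

/-! ### Telescoping along an episode -/

lemma actionNoise_const_mul (π : DetPolicy S A) (u : S → A → ℝ) (c : ℝ) :
    actionNoise M ξ π k h (fun s a => c * u s a) = c * actionNoise M ξ π k h u := by
  simp only [actionNoise, integral_const_mul, mul_sub]

lemma stateNoise_const_mul (w : S → ℝ) (c : ℝ) :
    stateNoise M ξ k h (fun s => c * w s) = c * stateNoise M ξ k h w := by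
  simp only [stateNoise, mean_const_mul, mul_sub]

/-- The part of the regret of a step that is paid for the uncertainty about the environment. -/
def stepCost (M : MDP S A) (δ : ℝ) (ξ : Trace S A) (π : DetPolicy S A) (k h : ℕ) : ℝ :=
  2 * bonusR M.H δ ξ k h (ξ.state k h)
    + 18 * √(var (M.tr h (ξ.state k h) (ξ.act k h)) (M.value π.toPolicy (h + 1))
        * (logFactor S A M.H δ k / max (ξ.nSA (k - 1) h (ξ.state k h) (ξ.act k h) : ℝ) 1))
    + 85 * (Fintype.card S * ((M.H : ℝ) ^ 2
        * (logFactor S A M.H δ k / max (ξ.nSA (k - 1) h (ξ.state k h) (ξ.act k h) : ℝ) 1)))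

lemma stepCost_nonneg (hL : 0 ≤ logFactor S A M.H δ k) (π : DetPolicy S A) :
    0 ≤ stepCost M δ ξ π k h := by
  have := bonusR_nonneg (H := M.H) (δ := δ) (ξ := ξ) (k := k) (h := h) (ξ.state k h)
  unfold stepCost
  positivity

/-- The noise of a step in the regret decomposition, with the weight of the step. -/
def gapNoise (M : MDP S A) (δ : ℝ) (ξ : Trace S A) (π : DetPolicy S A) (k h : ℕ) : ℝ :=
  actionNoise M ξ π k h (fun s a => -(1 + 9 / (M.H : ℝ)) ^ (h - 1) * scoreGap M δ ξ π k h s a)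
    + stateNoise M ξ k h (fun s => -(1 + 9 / (M.H : ℝ)) ^ h * valueGap M δ ξ π k (h + 1) s)

lemma weight_le (h : ℕ) (hh : h ≤ M.H) : (1 + 9 / (M.H : ℝ)) ^ h ≤ Real.exp 9 := by
  have hH1 : (1 : ℝ) ≤ M.H := by exact_mod_cast M.one_le_H
  calc (1 + 9 / (M.H : ℝ)) ^ h ≤ (1 + 9 / (M.H : ℝ)) ^ M.H :=
        pow_le_pow_right₀ (by linarith [show 0 ≤ 9 / (M.H : ℝ) by positivity]) hh
    _ ≤ Real.exp (9 / M.H) ^ M.H := by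
        gcongr
        linarith [Real.add_one_le_exp (9 / (M.H : ℝ))]
    _ = Real.exp 9 := by
        rw [← Real.exp_nat_mul]
        congr 1
        field_simp

section Episode

variable (hc : Concentrated M δ ξ k) (hδ : δ ∈ Set.Ioo (0 : ℝ) 1) (hk : 1 ≤ k)
  {π : DetPolicy S A} (hπ : IsMVPRLPolicy M.H δ ξ k π)

include hc hδ hk hπ

lemma valueGap_telescope {n : ℕ} (hn : n ≤ M.H) :
    valueGap M δ ξ π k 1 (ξ.state k 1)
      ≤ ∑ h ∈ Finset.Icc 1 n, (Real.exp 9 * stepCost M δ ξ π k h + gapNoise M δ ξ π k h)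
        + (1 + 9 / (M.H : ℝ)) ^ n * valueGap M δ ξ π k (n + 1) (ξ.state k (n + 1)) := by
  induction n with
  | zero => simp
  | succ n ih =>
    refine (ih (by omega)).trans ?_
    rw [Finset.sum_Icc_succ_top (Nat.le_add_left 1 n), add_assoc]
    refine add_le_add_right ?_ _
    have hh : n + 1 ∈ Set.Icc 1 M.H := ⟨by omega, hn⟩
    have hL := one_le_logFactor (S := S) (A := A) M.one_le_H hδ hk
    have hH1 : (1 : ℝ) ≤ M.H := by exact_mod_cast M.one_le_H
    set α : ℝ := 1 + 9 / (M.H : ℝ) with hα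
    have hα0 : 0 ≤ α ^ n := by positivity
    have h1 := valueGap_le hc hδ hk π hh hπ (ξ.state k (n + 1))
    have h2 := scoreGap_le hc hδ hk hh π (ξ.state k (n + 1)) (ξ.act k (n + 1))
    have h3 : gapNoise M δ ξ π k (n + 1)
        = -(α ^ n) * actionNoise M ξ π k (n + 1) (scoreGap M δ ξ π k (n + 1))
          + -(α ^ (n + 1)) * stateNoise M ξ k (n + 1) (valueGap M δ ξ π k (n + 1 + 1)) := by
      rw [gapNoise, ← hα, Nat.add_sub_cancel, ← actionNoise_const_mul, ← stateNoise_const_mul]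
    -- Conditional means are realized values minus noise; this fixes the negative signs in
    -- `gapNoise`.
    have h4 : valueGap M δ ξ π k (n + 1) (ξ.state k (n + 1))
        ≤ stepCost M δ ξ π k (n + 1)
          - actionNoise M ξ π k (n + 1) (scoreGap M δ ξ π k (n + 1))
          + α * (valueGap M δ ξ π k (n + 1 + 1) (ξ.state k (n + 1 + 1))
            - stateNoise M ξ k (n + 1) (valueGap M δ ξ π k (n + 1 + 1))) := by
      unfold actionNoise stateNoise stepCost
      rw [← hα] at h2
      linarith
    have h5 := mul_le_mul_of_nonneg_left h4 hα0
    have h6 : α ^ n * stepCost M δ ξ π k (n + 1) ≤ Real.exp 9 * stepCost M δ ξ π k (n + 1) :=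
      mul_le_mul_of_nonneg_right (weight_le n (by omega)) (stepCost_nonneg (by linarith) π)
    rw [h3, pow_succ]
    linarith

lemma optValue_sub_value_le :
    M.optValue 1 (ξ.state k 1) - M.value π.toPolicy 1 (ξ.state k 1)
      ≤ ∑ h ∈ Finset.Icc 1 M.H, (Real.exp 9 * stepCost M δ ξ π k h + gapNoise M δ ξ π k h) := by
  have h1 := optValue_le_optimisticValue hc hδ hk ⟨le_rfl, by omega⟩ (ξ.state k 1)
  have h2 := valueGap_telescope hc hδ hk hπ le_rfl
  have h3 : valueGap M δ ξ π k (M.H + 1) (ξ.state k (M.H + 1)) = 0 := by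
    unfold valueGap
    rw [optimisticValue_terminal, MDP.value_terminal, sub_zero]
  rw [h3, mul_zero, add_zero] at h2
  unfold valueGap at h2
  linarith

end Episode

/-- The noise of a step in the decomposition of the variances of the value along an episode. -/
def varNoise (M : MDP S A) (ξ : Trace S A) (π : DetPolicy S A) (k h : ℕ) : ℝ :=
  actionNoise M ξ π k h (fun s a => -(mean (M.tr h s a) (M.value π.toPolicy (h + 1))) ^ 2)
    + stateNoise M ξ k h (fun s => -(M.value π.toPolicy (h + 1) s) ^ 2)

/-- Write the value as `ρ + m`, with expected reward `ρ` in `[0, 1]` and expected continuation `m`.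
Then `(ρ + m)² - m² = ρ ((ρ + m) + m) ≤ 2H`, and Jensen's inequality bounds `m²`. -/
lemma value_sq_le (π : DetPolicy S A) (hh : h ∈ Set.Icc 1 M.H) (s : S) :
    M.value π.toPolicy h s ^ 2 ≤ 2 * M.H
      + ∫ r, mean (M.tr h s (π.act h s r)) (M.value π.toPolicy (h + 1)) ^ 2 ∂(M.rewardLaw h s) := by
  have hV := M.value_mem π.toPolicy h hh.1 s
  have hfin := M.integrable_played π h s
  have hr := M.integrable_reward_played π h s
  set f : A → ℝ := fun a => mean (M.tr h s a) (M.value π.toPolicy (h + 1)) with hf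
  have hf0 : ∀ a, f a ∈ Set.Icc (0 : ℝ) M.H := fun a =>
    M.mean_tr_mem h s a fun s' => M.value_mem π.toPolicy (h + 1) (by omega) s'
  have hb : M.value π.toPolicy h s = ∫ r, r (π.act h s r) ∂(M.rewardLaw h s)
      + ∫ r, f (π.act h s r) ∂(M.rewardLaw h s) := by
    rw [M.value_detPolicy_bellman π hh.2, integral_add hr (hfin f)]
  set ρ := ∫ r, r (π.act h s r) ∂(M.rewardLaw h s) with hρ
  set m := ∫ r, f (π.act h s r) ∂(M.rewardLaw h s) with hm
  have hρ0 : 0 ≤ ρ := integral_nonneg_of_ae ((M.reward_mem h s).mono fun r hr => (hr _).1)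
  have hρ1 : ρ ≤ 1 := by
    have := integral_mono_ae hr (integrable_const 1) ((M.reward_mem h s).mono fun r hr => (hr _).2)
    simpa using this
  have hm0 : 0 ≤ m := integral_nonneg fun r => (hf0 _).1
  have hj : m ^ 2 ≤ ∫ r, f (π.act h s r) ^ 2 ∂(M.rewardLaw h s) := by
    have h1 : 0 ≤ ∫ r, (f (π.act h s r) - m) ^ 2 ∂(M.rewardLaw h s) :=
      integral_nonneg fun r => sq_nonneg _
    have h2 : ∫ r, (f (π.act h s r) - m) ^ 2 ∂(M.rewardLaw h s)
        = ∫ r, f (π.act h s r) ^ 2 ∂(M.rewardLaw h s) - m ^ 2 := by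
      have e : ∀ r, (f (π.act h s r) - m) ^ 2
          = f (π.act h s r) ^ 2 - (2 * m * f (π.act h s r) - m ^ 2) := fun r => by ring
      simp only [e]
      rw [integral_sub (hfin fun a => f a ^ 2) (hfin fun a => 2 * m * f a - m ^ 2),
        integral_sub (hfin fun a => 2 * m * f a) (integrable_const _), integral_const_mul, ← hm]
      simp only [integral_const, probReal_univ, smul_eq_mul, one_mul]
      ring
    linarith
  rw [hb] at hV ⊢
  nlinarith [hV.2]

/-- A law of total variance: each variance is a mean of squares minus a squared mean, and the
squares telescope along the episode up to noise and `2H` per step. Bounding every variance by `H²`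
would lose a factor H. -/
lemma sum_var_le (π : DetPolicy S A) :
    ∑ h ∈ Finset.Icc 1 M.H, var (M.tr h (ξ.state k h) (ξ.act k h)) (M.value π.toPolicy (h + 1))
      ≤ 2 * (M.H : ℝ) ^ 2 + ∑ h ∈ Finset.Icc 1 M.H, varNoise M ξ π k h := by
  have key : ∀ n ≤ M.H,
      ∑ h ∈ Finset.Icc 1 n, var (M.tr h (ξ.state k h) (ξ.act k h)) (M.value π.toPolicy (h + 1))
      ≤ n * (2 * M.H) + ∑ h ∈ Finset.Icc 1 n, varNoise M ξ π k h
        + M.value π.toPolicy (n + 1) (ξ.state k (n + 1)) ^ 2 := by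
    intro n hn
    induction n with
    | zero =>
      simp only [zero_lt_one, Finset.Icc_eq_empty_of_lt, Finset.sum_empty, Nat.cast_zero,
        zero_mul, add_zero, zero_add]
      positivity
    | succ n ih =>
      rw [Finset.sum_Icc_succ_top (Nat.le_add_left 1 n), Finset.sum_Icc_succ_top
        (Nat.le_add_left 1 n)]
      have h1 := ih (by omega)
      have h2 := value_sq_le π (show n + 1 ∈ Set.Icc 1 M.H from ⟨by omega, hn⟩)
        (ξ.state k (n + 1))
      have h3 : varNoise M ξ π k (n + 1)
          = var (M.tr (n + 1) (ξ.state k (n + 1)) (ξ.act k (n + 1)))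
              (M.value π.toPolicy (n + 1 + 1))
            - M.value π.toPolicy (n + 1 + 1) (ξ.state k (n + 1 + 1)) ^ 2
            + ∫ r, mean (M.tr (n + 1) (ξ.state k (n + 1)) (π.act (n + 1) (ξ.state k (n + 1)) r))
              (M.value π.toPolicy (n + 1 + 1)) ^ 2 ∂(M.rewardLaw (n + 1) (ξ.state k (n + 1))) := by
        simp only [varNoise, actionNoise, stateNoise, integral_neg, var, mean, mul_neg,
          Finset.sum_neg_distrib]
        ring
      rw [h3]
      push_cast
      linarith
  have := key M.H le_rfl
  rw [MDP.value_terminal] at this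
  linarith

end

/-! ### Sums over the episodes and the regret on the good event -/

section

variable {S A : Type*} [Fintype S] [MeasurableSpace S] [MeasurableSingletonClass S]
  [Fintype A] [MeasurableSpace A] [MeasurableSingletonClass A] [Nonempty S] [Nonempty A]
  {M : MDP S A} {δ : ℝ} {ξ : Trace S A} {K : ℕ} {π : ℕ → DetPolicy S A}

section Sums

variable (hδ : δ ∈ Set.Ioo (0 : ℝ) 1) (hK : 1 ≤ K)
include hδ hK

lemma sum_sum_inv_nSA_le :
    ∑ k ∈ Finset.Icc 1 K, ∑ h ∈ Finset.Icc 1 M.H,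
        1 / max (ξ.nSA (k - 1) h (ξ.state k h) (ξ.act k h) : ℝ) 1
      ≤ M.H * Fintype.card S * Fintype.card A * logFactor S A M.H δ K := by
  rw [Finset.sum_comm]
  have hlog := two_add_log_le_logFactor (S := S) (A := A) M.one_le_H hδ hK
  calc _ ≤ ∑ _h ∈ Finset.Icc 1 M.H, (Fintype.card S * Fintype.card A * logFactor S A M.H δ K) :=
        Finset.sum_le_sum fun h _ => (sum_inv_nSA_le ξ h hK).trans (by gcongr)
    _ = _ := by simp; ring

lemma sum_sum_inv_nS_le :
    ∑ k ∈ Finset.Icc 1 K, ∑ h ∈ Finset.Icc 1 M.H,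
        1 / max (ξ.nS (k - 1) h (ξ.state k h) : ℝ) 1
      ≤ M.H * Fintype.card S * logFactor S A M.H δ K := by
  rw [Finset.sum_comm]
  have hlog := two_add_log_le_logFactor (S := S) (A := A) M.one_le_H hδ hK
  calc _ ≤ ∑ _h ∈ Finset.Icc 1 M.H, (Fintype.card S * logFactor S A M.H δ K) :=
        Finset.sum_le_sum fun h _ => (sum_inv_nS_le ξ h hK).trans (by gcongr)
    _ = _ := by simp; ring

/-- Cauchy-Schwarz over KH steps gives √(H²SAK) L; a factor √H is given away to match the leading
term. -/
lemma sum_bonusR_le :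
    ∑ k ∈ Finset.Icc 1 K, ∑ h ∈ Finset.Icc 1 M.H, bonusR M.H δ ξ k h (ξ.state k h)
      ≤ 3 * (√((M.H : ℝ) ^ 3 * Fintype.card S * Fintype.card A * K) * logFactor S A M.H δ K) := by
  have hH1 : (1 : ℝ) ≤ M.H := by exact_mod_cast M.one_le_H
  have hL := one_le_logFactor (S := S) (A := A) M.one_le_H hδ hK
  set L := logFactor S A M.H δ K with hLdef
  have h1 : ∀ k ∈ Finset.Icc 1 K, ∀ h ∈ Finset.Icc 1 M.H, bonusR M.H δ ξ k h (ξ.state k h)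
      ≤ 3 * √(Fintype.card A * L) * √(1 / max (ξ.nS (k - 1) h (ξ.state k h) : ℝ) 1) := by
    intro k hk h _
    rw [Finset.mem_Icc] at hk
    have hLk := logFactor_mono (S := S) (A := A) M.one_le_H hδ hk.1 hk.2
    have hLk0 := one_le_logFactor (S := S) (A := A) M.one_le_H hδ hk.1
    rw [mul_assoc, ← Real.sqrt_mul (by positivity)]
    unfold bonusR
    refine mul_le_mul_of_nonneg_left (Real.sqrt_le_sqrt ?_) (by norm_num)
    rw [mul_one_div]
    gcongr
    have : (1 : ℝ) ≤ max (ξ.nS (k - 1) h (ξ.state k h) : ℝ) 1 := le_max_right _ _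
    linarith
  refine (Finset.sum_le_sum fun k hk => Finset.sum_le_sum fun h hh => h1 k hk h hh).trans ?_
  simp only [← Finset.mul_sum]
  have h2 := sum_sum_inv_nS_le (M := M) (ξ := ξ) hδ hK
  rw [← hLdef] at h2
  rw [← Finset.sum_product'] at h2 ⊢
  have h3 := Real.sum_sqrt_mul_sqrt_le (Finset.Icc 1 K ×ˢ Finset.Icc 1 M.H) (f := fun _ => 1)
    (g := fun x => 1 / max (ξ.nS (x.1 - 1) x.2 (ξ.state x.1 x.2) : ℝ) 1) (fun _ => zero_le_one)
    (fun _ => by positivity)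
  have h4 : ∑ _x ∈ Finset.Icc 1 K ×ˢ Finset.Icc 1 M.H, (1 : ℝ) = K * M.H := by simp
  simp only [h4, Real.sqrt_one, one_mul] at h3
  rw [mul_assoc]
  refine mul_le_mul_of_nonneg_left ?_ (by norm_num)
  calc _ ≤ √(Fintype.card A * L) * (√(K * M.H) * √(M.H * Fintype.card S * L)) := by
        refine mul_le_mul_of_nonneg_left (h3.trans ?_) (Real.sqrt_nonneg _)
        gcongr
    _ = √((Fintype.card A * L) * ((K * M.H) * (M.H * Fintype.card S * L))) := by
        rw [Real.sqrt_mul (x := Fintype.card A * L) (by positivity),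
          Real.sqrt_mul (x := (K : ℝ) * M.H) (by positivity)]
    _ ≤ √(L ^ 2 * ((M.H : ℝ) ^ 3 * Fintype.card S * Fintype.card A * K)) := by
        refine Real.sqrt_le_sqrt ?_
        calc _ = (M.H : ℝ) ^ 2 * (L ^ 2 * Fintype.card S * Fintype.card A * K) := by ring
          _ ≤ (M.H : ℝ) ^ 3 * (L ^ 2 * Fintype.card S * Fintype.card A * K) := by
              gcongr; norm_num
          _ = _ := by ring
    _ = _ := by rw [sqrt_sq_mul (by linarith), mul_comm]

lemma sum_sqrt_var_le
    (hvar : ∑ k ∈ Finset.Icc 1 K, ∑ h ∈ Finset.Icc 1 M.H, varNoise M ξ (π k) k h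
      ≤ (M.H : ℝ) ^ 2 * √(K * M.H * logFactor S A M.H δ K)) :
    ∑ k ∈ Finset.Icc 1 K, ∑ h ∈ Finset.Icc 1 M.H,
      √(var (M.tr h (ξ.state k h) (ξ.act k h)) (M.value (π k).toPolicy (h + 1))
        * (logFactor S A M.H δ k / max (ξ.nSA (k - 1) h (ξ.state k h) (ξ.act k h) : ℝ) 1))
      ≤ 2 * (√((M.H : ℝ) ^ 3 * Fintype.card S * Fintype.card A * K) * logFactor S A M.H δ K)
        + (M.H : ℝ) ^ 3 * (Fintype.card S : ℝ) ^ 2 * Fintype.card A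
          * logFactor S A M.H δ K ^ 2 := by
  have hH1 : (1 : ℝ) ≤ M.H := by exact_mod_cast M.one_le_H
  have hS : (1 : ℝ) ≤ Fintype.card S := by exact_mod_cast Fintype.card_pos
  have hA : (1 : ℝ) ≤ Fintype.card A := by exact_mod_cast Fintype.card_pos
  have hL := one_le_logFactor (S := S) (A := A) M.one_le_H hδ hK
  set L := logFactor S A M.H δ K with hLdef
  set σ : ℝ := ((Fintype.card S : ℕ) : ℝ) with hσ
  set a : ℝ := ((Fintype.card A : ℕ) : ℝ) with ha
  set H : ℝ := (M.H : ℝ) with hHdef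
  let v : ℕ → ℕ → ℝ := fun k h =>
    var (M.tr h (ξ.state k h) (ξ.act k h)) (M.value (π k).toPolicy (h + 1))
  let w : ℕ → ℕ → ℝ := fun k h => 1 / max (ξ.nSA (k - 1) h (ξ.state k h) (ξ.act k h) : ℝ) 1
  have hv0 : ∀ k h, 0 ≤ v k h := fun k h => var_nonneg (M.tr_nonneg h _ _) (M.sum_tr h _ _) _
  have h1 : ∀ k ∈ Finset.Icc 1 K, ∀ h ∈ Finset.Icc 1 M.H,
      √(v k h * (logFactor S A M.H δ k / max (ξ.nSA (k - 1) h (ξ.state k h) (ξ.act k h) : ℝ) 1))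
      ≤ √L * (√(v k h) * √(w k h)) := by
    intro k hk h _
    rw [Finset.mem_Icc] at hk
    have hLk := logFactor_mono (S := S) (A := A) M.one_le_H hδ hk.1 hk.2
    rw [← Real.sqrt_mul (hv0 k h), ← Real.sqrt_mul (by linarith)]
    refine Real.sqrt_le_sqrt ?_
    rw [mul_left_comm L]
    refine mul_le_mul_of_nonneg_left ?_ (hv0 k h)
    simp only [w]
    rw [mul_one_div]
    gcongr
  refine (Finset.sum_le_sum fun k hk => Finset.sum_le_sum fun h hh => h1 k hk h hh).trans ?_
  simp only [← Finset.mul_sum]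
  have hw := sum_sum_inv_nSA_le (M := M) (ξ := ξ) hδ hK
  have hv : ∑ k ∈ Finset.Icc 1 K, ∑ h ∈ Finset.Icc 1 M.H, v k h ≤ 3 * (H ^ 2 * K) + H ^ 3 * L := by
    have h2 := Finset.sum_le_sum fun k (_ : k ∈ Finset.Icc 1 K) =>
      sum_var_le (M := M) (ξ := ξ) (k := k) (π k)
    rw [Finset.sum_add_distrib] at h2
    simp only [Finset.sum_const, Nat.card_Icc, Nat.add_sub_cancel, nsmul_eq_mul] at h2
    -- The noise `H² √(K · HL)` splits into multiples of `H² K` and `H³ L`, so it does not raise the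
    -- order of the total variance.
    have h3 := two_mul_sqrt_mul_le (by positivity : (0 : ℝ) ≤ K) (by positivity : 0 ≤ H * L)
    rw [← mul_assoc] at h3
    have h4 := mul_le_mul_of_nonneg_left h3 (by positivity : 0 ≤ H ^ 2)
    have h5 : 0 ≤ H ^ 2 * K := by positivity
    have h6 : 0 ≤ H ^ 3 * L := by positivity
    refine h2.trans ?_
    nlinarith [hvar]
  rw [← Finset.sum_product'] at hw hv ⊢
  have h3 := Real.sum_sqrt_mul_sqrt_le (Finset.Icc 1 K ×ˢ Finset.Icc 1 M.H)
    (f := fun x => v x.1 x.2) (g := fun x => w x.1 x.2) (fun x => hv0 _ _)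
    (fun _ => by simp only [w]; positivity)
  calc _ ≤ √L * (√(3 * (H ^ 2 * K) + H ^ 3 * L) * √(H * σ * a * L)) := by
        refine mul_le_mul_of_nonneg_left (h3.trans ?_) (Real.sqrt_nonneg _)
        gcongr
    _ = √(L * ((3 * (H ^ 2 * K) + H ^ 3 * L) * (H * σ * a * L))) := by
        rw [Real.sqrt_mul (x := L) (by positivity),
          Real.sqrt_mul (x := 3 * (H ^ 2 * K) + H ^ 3 * L) (by positivity)]
    _ ≤ √((2 * L) ^ 2 * (H ^ 3 * σ * a * K) + (H ^ 3 * σ ^ 2 * a * L ^ 2) ^ 2) := by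
        refine Real.sqrt_le_sqrt ?_
        -- The part free of `K` lies below the square of the lower-order term.
        have e : H ^ 4 * σ * a * L ^ 3 ≤ H ^ 6 * σ ^ 4 * a ^ 2 * L ^ 4 := by
          gcongr
          · norm_num
          · exact le_self_pow₀ hS (by norm_num)
          · exact le_self_pow₀ hA (by norm_num)
          · norm_num
        have e2 : 0 ≤ L ^ 2 * (H ^ 3 * σ * a * K) := by positivity
        nlinarith
    _ ≤ √((2 * L) ^ 2 * (H ^ 3 * σ * a * K)) + √((H ^ 3 * σ ^ 2 * a * L ^ 2) ^ 2) :=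
        sqrt_add_le_add _ _ (by positivity) (by positivity)
    _ = _ := by
        rw [sqrt_sq_mul (by linarith), Real.sqrt_sq (by positivity)]
        ring

/-- The regret bound on the event that all the concentration inequalities hold. -/
lemma regret_le_of_concentrated
    (hc : ∀ k ∈ Finset.Icc 1 K, Concentrated M δ ξ k)
    (hπ : ∀ k ∈ Finset.Icc 1 K, IsMVPRLPolicy M.H δ ξ k (π k))
    (hgap : ∑ k ∈ Finset.Icc 1 K, ∑ h ∈ Finset.Icc 1 M.H, gapNoise M δ ξ (π k) k h
      ≤ 3 * M.H * Real.exp 9 * √(K * M.H * logFactor S A M.H δ K))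
    (hvar : ∑ k ∈ Finset.Icc 1 K, ∑ h ∈ Finset.Icc 1 M.H, varNoise M ξ (π k) k h
      ≤ (M.H : ℝ) ^ 2 * √(K * M.H * logFactor S A M.H δ K)) :
    regret M (fun k => ξ.state k 1) π K ≤ Real.exp 9 *
      (45 * (√((M.H : ℝ) ^ 3 * Fintype.card S * Fintype.card A * K) * logFactor S A M.H δ K)
      + 103 * ((M.H : ℝ) ^ 3 * (Fintype.card S : ℝ) ^ 2 * Fintype.card A
          * logFactor S A M.H δ K ^ 2)) := by
  have hb := sum_bonusR_le (M := M) (ξ := ξ) hδ hK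
  have hs := sum_sqrt_var_le hδ hK hvar
  have hn := sum_sum_inv_nSA_le (M := M) (ξ := ξ) hδ hK
  have hH1 : (1 : ℝ) ≤ M.H := by exact_mod_cast M.one_le_H
  have hS : (1 : ℝ) ≤ Fintype.card S := by exact_mod_cast Fintype.card_pos
  have hA : (1 : ℝ) ≤ Fintype.card A := by exact_mod_cast Fintype.card_pos
  have hL := one_le_logFactor (S := S) (A := A) M.one_le_H hδ hK
  have hℓ : ∑ k ∈ Finset.Icc 1 K, ∑ h ∈ Finset.Icc 1 M.H,
      (logFactor S A M.H δ k / max (ξ.nSA (k - 1) h (ξ.state k h) (ξ.act k h) : ℝ) 1)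
      ≤ logFactor S A M.H δ K * (M.H * Fintype.card S * Fintype.card A * logFactor S A M.H δ K) := by
    refine le_trans ?_ (mul_le_mul_of_nonneg_left hn (by linarith))
    simp only [Finset.mul_sum]
    refine Finset.sum_le_sum fun k hk => Finset.sum_le_sum fun h _ => ?_
    rw [Finset.mem_Icc] at hk
    have hLk := logFactor_mono (S := S) (A := A) M.one_le_H hδ hk.1 hk.2
    rw [mul_one_div]
    gcongr
  have hreg : regret M (fun k => ξ.state k 1) π K ≤ ∑ k ∈ Finset.Icc 1 K,
      ∑ h ∈ Finset.Icc 1 M.H, (Real.exp 9 * stepCost M δ ξ (π k) k h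
        + gapNoise M δ ξ (π k) k h) :=
    Finset.sum_le_sum fun k hk => optValue_sub_value_le (hc k hk) hδ (Finset.mem_Icc.1 hk).1 (hπ k hk)
  simp only [Finset.sum_add_distrib, ← Finset.mul_sum, stepCost] at hreg
  set L := logFactor S A M.H δ K with hLdef
  set Y := √((M.H : ℝ) ^ 3 * Fintype.card S * Fintype.card A * K) with hY
  set E := Real.exp 9 with hE
  have hE0 : 0 < E := Real.exp_pos 9
  have hg : 3 * M.H * E * √(K * M.H * L) ≤ 3 * E * (Y * L) := by
    have h1 : M.H * √(K * M.H * L) ≤ Y * L := by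
      rw [mul_comm Y L, hY, ← sqrt_sq_mul (c := (M.H : ℝ)) (by linarith),
        ← sqrt_sq_mul (c := L) (by linarith)]
      refine Real.sqrt_le_sqrt ?_
      calc _ = (L * 1) * ((M.H : ℝ) ^ 3 * 1 * 1 * K) := by ring
        _ ≤ (L * L) * ((M.H : ℝ) ^ 3 * Fintype.card S * Fintype.card A * K) := by gcongr
        _ = _ := by ring
    calc _ = 3 * E * (M.H * √(K * M.H * L)) := by ring
      _ ≤ _ := by gcongr
  have hℓ2 := mul_le_mul_of_nonneg_left hℓ
    (by positivity : 0 ≤ (Fintype.card S : ℝ) * (M.H : ℝ) ^ 2)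
  refine hreg.trans ?_
  refine (add_le_add (mul_le_mul_of_nonneg_left (add_le_add (add_le_add
    (mul_le_mul_of_nonneg_left hb two_pos.le) (mul_le_mul_of_nonneg_left hs (by norm_num)))
    (mul_le_mul_of_nonneg_left (mul_le_mul_of_nonneg_left (mul_le_mul_of_nonneg_left hℓ
      (by positivity)) (by positivity)) (by norm_num))) hE0.le) (hgap.trans hg)).trans ?_
  -- The constants are `45 = 2·3 + 18·2 + 3` (reward bonuses, variances, noise) and `103 = 18 + 85`.
  apply le_of_eq
  ring

end Sums

/-- The logarithmic factor is of the order of the logarithm in the regret bound. -/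
lemma logFactor_le {H : ℕ} (hH : 1 ≤ H) (hδ : δ ∈ Set.Ioo (0 : ℝ) 1) (hK : 1 ≤ K)
    (h2 : (2 : ℝ) ≤ Fintype.card S * Fintype.card A * H * K) :
    logFactor S A H δ K ≤ 13 * Real.log (Fintype.card S * Fintype.card A * H * K / δ) := by
  have hS : (1 : ℝ) ≤ Fintype.card S := by exact_mod_cast Fintype.card_pos
  have hA : (1 : ℝ) ≤ Fintype.card A := by exact_mod_cast Fintype.card_pos
  have hH' : (1 : ℝ) ≤ H := by exact_mod_cast hH
  have hk' : (1 : ℝ) ≤ K := by exact_mod_cast hK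
  obtain ⟨hδ0, hδ1⟩ := hδ
  set σ : ℝ := ((Fintype.card S : ℕ) : ℝ)
  set a : ℝ := ((Fintype.card A : ℕ) : ℝ)
  have hx : 2 ≤ σ * a * H * K / δ := by
    rw [le_div_iff₀ hδ0]; nlinarith
  rw [show (13 : ℝ) * Real.log (σ * a * H * K / δ) = Real.log ((σ * a * H * K / δ) ^ 13) by
    rw [Real.log_pow]; norm_num, logFactor]
  refine Real.log_le_log (by positivity) ?_
  -- Since `K + 1 ≤ 2K`, the constant is at most `288 ≤ 2⁹`, and `2⁹` is absorbed by nine powers of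
  -- a quantity that is at least 2; hence `13 = 9 + 4`.
  have h4 : 144 * σ ^ 2 * a * (H : ℝ) ^ 2 * (K : ℝ) ^ 3 * (K + 1) / δ
      ≤ 2 ^ 9 * (σ * a * H * K / δ) ^ 4 := by
    have h5 : 144 * σ ^ 2 * a * (H : ℝ) ^ 2 * (K : ℝ) ^ 3 * (K + 1)
        ≤ 2 ^ 9 * (σ ^ 4 * a ^ 4 * (H : ℝ) ^ 4 * (K : ℝ) ^ 3 * K) := by
      calc _ = 144 * (σ ^ 2 * a ^ 1 * (H : ℝ) ^ 2 * (K : ℝ) ^ 3 * (K + 1)) := by ring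
        _ ≤ 144 * (σ ^ 4 * a ^ 4 * (H : ℝ) ^ 4 * (K : ℝ) ^ 3 * (K + K)) := by
            gcongr <;> first | assumption | norm_num
        _ = 288 * (σ ^ 4 * a ^ 4 * (H : ℝ) ^ 4 * (K : ℝ) ^ 3 * K) := by ring
        _ ≤ _ := by gcongr; norm_num
    have h6 : δ ^ 4 ≤ δ := pow_le_of_le_one hδ0.le hδ1.le (by norm_num)
    calc _ ≤ 2 ^ 9 * (σ ^ 4 * a ^ 4 * (H : ℝ) ^ 4 * (K : ℝ) ^ 3 * K) / δ := by gcongr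
      _ ≤ 2 ^ 9 * (σ ^ 4 * a ^ 4 * (H : ℝ) ^ 4 * (K : ℝ) ^ 3 * K) / δ ^ 4 := by gcongr
      _ = _ := by rw [div_pow]; ring
  calc _ ≤ 2 ^ 9 * (σ * a * H * K / δ) ^ 4 := h4
    _ ≤ (σ * a * H * K / δ) ^ 9 * (σ * a * H * K / δ) ^ 4 := by gcongr
    _ = _ := by rw [← pow_add]

end

section

/-! ### The probability that the concentration inequalities fail -/

section Union

variable {Ω : Type*} [MeasurableSpace Ω] {μ : Measure Ω}

lemma measure_not_forall_le {ι : Type*} [Fintype ι] {p : ι → Ω → Prop} {c : ℝ}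
    (h : ∀ i, μ {ω | ¬ p i ω} ≤ ENNReal.ofReal c) :
    μ {ω | ¬ ∀ i, p i ω} ≤ ENNReal.ofReal (Fintype.card ι * c) := by
  have e : {ω | ¬ ∀ i, p i ω} = ⋃ i, {ω | ¬ p i ω} := by ext; simp
  rw [e, ENNReal.ofReal_mul (by positivity), ENNReal.ofReal_natCast]
  calc _ ≤ ∑ i, μ {ω | ¬ p i ω} := measure_iUnion_fintype_le _ _
    _ ≤ ∑ _i : ι, ENNReal.ofReal c := Finset.sum_le_sum fun i _ => h i
    _ = _ := by simp

lemma measure_not_forall_Icc_le {H : ℕ} {p : ℕ → Ω → Prop} {c : ℝ}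
    (h : ∀ i ∈ Set.Icc 1 H, μ {ω | ¬ p i ω} ≤ ENNReal.ofReal c) :
    μ {ω | ¬ ∀ i ∈ Set.Icc 1 H, p i ω} ≤ ENNReal.ofReal (H * c) := by
  have := measure_not_forall_le (μ := μ) (ι := Set.Icc 1 H) (p := fun i => p i) (c := c)
    fun i => h i i.2
  simpa using this

end Union

variable {S A Ω : Type*} [Fintype S] [MeasurableSpace S] [MeasurableSingletonClass S]
  [Fintype A] [MeasurableSpace A] [MeasurableSingletonClass A] [Nonempty S] [Nonempty A]
  [MeasurableSpace Ω] {μ : Measure Ω} [IsProbabilityMeasure μ] {M : MDP S A}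
  {ξ : Ω → Trace S A} {π : ℕ → Ω → DetPolicy S A} {δ : ℝ} {k : ℕ}

/-- The rounding down of `x` to the multiples of `1 / k`. -/
def roundDown (k : ℕ) (x : A → ℝ) (a : A) : ℝ := ⌊k * x a⌋₊ / k

lemma roundDown_le (hk : 1 ≤ k) {x : A → ℝ} (hx : ∀ a, 0 ≤ x a) (a : A) :
    roundDown k x a ≤ x a := by
  have hk' : (0 : ℝ) < k := by exact_mod_cast hk
  rw [roundDown, div_le_iff₀ hk', mul_comm (x a)]
  exact Nat.floor_le (mul_nonneg (Nat.cast_nonneg k) (hx a))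

lemma le_roundDown_add (hk : 1 ≤ k) (x : A → ℝ) (a : A) :
    x a ≤ roundDown k x a + 1 / k := by
  have hk' : (0 : ℝ) < k := by exact_mod_cast hk
  rw [roundDown, ← add_div, le_div_iff₀ hk', mul_comm (x a)]
  exact (Nat.lt_floor_add_one _).le

/-- The deviation of the mean of the best score is stable under rounding of the bonuses. -/
lemma abs_deviation_le_roundDown (M : MDP S A) (ξ : Trace S A) {j h : ℕ} {s : S}
    (hn : ξ.nS j h s ≠ 0) (hk : 1 ≤ k) {x : A → ℝ} (hx : ∀ a, 0 ≤ x a) :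
    |ξ.empR j h s (fun r => ⨆ a, (r a + x a)) - ∫ r, ⨆ a, (r a + x a) ∂(M.rewardLaw h s)|
      ≤ |ξ.empR j h s (fun r => ⨆ a, (r a + roundDown k x a))
          - ∫ r, ⨆ a, (r a + roundDown k x a) ∂(M.rewardLaw h s)| + 1 / k := by
  -- Rounding lowers both means, each by at most `1/k`, so their difference moves by `1/k` and not
  -- by `2/k`.
  have hle : ∀ r : A → ℝ, (⨆ a, (r a + roundDown k x a)) ≤ ⨆ a, (r a + x a) := fun r => by
    simpa using iSup_add_le_add (roundDown k x) x r 0 fun a => by simpa using roundDown_le hk hx a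
  have hge : ∀ r : A → ℝ, (⨆ a, (r a + x a)) ≤ (⨆ a, (r a + roundDown k x a)) + 1 / k := fun r =>
    iSup_add_le_add x (roundDown k x) r _ fun a => le_roundDown_add hk x a
  have hn' : (0 : ℝ) < ξ.nS j h s := by exact_mod_cast Nat.pos_of_ne_zero hn
  have e1 : ξ.empR j h s (fun r => ⨆ a, (r a + roundDown k x a))
      ≤ ξ.empR j h s (fun r => ⨆ a, (r a + x a)) := by
    unfold Trace.empR
    gcongr
    exact hle _
  have e2 : ξ.empR j h s (fun r => ⨆ a, (r a + x a))
      ≤ ξ.empR j h s (fun r => ⨆ a, (r a + roundDown k x a)) + 1 / k := by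
    unfold Trace.empR
    rw [div_add' _ _ _ hn'.ne']
    gcongr
    refine (Finset.sum_le_sum fun i _ => hge _).trans_eq ?_
    rw [Finset.sum_add_distrib, Finset.sum_const, nsmul_eq_mul, Trace.nS]
    ring
  have i1 := M.integrable_iSup h s x
  have i2 := M.integrable_iSup h s (roundDown k x)
  have e3 : ∫ r, ⨆ a, (r a + roundDown k x a) ∂(M.rewardLaw h s)
      ≤ ∫ r, ⨆ a, (r a + x a) ∂(M.rewardLaw h s) := integral_mono i2 i1 hle
  have e4 : ∫ r, ⨆ a, (r a + x a) ∂(M.rewardLaw h s)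
      ≤ ∫ r, ⨆ a, (r a + roundDown k x a) ∂(M.rewardLaw h s) + 1 / k := by
    refine (integral_mono i1 (i2.add (integrable_const _)) hge).trans_eq ?_
    rw [integral_add' i2 (integrable_const _)]
    simp
  refine abs_le.2 ⟨?_, ?_⟩
  · linarith [neg_abs_le (ξ.empR j h s (fun r => ⨆ a, (r a + roundDown k x a))
          - ∫ r, ⨆ a, (r a + roundDown k x a) ∂(M.rewardLaw h s))]
  · linarith [le_abs_self (ξ.empR j h s (fun r => ⨆ a, (r a + roundDown k x a))
          - ∫ r, ⨆ a, (r a + roundDown k x a) ∂(M.rewardLaw h s))]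

/-- The constant 3 of the bonus is split in halves: one covers `√2 ≤ 3/2` in the grid deviation, the
other the rounding error, because the visit count is at most `k`. -/
lemma sqrt_add_inv_le_bonusR (ξ : Trace S A) {h : ℕ} {s : S} {H : ℕ} (hH : 1 ≤ H)
    (hδ : δ ∈ Set.Ioo (0 : ℝ) 1) (hn : ξ.nS (k - 1) h s ≠ 0) :
    √(2 * (Fintype.card A * logFactor S A H δ k) / (2 * ξ.nS (k - 1) h s)) + 1 / k
      ≤ bonusR H δ ξ k h s := by
  have hnk := ξ.nS_le (k - 1) h s
  have hk : 1 ≤ k := by omega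
  have hA : (1 : ℝ) ≤ Fintype.card A := by exact_mod_cast Fintype.card_pos
  have hL := one_le_logFactor (S := S) (A := A) hH hδ hk
  have hk' : (0 : ℝ) < k := by exact_mod_cast hk
  have hn' : (1 : ℝ) ≤ ξ.nS (k - 1) h s := by exact_mod_cast Nat.one_le_iff_ne_zero.2 hn
  have hnk' : (ξ.nS (k - 1) h s : ℝ) ≤ k := by exact_mod_cast (by omega)
  rw [bonusR, max_natCast_one hn]
  set n : ℝ := (ξ.nS (k - 1) h s : ℝ)
  set x : ℝ := Fintype.card A * logFactor S A H δ k with hx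
  have hx1 : 1 ≤ x := one_le_mul_of_one_le_of_one_le hA hL
  have h1 : √(2 * x / (2 * n)) ≤ 3 / 2 * √(x / (2 * n)) := by
    rw [← sqrt_sq_mul (by norm_num), mul_div_assoc]
    have : 0 ≤ x / (2 * n) := by positivity
    exact Real.sqrt_le_sqrt (by linarith)
  have h2 : (1 : ℝ) / k ≤ 3 / 2 * √(x / (2 * n)) := by
    rw [← sqrt_sq_mul (by norm_num)]
    refine Real.le_sqrt_of_sq_le ?_
    have hkn : 1 / (k : ℝ) ≤ x / n := by gcongr
    have hk1 : 1 / (k : ℝ) ≤ 1 := by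
      rw [div_le_one hk']; exact_mod_cast hk
    have hk0 : 0 < 1 / (k : ℝ) := by positivity
    have e : x / (2 * n) = x / n / 2 := by rw [div_div, mul_comm]
    rw [e]
    nlinarith
  linarith

section Rates

variable {H : ℕ} (hH : 1 ≤ H) (hδ : δ ∈ Set.Ioo (0 : ℝ) 1) (hk : 1 ≤ k)
include hH hδ hk

lemma exp_neg_logFactor : Real.exp (-logFactor S A H δ k) = δ / (144 *
    (Fintype.card S : ℝ) ^ 2 * Fintype.card A * (H : ℝ) ^ 2 * (k : ℝ) ^ 3 * (k + 1)) := by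
  have hk' : (0 : ℝ) < k := by exact_mod_cast hk
  have hH' : (0 : ℝ) < H := by exact_mod_cast hH
  have hS : (0 : ℝ) < Fintype.card S := by exact_mod_cast Fintype.card_pos
  have hA : (0 : ℝ) < Fintype.card A := by exact_mod_cast Fintype.card_pos
  have := hδ.1
  rw [logFactor, Real.exp_neg, Real.exp_log (by positivity), inv_div]

/-- The number of grid points is compensated by the exponential rate. -/
lemma card_grid_mul_exp_le :
    ((2 * H * k + 1 : ℕ) : ℝ) ^ Fintype.card A
        * Real.exp (-(2 * (Fintype.card A * logFactor S A H δ k)))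
      ≤ Real.exp (-logFactor S A H δ k) := by
  have hk' : (1 : ℝ) ≤ k := by exact_mod_cast hk
  have hH' : (1 : ℝ) ≤ H := by exact_mod_cast hH
  have hS : (1 : ℝ) ≤ Fintype.card S := by exact_mod_cast Fintype.card_pos
  have hA : (1 : ℝ) ≤ Fintype.card A := by exact_mod_cast Fintype.card_pos
  have hL := one_le_logFactor (S := S) (A := A) hH hδ hk
  have h1 : ((2 * H * k + 1 : ℕ) : ℝ) ≤ Real.exp (logFactor S A H δ k) := by
    have := hδ.1
    rw [logFactor, Real.exp_log (by positivity), le_div_iff₀ hδ.1]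
    push_cast
    have hHk : 1 ≤ (H : ℝ) * k := one_le_mul_of_one_le_of_one_le hH' hk'
    calc (2 * (H : ℝ) * k + 1) * δ ≤ (2 * (H : ℝ) * k + 1) * 1 := by gcongr; exact hδ.2.le
      _ ≤ 144 * 1 ^ 2 * 1 * (H : ℝ) ^ 1 * (k : ℝ) ^ 1 * (0 + 1) := by nlinarith
      _ ≤ _ := by
        gcongr
        · norm_num
        · norm_num
        · linarith
  set L := logFactor S A H δ k
  calc _ ≤ Real.exp L ^ Fintype.card A * Real.exp (-(2 * (Fintype.card A * L))) := by gcongr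
    _ = Real.exp (-(Fintype.card A * L)) := by
        rw [← Real.exp_nat_mul, ← Real.exp_add]; ring_nf
    _ ≤ _ := by
        refine Real.exp_le_exp.2 ?_
        nlinarith

end Rates

section Failure

variable (hI : IsInteraction M μ ξ π) (hδ : δ ∈ Set.Ioo (0 : ℝ) 1) (hk : 1 ≤ k) {h : ℕ}
  (hh : h ∈ Set.Icc 1 M.H)
include hI hδ hk hh

lemma measure_not_transitionBound_le (s : S) (a : A) {W : S → ℝ} {B : ℝ} (hB : 0 < B)
    (hW : ∀ s, W s ∈ Set.Icc 0 B) :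
    μ {ω | ¬ TransitionBound M δ (ξ ω) k h s a W B}
      ≤ ENNReal.ofReal (2 * k * Real.exp (-logFactor S A M.H δ k)) := by
  have hL := one_le_logFactor (S := S) (A := A) M.one_le_H hδ hk
  refine (measure_mono ?_).trans ((hI.measure_empP_deviation (k - 1) hh s a hB hW
    (θ := logFactor S A M.H δ k) (by linarith)).trans ?_)
  · intro ω hω
    simpa [TransitionBound] using hω
  · rw [← ENNReal.ofReal_natCast, ← ENNReal.ofReal_ofNat 2, ← ENNReal.ofReal_mul (by norm_num),
      ← ENNReal.ofReal_mul (by positivity)]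
    refine ENNReal.ofReal_le_ofReal ?_
    have : ((k - 1 : ℕ) : ℝ) ≤ k := by exact_mod_cast Nat.sub_le k 1
    have h0 := Real.exp_pos (-logFactor S A M.H δ k)
    nlinarith

/-- The offsets used by the algorithm depend on the data, so the bound must be uniform over the
cube. The deviation is controlled on a grid of mesh `1/k`; its `(2Hk + 1)^A` points are paid for by
the exponent `2AL`. -/
lemma measure_not_reward_le (s : S) :
    μ {ω | ¬ ((ξ ω).nS (k - 1) h s ≠ 0 → ∀ x : A → ℝ, (∀ a, x a ∈ Set.Icc (0 : ℝ) (2 * M.H)) →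
      |(ξ ω).empR (k - 1) h s (fun r => ⨆ a, (r a + x a))
        - ∫ r, ⨆ a, (r a + x a) ∂(M.rewardLaw h s)| ≤ bonusR M.H δ (ξ ω) k h s)}
      ≤ ENNReal.ofReal (2 * k * Real.exp (-logFactor S A M.H δ k)) := by
  classical
  have hL := one_le_logFactor (S := S) (A := A) M.one_le_H hδ hk
  have hk' : (0 : ℝ) < k := by exact_mod_cast hk
  let y : (A → Fin (2 * M.H * k + 1)) → A → ℝ := fun g a => (g a : ℕ) / k
  have hp := measure_not_forall_le (μ := μ) (ι := A → Fin (2 * M.H * k + 1))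
    (p := fun g ω => ¬ ((ξ ω).nS (k - 1) h s ≠ 0 ∧
      √(2 * (Fintype.card A * logFactor S A M.H δ k) / (2 * (ξ ω).nS (k - 1) h s))
        < |(ξ ω).empR (k - 1) h s (fun r => ⨆ a, (r a + y g a))
          - ∫ r, ⨆ a, (r a + y g a) ∂(M.rewardLaw h s)|))
    (c := 2 * k * Real.exp (-(2 * (Fintype.card A * logFactor S A M.H δ k)))) fun g => by
      simp only [not_not]
      refine (hI.measure_empR_deviation (k - 1) hh s (measurable_iSup_add (y g))
        ((M.reward_mem h s).mono fun r hr => iSup_add_mem_Icc (y g) r hr)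
        (θ := 2 * (Fintype.card A * logFactor S A M.H δ k)) (by positivity)).trans ?_
      rw [← ENNReal.ofReal_natCast, ← ENNReal.ofReal_ofNat 2, ← ENNReal.ofReal_mul (by norm_num),
        ← ENNReal.ofReal_mul (by positivity)]
      refine ENNReal.ofReal_le_ofReal ?_
      have : ((k - 1 : ℕ) : ℝ) ≤ k := by exact_mod_cast Nat.sub_le k 1
      have h0 := Real.exp_pos (-(2 * (Fintype.card A * logFactor S A M.H δ k)))
      nlinarith
  refine (measure_mono ?_).trans (hp.trans (ENNReal.ofReal_le_ofReal ?_))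
  · intro ω hω hall
    refine hω fun hn x hx => ?_
    have hfl : ∀ a, ⌊k * x a⌋₊ < 2 * M.H * k + 1 := fun a => by
      rw [Nat.lt_succ_iff]
      refine Nat.floor_le_of_le ?_
      push_cast
      nlinarith [(hx a).2]
    have hg := hall fun a => ⟨⌊k * x a⌋₊, hfl a⟩
    have e : y (fun a => ⟨⌊k * x a⌋₊, hfl a⟩) = roundDown k x := rfl
    rw [e] at hg
    simp only [not_and, not_lt] at hg
    exact (abs_deviation_le_roundDown M (ξ ω) hn hk fun a => (hx a).1).trans
      ((add_le_add_left (hg hn) _).trans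
        (sqrt_add_inv_le_bonusR (ξ ω) M.one_le_H hδ hn))
  · have h1 := card_grid_mul_exp_le (S := S) (A := A) M.one_le_H hδ hk
    simp only [Fintype.card_fun, Fintype.card_fin, Nat.cast_pow]
    nlinarith

end Failure

/-- There are four families of conditions, each with at most `|S|² |A| H` members of failure
probability `2k exp(-L)`; this accounts for the 8. -/
lemma IsInteraction.measure_not_concentrated_le (hI : IsInteraction M μ ξ π)
    (hδ : δ ∈ Set.Ioo (0 : ℝ) 1) (hk : 1 ≤ k) :
    μ {ω | ¬ Concentrated M δ (ξ ω) k} ≤ ENNReal.ofReal (8 * ((Fintype.card S : ℝ) ^ 2 *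
      Fintype.card A * M.H * k * Real.exp (-logFactor S A M.H δ k))) := by
  have hS : (1 : ℝ) ≤ Fintype.card S := by exact_mod_cast Fintype.card_pos
  have hA : (1 : ℝ) ≤ Fintype.card A := by exact_mod_cast Fintype.card_pos
  have hH1 : (1 : ℝ) ≤ M.H := by exact_mod_cast M.one_le_H
  have h1 := measure_not_forall_Icc_le fun h hh =>
    measure_not_forall_le fun s => measure_not_reward_le hI hδ hk hh s
  have h2 := measure_not_forall_Icc_le fun h hh => measure_not_forall_le fun s =>
    measure_not_forall_le fun a => measure_not_transitionBound_le hI hδ hk hh s a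
      (W := M.optValue (h + 1)) (by linarith) fun s' => M.optValue_mem (by omega) s'
  have h3 := measure_not_forall_Icc_le fun h (hh : h ∈ Set.Icc 1 M.H) =>
    measure_not_forall_le fun s => measure_not_forall_le fun a =>
      measure_not_transitionBound_le hI hδ hk hh s a (W := optSqDev M h s a)
        (B := (M.H : ℝ) ^ 2) (by positivity) fun s' => optSqDev_mem hh.1 s a s'
  have h4 := measure_not_forall_Icc_le fun h hh => measure_not_forall_le fun s =>
    measure_not_forall_le fun a => measure_not_forall_le fun s' =>
      measure_not_transitionBound_le hI hδ hk hh s a (W := Set.indicator {s'} 1)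
        one_pos fun s'' => ⟨Set.indicator_nonneg (fun _ _ => zero_le_one) _,
          Set.indicator_le_self' (fun _ _ => zero_le_one) _⟩
  have hsub : {ω | ¬ Concentrated M δ (ξ ω) k} ⊆ _ ∪ (_ ∪ (_ ∪ _)) := fun ω hω => by
    by_contra hcon
    simp only [Set.mem_union, not_or] at hcon
    exact hω ⟨not_not.1 hcon.1, not_not.1 hcon.2.1, not_not.1 hcon.2.2.1, not_not.1 hcon.2.2.2⟩
  refine (measure_mono hsub).trans ((measure_union_le _ _).trans ((add_le_add h1
    ((measure_union_le _ _).trans (add_le_add h2 ((measure_union_le _ _).trans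
      (add_le_add h3 h4))))).trans ?_))
  have hk0 : (0 : ℝ) ≤ k := by positivity
  set x := Real.exp (-logFactor S A M.H δ k) with hx
  have hx0 : 0 < x := Real.exp_pos _
  rw [← ENNReal.ofReal_add (by positivity) (by positivity),
    ← ENNReal.ofReal_add (by positivity) (by positivity),
    ← ENNReal.ofReal_add (by positivity) (by positivity)]
  refine ENNReal.ofReal_le_ofReal ?_
  set σ : ℝ := ((Fintype.card S : ℕ) : ℝ)
  set a : ℝ := ((Fintype.card A : ℕ) : ℝ)
  have e1 : σ * 1 * (M.H * k * x) ≤ σ ^ 2 * a * (M.H * k * x) := by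
    gcongr; exact le_self_pow₀ hS (by norm_num)
  have e2 : σ * a * (M.H * k * x) ≤ σ ^ 2 * a * (M.H * k * x) := by
    gcongr; exact le_self_pow₀ hS (by norm_num)
  nlinarith

end

/-! ### Noise events, union bound over the episodes and conclusion -/

section

variable {S A Ω : Type*} [Fintype S] [MeasurableSpace S] [MeasurableSingletonClass S]
  [Fintype A] [MeasurableSpace A] [MeasurableSingletonClass A] [Nonempty S] [Nonempty A]
  [MeasurableSpace Ω] {μ : Measure Ω} [IsProbabilityMeasure μ] {M : MDP S A}
  {ξ : Ω → Trace S A} {π : ℕ → Ω → DetPolicy S A} {δ : ℝ} {K : ℕ}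

lemma neg_mul_mem_Icc {w e b c x : ℝ} (hw : w ∈ Set.Icc 0 e) (hb : 0 ≤ b) (hc : 0 ≤ c)
    (hx : x ∈ Set.Icc (-b) c) : -w * x ∈ Set.Icc (-(e * c)) (e * b) := by
  have h1 : w * c ≤ e * c := mul_le_mul_of_nonneg_right hw.2 hc
  have h2 : w * b ≤ e * b := mul_le_mul_of_nonneg_right hw.2 hb
  have h3 := mul_le_mul_of_nonneg_left hx.1 hw.1
  have h4 := mul_le_mul_of_nonneg_left hx.2 hw.1
  constructor <;> linarith

/-- The noise in the regret decomposition is small with high probability. The optimistic values are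
replaced by their positive parts, which are always bounded. -/
lemma IsInteraction.measure_gapNoise_le (hI : IsInteraction M μ ξ π)
    (hδ : δ ∈ Set.Ioo (0 : ℝ) 1) (hK : 1 ≤ K) :
    μ {ω | (∀ k ∈ Finset.Icc 1 K, Concentrated M δ (ξ ω) k) ∧
        3 * M.H * Real.exp 9 * √(K * M.H * logFactor S A M.H δ K)
          < ∑ k ∈ Finset.Icc 1 K, ∑ h ∈ Finset.Icc 1 M.H, gapNoise M δ (ξ ω) (π k ω) k h}
      ≤ ENNReal.ofReal (Real.exp (-logFactor S A M.H δ K)) := by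
  have hH1 : (1 : ℝ) ≤ M.H := by exact_mod_cast M.one_le_H
  have hw0 : ∀ n ≤ M.H, (1 + 9 / (M.H : ℝ)) ^ n ∈ Set.Icc 0 (Real.exp 9) := fun n hn =>
    ⟨by positivity, weight_le n hn⟩
  let V : ℕ → ℕ → Ω → S → ℝ := fun k h ω s => max (optimisticValue M.H δ (ξ ω) k h s) 0
  let u : ℕ → ℕ → Ω → S → A → ℝ := fun k h ω s a => -(1 + 9 / (M.H : ℝ)) ^ (h - 1) *
    (bonusP M.H δ (ξ ω) k h (optimisticValue M.H δ (ξ ω) k (h + 1)) s a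
      + mean ((ξ ω).empP (k - 1) h s a) (V k (h + 1) ω)
      - mean (M.tr h s a) (M.value (π k ω).toPolicy (h + 1)))
  let w : ℕ → ℕ → Ω → S → ℝ := fun k h ω s => -(1 + 9 / (M.H : ℝ)) ^ h *
    (V k (h + 1) ω s - M.value (π k ω).toPolicy (h + 1) s)
  have hV : ∀ k h ω s, V k h ω s ∈ Set.Icc (0 : ℝ) M.H := fun k h ω s =>
    ⟨le_max_right _ _, max_le (optimisticValue_le s) (by linarith)⟩
  have hVm : ∀ k h, 1 ≤ h → ∀ s, Measurable[pastOfRewards M.H ξ k 1] fun ω => V k h ω s :=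
    fun k h hh s => (measurable_optimisticValue_pastOfRewards hh s).max
      (@measurable_const _ _ _ (pastOfRewards M.H ξ k 1) _)
  have hpm : ∀ k ≥ 1, ∀ h ∈ Set.Icc 1 M.H, ∀ s, Measurable[pastOfRewards M.H ξ k 1]
      fun ω => M.value (π k ω).toPolicy (h + 1) s := fun k hk h hh s =>
    hI.measurable_value_pastOfRewards hk ⟨by omega, by have := hh.2; omega⟩ s
  -- The score gap lies in `[-H, 2H]` and the value gap in `[-H, H]`. With weights in `[-e⁹, 0]`
  -- both land in an interval of length `3H e⁹`.
  have key := hI.measure_noise_le K hK u w ?_ ?_ (a := -(Real.exp 9 * (2 * M.H)))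
    (a' := -(Real.exp 9 * (2 * M.H))) (c := 3 * M.H * Real.exp 9) (by positivity) ?_ ?_
    (θ := logFactor S A M.H δ K)
    (zero_le_one.trans (one_le_logFactor (S := S) (A := A) M.one_le_H hδ hK))
  · refine (measure_mono fun ω hω => ?_).trans key
    refine hω.2.le.trans_eq (Finset.sum_congr rfl fun k hk => Finset.sum_congr rfl fun h hh => ?_)
    rw [Finset.mem_Icc] at hh
    -- On the good event optimism makes these values nonnegative, so taking positive parts changes
    -- nothing.
    have e : V k (h + 1) ω = optimisticValue M.H δ (ξ ω) k (h + 1) := funext fun s =>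
      max_eq_left ((M.optValue_mem (by omega) s).1.trans
        (optValue_le_optimisticValue (hω.1 k hk) hδ (Finset.mem_Icc.1 hk).1
          ⟨by omega, by omega⟩ s))
    simp only [gapNoise, scoreGap, valueGap, u, w, e]
  · intro k hk h hh s a
    refine (@measurable_const _ _ _ (pastOfRewards M.H ξ k 1) _).mul
      (((measurable_bonusP_pastOfRewards hh s a).add ?_).sub ?_)
    · exact @MeasurableData.measurable_mean_empP S A _ _ _ _ _ _ Ω (pastOfRewards M.H ξ k 1) M.H k h ξ
        (measurableData_pastOfRewards M.H k ξ) hh _ (fun s => hVm k (h + 1) (by omega) s) s a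
    · exact Finset.measurable_fun_sum _ fun s' _ =>
        (@measurable_const _ _ _ (pastOfRewards M.H ξ k 1) _).mul (hpm k hk h hh s')
  · intro k hk h hh s
    exact (@measurable_const _ _ _ (pastOfRewards M.H ξ k 1) _).mul
      ((hVm k (h + 1) (by omega) s).sub (hpm k hk h hh s))
  · intro k hk h hh ω s a
    have hL := one_le_logFactor (S := S) (A := A) M.one_le_H hδ hk
    have h1 := bonusP_mem (H := M.H) (ξ := ξ ω) (h := h) (zero_le_one.trans hL)
      (optimisticValue M.H δ (ξ ω) k (h + 1)) s a
    have h2 := (ξ ω).mean_empP_mem (k - 1) h s a (by linarith) (hV k (h + 1) ω)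
    have h3 := M.mean_tr_mem h s a fun s' => M.value_mem (π k ω).toPolicy (h + 1) (by omega) s'
    have h4 := neg_mul_mem_Icc (hw0 (h - 1) (by have := hh.2; omega)) (b := M.H) (c := 2 * M.H)
      (x := bonusP M.H δ (ξ ω) k h (optimisticValue M.H δ (ξ ω) k (h + 1)) s a
      + mean ((ξ ω).empP (k - 1) h s a) (V k (h + 1) ω)
      - mean (M.tr h s a) (M.value (π k ω).toPolicy (h + 1))) (by linarith) (by linarith)
      ⟨by linarith [h1.1, h2.1, h3.2], by linarith [h1.2, h2.2, h3.1]⟩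
    exact ⟨h4.1, h4.2.trans_eq (by ring)⟩
  · intro k hk h hh ω s
    have h2 := hV k (h + 1) ω s
    have h3 := M.value_mem (π k ω).toPolicy (h + 1) (by omega) s
    have h4 := neg_mul_mem_Icc (hw0 h hh.2) (b := M.H) (c := 2 * M.H)
      (x := V k (h + 1) ω s - M.value (π k ω).toPolicy (h + 1) s) (by linarith) (by linarith)
      ⟨by linarith [h2.1, h3.2], by linarith [h2.2, h3.1]⟩
    exact ⟨h4.1, h4.2.trans_eq (by ring)⟩

/-- The noise in the decomposition of the variances is small with high probability. -/
lemma IsInteraction.measure_varNoise_le (hI : IsInteraction M μ ξ π)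
    (hδ : δ ∈ Set.Ioo (0 : ℝ) 1) (hK : 1 ≤ K) :
    μ {ω | (M.H : ℝ) ^ 2 * √(K * M.H * logFactor S A M.H δ K)
          < ∑ k ∈ Finset.Icc 1 K, ∑ h ∈ Finset.Icc 1 M.H, varNoise M (ξ ω) (π k ω) k h}
      ≤ ENNReal.ofReal (Real.exp (-logFactor S A M.H δ K)) := by
  have hH1 : (1 : ℝ) ≤ M.H := by exact_mod_cast M.one_le_H
  have hpm : ∀ k ≥ 1, ∀ h ∈ Set.Icc 1 M.H, ∀ s, Measurable[pastOfRewards M.H ξ k 1]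
      fun ω => M.value (π k ω).toPolicy (h + 1) s := fun k hk h hh s =>
    hI.measurable_value_pastOfRewards hk ⟨by omega, by have := hh.2; omega⟩ s
  have hsq : ∀ {x : ℝ}, x ∈ Set.Icc (0 : ℝ) M.H →
      -x ^ 2 ∈ Set.Icc (-(M.H : ℝ) ^ 2) (-(M.H : ℝ) ^ 2 + (M.H : ℝ) ^ 2) := fun {x} hx => by
    have := pow_le_pow_left₀ hx.1 hx.2 2
    have := sq_nonneg x
    constructor <;> linarith
  refine (measure_mono fun ω hω => ?_).trans (hI.measure_noise_le K hK
    (fun k h ω s a => -(mean (M.tr h s a) (M.value (π k ω).toPolicy (h + 1))) ^ 2)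
    (fun k h ω s => -(M.value (π k ω).toPolicy (h + 1) s) ^ 2)
    (fun k hk h hh s a => ((Finset.measurable_fun_sum _ fun s' _ =>
        (@measurable_const _ _ _ (pastOfRewards M.H ξ k 1) _).mul (hpm k hk h hh s')).pow_const 2).neg)
    (fun k hk h hh s => ((hpm k hk h hh s).pow_const 2).neg)
    (a := -(M.H : ℝ) ^ 2) (a' := -(M.H : ℝ) ^ 2) (c := (M.H : ℝ) ^ 2) (by positivity)
    (fun k _ h _ ω s a => hsq (M.mean_tr_mem h s a fun s' =>
      M.value_mem (π k ω).toPolicy (h + 1) (by omega) s'))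
    (fun k _ h _ ω s => hsq (M.value_mem (π k ω).toPolicy (h + 1) (by omega) s))
    (θ := logFactor S A M.H δ K)
    (zero_le_one.trans (one_le_logFactor (S := S) (A := A) M.one_le_H hδ hK)))
  exact (Set.mem_ofPred.1 hω).le

/-- The event that one of the inequalities needed in episode `K` fails. -/
def failure (M : MDP S A) (δ : ℝ) (ξ : Ω → Trace S A) (π : ℕ → Ω → DetPolicy S A) (K : ℕ) : Set Ω :=
  {ω | ¬ Concentrated M δ (ξ ω) K}
    ∪ ({ω | (∀ k ∈ Finset.Icc 1 K, Concentrated M δ (ξ ω) k) ∧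
        3 * M.H * Real.exp 9 * √(K * M.H * logFactor S A M.H δ K)
          < ∑ k ∈ Finset.Icc 1 K, ∑ h ∈ Finset.Icc 1 M.H, gapNoise M δ (ξ ω) (π k ω) k h}
    ∪ {ω | (M.H : ℝ) ^ 2 * √(K * M.H * logFactor S A M.H δ K)
          < ∑ k ∈ Finset.Icc 1 K, ∑ h ∈ Finset.Icc 1 M.H, varNoise M (ξ ω) (π k ω) k h})

lemma IsInteraction.measure_failure_le (hI : IsInteraction M μ ξ π)
    (hδ : δ ∈ Set.Ioo (0 : ℝ) 1) (hK : 1 ≤ K) :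
    μ (failure M δ ξ π K) ≤ ENNReal.ofReal (δ / K - δ / (K + 1)) := by
  refine (measure_union_le _ _).trans ((add_le_add (hI.measure_not_concentrated_le hδ hK)
    ((measure_union_le _ _).trans (add_le_add (hI.measure_gapNoise_le hδ hK)
      (hI.measure_varNoise_le hδ hK)))).trans ?_)
  rw [← ENNReal.ofReal_add (by positivity) (by positivity),
    ← ENNReal.ofReal_add (by positivity) (by positivity)]
  refine ENNReal.ofReal_le_ofReal ?_
  have hS : (1 : ℝ) ≤ Fintype.card S := by exact_mod_cast Fintype.card_pos
  have hA : (1 : ℝ) ≤ Fintype.card A := by exact_mod_cast Fintype.card_pos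
  have hH1 : (1 : ℝ) ≤ M.H := by exact_mod_cast M.one_le_H
  have hK1 : (1 : ℝ) ≤ K := by exact_mod_cast hK
  rw [exp_neg_logFactor (S := S) (A := A) M.one_le_H hδ hK]
  set D : ℝ := (Fintype.card S : ℝ) ^ 2 * Fintype.card A * M.H * K with hD
  have hD1 : 1 ≤ D := one_le_mul_of_one_le_of_one_le (one_le_mul_of_one_le_of_one_le
    (one_le_mul_of_one_le_of_one_le (one_le_pow₀ hS) hA) hH1) hK1
  have e : 144 * (Fintype.card S : ℝ) ^ 2 * Fintype.card A * (M.H : ℝ) ^ 2 * (K : ℝ) ^ 3 * (K + 1)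
      = 144 * D * (M.H * K) * (K * (K + 1)) := by rw [hD]; ring
  have hHK : 1 ≤ (M.H : ℝ) * K := one_le_mul_of_one_le_of_one_le hH1 hK1
  have hδ0 := hδ.1
  rw [e]
  -- `8D` counts the concentration failures and 2 the noise events. The remainder `δ / (K (K + 1))`
  -- is written as a difference so that it telescopes over `K`.
  calc _ = (8 * D + 2) * (δ / (144 * D * (M.H * K) * (K * (K + 1)))) := by ring
    _ ≤ (144 * D * 1) * (δ / (144 * D * (M.H * K) * (K * (K + 1)))) := by gcongr; linarith
    _ ≤ (144 * D * (M.H * K)) * (δ / (144 * D * (M.H * K) * (K * (K + 1)))) := by gcongr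
    _ = δ / K - δ / (K + 1) := by field_simp; ring

lemma IsInteraction.measure_iUnion_failure_le (hI : IsInteraction M μ ξ π)
    (hδ : δ ∈ Set.Ioo (0 : ℝ) 1) :
    μ (⋃ n : ℕ, failure M δ ξ π (n + 1)) ≤ ENNReal.ofReal δ := by
  refine (measure_iUnion_le _).trans (ENNReal.tsum_le_of_sum_range_le fun n => ?_)
  have hδ0 := hδ.1
  have hterm : ∀ i : ℕ, 0 ≤ δ / (i + 1 : ℕ) - δ / ((i + 1 : ℕ) + 1) := fun i => by
    rw [sub_nonneg]; gcongr; linarith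
  refine (Finset.sum_le_sum fun i _ => hI.measure_failure_le hδ (Nat.le_add_left 1 i)).trans ?_
  rw [← ENNReal.ofReal_sum_of_nonneg fun i _ => hterm i]
  refine ENNReal.ofReal_le_ofReal ?_
  have := Finset.sum_range_sub' (fun i : ℕ => δ / ((i : ℝ) + 1)) n
  push_cast at this ⊢
  rw [this]
  have : 0 ≤ δ / ((n : ℝ) + 1) := by positivity
  simp only [zero_add, div_one]
  linarith

/-- The regret bound, outside of the failure events. -/
lemma regret_le_of_notMem_failure (hδ : δ ∈ Set.Ioo (0 : ℝ) 1) (hK : 1 ≤ K) {ω : Ω}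
    (hω : ∀ k ∈ Finset.Icc 1 K, ω ∉ failure M δ ξ π k)
    (hπ : ∀ k ≥ 1, IsMVPRLPolicy M.H δ (ξ ω) k (π k ω)) :
    regret M (fun k => (ξ ω).state k 1) (fun k => π k ω) K
      ≤ Real.exp 9 * 17407 * (√((M.H : ℝ) ^ 3 * Fintype.card S * Fintype.card A * K)
            * Real.log (Fintype.card S * Fintype.card A * M.H * K / δ)
          + (M.H : ℝ) ^ 3 * (Fintype.card S : ℝ) ^ 2 * Fintype.card A
            * Real.log (Fintype.card S * Fintype.card A * M.H * K / δ) ^ 2) := by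
  have hS : 1 ≤ Fintype.card S := Fintype.card_pos
  have hA : 1 ≤ Fintype.card A := Fintype.card_pos
  have hS' : (1 : ℝ) ≤ Fintype.card S := by exact_mod_cast hS
  have hA' : (1 : ℝ) ≤ Fintype.card A := by exact_mod_cast hA
  have hH1 : (1 : ℝ) ≤ M.H := by exact_mod_cast M.one_le_H
  have hK1 : (1 : ℝ) ≤ K := by exact_mod_cast hK
  have hδ0 := hδ.1
  have hlog : 0 ≤ Real.log (Fintype.card S * Fintype.card A * M.H * K / δ) := by
    refine Real.log_nonneg ?_
    rw [le_div_iff₀ hδ0, one_mul]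
    exact hδ.2.le.trans (one_le_mul_of_one_le_of_one_le (one_le_mul_of_one_le_of_one_le
      (one_le_mul_of_one_le_of_one_le hS' hA') hH1) hK1)
  -- If SAHK = 1, the logarithmic factor is not controlled by the logarithm in the bound, but the
  -- regret is zero.
  by_cases h2 : 2 ≤ Fintype.card S * Fintype.card A * M.H * K
  · have hc : ∀ k ∈ Finset.Icc 1 K, Concentrated M δ (ξ ω) k := fun k hk => by
      by_contra hcon
      exact hω k hk (Or.inl hcon)
    -- Concentration is needed in every episode up to `K`, the noise bounds only at the final `K`.
    have hKK := hω K (Finset.mem_Icc.2 ⟨hK, le_rfl⟩)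
    have hgap := not_lt.1 fun hlt => hKK (Or.inr (Or.inl ⟨hc, hlt⟩))
    have hvar : ω ∉ {ω | _ < _} := fun hlt => hKK (Or.inr (Or.inr hlt))
    rw [Set.mem_ofPred, not_lt] at hvar
    have hreg := regret_le_of_concentrated (π := fun k => π k ω) hδ hK hc
      (fun k hk => hπ k (Finset.mem_Icc.1 hk).1) hgap hvar
    have hL := logFactor_le (S := S) (A := A) M.one_le_H hδ hK (by exact_mod_cast h2)
    have hL0 := one_le_logFactor (S := S) (A := A) M.one_le_H hδ hK
    set ℓ := Real.log (Fintype.card S * Fintype.card A * M.H * K / δ)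
    set L := logFactor S A M.H δ K
    refine hreg.trans ?_
    rw [mul_assoc (Real.exp 9)]
    refine mul_le_mul_of_nonneg_left ?_ (Real.exp_pos 9).le
    set Y := √((M.H : ℝ) ^ 3 * Fintype.card S * Fintype.card A * K)
    set Z := (M.H : ℝ) ^ 3 * (Fintype.card S : ℝ) ^ 2 * Fintype.card A
    have hY : 0 ≤ Y := Real.sqrt_nonneg _
    have hZ : 0 ≤ Z := by positivity
    -- `585 = 45 · 13` and `17407 = 103 · 13²`.
    calc 45 * (Y * L) + 103 * (Z * L ^ 2)
        ≤ 45 * (Y * (13 * ℓ)) + 103 * (Z * (13 * ℓ) ^ 2) := by gcongr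
      _ = 585 * (Y * ℓ) + 17407 * (Z * ℓ ^ 2) := by ring
      _ ≤ 17407 * (Y * ℓ) + 17407 * (Z * ℓ ^ 2) := by gcongr; norm_num
      _ = _ := by ring
  · have hA1 : Fintype.card A ≤ 1 := by
      by_contra hA2
      refine h2 ?_
      calc 2 = 1 * 2 * 1 * 1 := by norm_num
        _ ≤ _ := by
          gcongr
          · omega
          · exact M.one_le_H
    haveI : Subsingleton A := Fintype.card_le_one_iff_subsingleton.1 hA1
    have h0 : regret M (fun k => (ξ ω).state k 1) (fun k => π k ω) K = 0 :=
      Finset.sum_eq_zero fun k _ => by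
        rw [M.optValue_eq_value_of_subsingleton (π k ω).toPolicy, sub_self]
    rw [h0]
    positivity

end

end RewardLookahead

end

/-- There is an absolute constant `C` such that, for every environment and every run of MVP-RL in it,
the event that the regret exceeds the bound for some `K` has (outer) probability at most `δ`. -/
theorem mainTheorem1 :
    ∃ C : ℝ, 0 < C ∧
      ∀ {S A Ω : Type*} [Fintype S] [MeasurableSpace S] [MeasurableSingletonClass S]
        [Fintype A] [Nonempty A] [MeasurableSpace A] [MeasurableSingletonClass A]
        [MeasurableSpace Ω] (μ : Measure Ω) [IsProbabilityMeasure μ]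
        (M : RewardLookahead.MDP S A) (δ : ℝ) (_ : δ ∈ Set.Ioo (0 : ℝ) 1)
        (ξ : Ω → RewardLookahead.Trace S A) (π : ℕ → Ω → RewardLookahead.DetPolicy S A)
        (_ : RewardLookahead.IsInteraction M μ ξ π)
        (_ : ∀ k ≥ 1, ∀ ω, RewardLookahead.IsMVPRLPolicy M.H δ (ξ ω) k (π k ω)),
        μ {ω | ¬ ∀ K ≥ 1,
            RewardLookahead.regret M (fun k => (ξ ω).state k 1) (fun k => π k ω) K
              ≤ C * (√((M.H : ℝ) ^ 3 * Fintype.card S * Fintype.card A * K)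
                    * Real.log (Fintype.card S * Fintype.card A * M.H * K / δ)
                  + (M.H : ℝ) ^ 3 * (Fintype.card S : ℝ) ^ 2 * Fintype.card A
                    * Real.log (Fintype.card S * Fintype.card A * M.H * K / δ) ^ 2)}
          ≤ ENNReal.ofReal δ := by
  refine ⟨Real.exp 9 * 17407, by positivity, ?_⟩
  intro S A Ω _ _ _ _ _ _ _ _ μ _ M δ hδ ξ π hI hπ
  -- A probability space has a point, and any trace contains a state, so `S` is nonempty.
  haveI : Nonempty S := (nonempty_of_isProbabilityMeasure μ).map fun ω => (ξ ω).state 0 0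
  refine (measure_mono fun ω hω => ?_).trans (hI.measure_iUnion_failure_le hδ)
  by_contra hcon
  simp only [Set.mem_iUnion, not_exists] at hcon
  refine hω fun K hK => RewardLookahead.regret_le_of_notMem_failure (ξ := ξ) (π := π) hδ hK
    (fun k hk => ?_) fun k hk => hπ k hk ω
  have := hcon (k - 1)
  rwa [Nat.sub_add_cancel (Finset.mem_Icc.1 hk).1] at this
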